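/- **Setting.** Let $T\ge 2$, $\delta\in(0,1)$ and $q_1,\dots,q_T\in[0,1]$ be fixed in advance. In round $t$ the outcome $y_t\sim\mathrm{Ber}(q_t)$ is drawn and, independently of it given the past, the forecaster predicts $p_t\in[0,1]$; then $y_t$ is revealed. Put $$\mathrm{Cal}_1=\sum_{p:\,n(p)>0} n(p)\Big|\frac1{n(p)}\sum_{t=1}^T (y_t-p_t)\mathbf 1[p_t=p]\Big|,\quad n(p)=\sum_{t=1}^T\mathbf 1[p_t=p],\qquad C=\min_{p\in[0,1]}\sum_{t=1}^T|q_t-p|,$$ $$\iota=\log(T/\delta),\qquad N=\Big\lceil\min\Big\{\sqrt{\tfrac{T}{\iota\log T}},\Big(\tfrac{T^2}{\iota(1+C)\log T}\Big)^{1/3}\Big\}\Big\rceil .$$ **Algorithm** ($T$ and $N$ are given; computing $N$ uses $C$). Partition $[0,1]$ into $J_i=[\frac{i-1}N,\frac iN)$ for $i<N$ and $J_N=[1-\frac1N,1]$. There are $d=2N$ experts $(i,\sigma)\in[N]\times\{\pm1\}$ with weights $\omega_t$, where $\omega_1$ is uniform. In round $t$ let $\Phi_t(u)=\sum_{(i,\sigma)}\omega_{t,i,\sigma}\,\sigma\,\mathbf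 1[u\in J_i]$. Let $P_t$ be the point mass at $0$ if $\Phi_t(0)>0$; otherwise the point mass at $1$ if $\Phi_t(1)\le 0$; otherwise choose $k\in\{0,\dots,T-1\}$ with $\Phi_t(\frac kT)\Phi_t(\frac{k+1}T)\le0$ and let $P_t$ be supported on $\{\frac kT,\frac{k+1}T\}$ with $$P_t(\tfrac kT)=\frac{|\Phi_t(\frac{k+1}T)|}{|\Phi_t(\frac kT)|+|\Phi_t(\frac{k+1}T)|}$$ (arbitrary if both potentials vanish). Sample $\tilde p_t\sim P_t$ and predict $p_t=i_t/N$, where $\tilde p_t\in J_{i_t}$. After $y_t$ is seen, feed the loss vector $\ell_{t,i,\sigma}=-\mathbb E_{u\sim P_t}[\sigma\mathbf 1[u\in J_i](u-y_t)]$ to the expert algorithm MsMwC, that is, for the experts $e=(i,\sigma)$ set $$\omega_{t+1}=\operatorname*{argmin}_{w\in\Omega}\ \sum_e w_e(\ell_{t,e}+32\eta_{t,e}\ell_{t,e}^2)+\sum_e\frac1{\eta_{t,e}}\Big(w_e\log\frac{w_e}{\omega_{t,e}}-w_e+\omega_{t,e}\Big),$$ $$\eta_{t,e}=\min\Big\{\tfrac1{64},\sqrt{\log(dT)\big/\textstyle\sum_{s<t}\ell_{s,e}^2}\Big\},\qquad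 \Omega=\Big\{w:\ \sum_e w_e=1,\ w_e\ge\tfrac1{dT}\text{ for all } e\Big\}.$$ An update is *$\varepsilon$-accurate* if $\omega_{t+1}\in\Omega$ differs in every coordinate by at most $\varepsilon$ from the minimizer; the exact algorithm is the case $\varepsilon=0$. **Theorem.** There are absolute constants $a,b,c\in\mathbb N$ and $K>0$ such that for all $T\ge2$, $\delta\in(0,1)$ and $q_1,\dots,q_T\in[0,1]$ the following hold. 1. For every $\varepsilon\in[0,T^{-a}]$ (in particular for the exact algorithm, $\varepsilon=0$), the algorithm with $\varepsilon$-accurate updates, whatever admissible choices of $k$ are made, satisfies with probability at least $1-\delta$ $$\mathrm{Cal}_1\le K\Big(\sqrt{\iota T\log T}+(\iota TC\log T)^{1/3}\Big).$$ 2. There is one program, independent of $T,\delta,q$, for a random access machine with unit-cost exact real arithmetic ($+,-,\times,/,\exp,\log,\sqrt{\cdot}$ and comparisons, without rounding) and integer words of size at most $T^b$, that on input $(T,N)$ runs the algorithm with $T^{-a}$-accurate updates, where tossing a coin of a computed bias is free. For all outcomes, its initialization and each of its rounds take at most $$K\,\min\Big\{\sqrt T,\Big(\frac{T^2}{1+C}\Big)^{1/3}\Big\}(\log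 T)^{c}$$ steps, that is, $\widetilde O(\min\{\sqrt T,(T^2/C)^{1/3}\})$ steps per round. -/

import Mathlib

noncomputable section

namespace OnlineCalibration

/-! ### The prediction problem: calibration error and non-stationarity -/

/-- The numerical value of a binary outcome. -/
def outcome (y : Bool) : ℝ := if y then 1 else 0

/-- The number of rounds in which the forecast `p` was made;
a play is a list of (outcome, forecast) pairs, one for every round. -/
def visits (l : List (Bool × ℝ)) (p : ℝ) : ℕ := (l.map Prod.snd).count p

/-- The `ℓ₁`-calibration error
`∑_{p : n(p) > 0} n(p) * |(1 / n(p)) * ∑_t (y_t - p_t) 1[p_t = p]|`. -/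
def calError (l : List (Bool × ℝ)) : ℝ :=
  ∑ p ∈ (l.map Prod.snd).toFinset,
    (visits l p : ℝ) *
      |1 / (visits l p : ℝ) * (l.map fun r => if r.2 = p then outcome r.1 - r.2 else 0).sum|

/-- The minimal `ℓ₁` deviation `C = min_{p ∈ [0,1]} ∑_{t < T} |q_t - p|` of the outcome means
(the minimum is attained, so the infimum is a minimum; rounds are numbered `0, …, T - 1`). -/
def deviation (T : ℕ) (q : ℕ → unitInterval) : ℝ :=
  ⨅ p : unitInterval, ∑ t ∈ Finset.range T, |(q t : ℝ) - (p : ℝ)|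

/-- The confidence factor `ι = log (T / δ)`. -/
def confidence (T : ℕ) (δ : ℝ) : ℝ := Real.log (T / δ)

/-- `N = ⌈min {√(T / (ι log T)), (T² / (ι (1 + C) log T))^(1/3)}⌉`. -/
def gridSize (T : ℕ) (δ C : ℝ) : ℕ :=
  ⌈min (√(T / (confidence T δ * Real.log T)))
    (((T : ℝ) ^ 2 / (confidence T δ * (1 + C) * Real.log T)) ^ (1 / 3 : ℝ))⌉₊

/-- The uniform partition of `[0,1]` into `N` intervals; the last one is closed. -/
def uniformPartition (N : ℕ) (i : Fin N) : Set ℝ :=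
  if (i : ℕ) + 1 = N then Set.Icc ((i : ℝ) / N) 1 else Set.Ico ((i : ℝ) / N) (((i : ℝ) + 1) / N)

/-- The forecast made from the sampled point `u`: the right end point `sup J_i` of the interval
`J_i` of the partition that contains `u` (the sum has exactly one non-zero indicator). -/
def forecast {N : ℕ} (J : Fin N → Set ℝ) (u : ℝ) : ℝ :=
  ∑ i, (J i).indicator (fun _ => sSup (J i)) u

/-! ### The expert algorithm MsMwC

Multi-scale multiplicative weights with correction, for losses in `[-1,1]` and with all loss
predictions equal to zero (then the played weights are the iterates themselves). -/

/-- The truncated simplex `{w : w_e ≥ 1 / (d T), ∑ w_e = 1}`, where `d` is the number of experts. -/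
def truncSimplex (E : Type) [Fintype E] (T : ℕ) : Set (E → ℝ) :=
  {w | (∀ e, 1 / ((Fintype.card E : ℝ) * T) ≤ w e) ∧ ∑ e, w e = 1}

/-- The learning rate `min {1 / 64, √(log (d T) / V)}` of an expert whose past losses have the sum
of squares `V` (written so that it is `1 / 64` for `V = 0`). -/
def learningRate (E : Type) [Fintype E] (T : ℕ) (V : ℝ) : ℝ :=
  1 / max 64 (√(V / Real.log ((Fintype.card E : ℝ) * T)))

/-- The objective `⟨w, g⟩ + D_ψ(w, v)` of a mirror descent step from `v`, where `D_ψ` is the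
Bregman divergence of `ψ(w) = ∑ (1 / η_e) w_e log w_e`. -/
def mirrorObjective {E : Type} [Fintype E] (η g v w : E → ℝ) : ℝ :=
  ∑ e, w e * g e + ∑ e, 1 / η e * (w e * Real.log (w e / v e) - w e + v e)

/-- `w'` is an update of the weights `w` after the loss vector `l`, if the squares of the earlier
losses of expert `e` sum to `V e`: it lies in the truncated simplex, and differs in no coordinate by
more than `ε` from the minimizer of the mirror descent objective with the corrected loss
`l_e + 32 η_e l_e²`. For `ε = 0` this is the update of MsMwC itself. -/
def IsMsMwCUpdate {E : Type} [Fintype E] (T : ℕ) (ε : ℝ) (V l w w' : E → ℝ) : Prop :=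
  w' ∈ truncSimplex E T ∧ ∃ v ∈ truncSimplex E T,
    IsMinOn (mirrorObjective (fun e => learningRate E T (V e))
      (fun e => l e + 32 * learningRate E T (V e) * l e ^ 2) w) (truncSimplex E T) v ∧
    ∀ e, |w' e - v e| ≤ ε

/-! ### The calibration algorithm -/

/-- Experts are pairs of an interval of the partition and a sign. -/
abbrev Expert (N : ℕ) : Type := Fin N × ℤˣ

/-- What happens in a round: the outcome, and the index `k` of the point `k / T` that the
forecaster samples. -/
abbrev Round (T : ℕ) : Type := Bool × Fin (T + 1)

/-- The grid point `k / T`. -/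
def gridPoint (T : ℕ) (k : Fin (T + 1)) : ℝ := (k : ℝ) / T

/-- The value of a sign. -/
def signValue (s : ℤˣ) : ℝ := ((s : ℤ) : ℝ)

/-- `Φ(u) = ∑_{(i,σ)} ω_{i,σ} σ 1[u ∈ J_i]`. -/
def potential {N : ℕ} (J : Fin N → Set ℝ) (w : Expert N → ℝ) (u : ℝ) : ℝ :=
  ∑ e : Expert N, w e * signValue e.2 * (J e.1).indicator (fun _ => (1 : ℝ)) u

/-- The expectation over `u ∼ P` of `σ 1[u ∈ J_i] (u - y)`. -/
def expertGain {N T : ℕ} (J : Fin N → Set ℝ) (P : PMF (Fin (T + 1))) (y : Bool)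
    (e : Expert N) : ℝ :=
  ∑ k, (P k).toReal * (signValue e.2 *
    (J e.1).indicator (fun _ => (1 : ℝ)) (gridPoint T k) * (gridPoint T k - outcome y))

/-- `P` is a sampling distribution admitted for the potential `Φ`: all mass on `0` if `Φ(0) > 0`;
otherwise all mass on `1` if `Φ(1) ≤ 0`; otherwise, for some `k` with
`Φ(k/T) Φ((k+1)/T) ≤ 0`, mass `|Φ((k+1)/T)| / (|Φ(k/T)| + |Φ((k+1)/T)|)` on `k/T` and the rest on
`(k+1)/T`. If both potentials vanish, any division of the mass between the two points is admitted. -/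
def IsSamplingRule {T : ℕ} (Φ : ℝ → ℝ) (P : PMF (Fin (T + 1))) : Prop :=
  (0 < Φ 0 → P = PMF.pure 0) ∧
  (Φ 0 ≤ 0 → Φ 1 ≤ 0 → P = PMF.pure (Fin.last T)) ∧
  (Φ 0 ≤ 0 → 0 < Φ 1 → ∃ k : Fin T,
    Φ (gridPoint T k.castSucc) * Φ (gridPoint T k.succ) ≤ 0 ∧
    (P k.castSucc).toReal + (P k.succ).toReal = 1 ∧
    (P k.castSucc).toReal * (|Φ (gridPoint T k.castSucc)| + |Φ (gridPoint T k.succ)|)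
      = |Φ (gridPoint T k.succ)|)

/-- A forecaster that keeps expert weights: the weights and the sampling distribution as functions
of the history, which is a list of the past rounds, the most recent one first. -/
structure Forecaster (N T : ℕ) where
  weight : List (Round T) → Expert N → ℝ
  dist : List (Round T) → PMF (Fin (T + 1))

/-- The sum of the squares of the past losses of every expert. -/
def squareSum {N T : ℕ} (J : Fin N → Set ℝ) (F : Forecaster N T) :
    List (Round T) → Expert N → ℝ
  | [], _ => 0
  | r :: h, e => squareSum J F h e + expertGain J (F.dist h) r.1 e ^ 2

/-- `F` runs the calibration algorithm with the partition `J` over `T` rounds, every MsMwC update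
being computed up to the error `ε`. MsMwC minimizes losses and is to favour the experts `(i,σ)` with
a large `∑_t E[σ 1[u ∈ J_i] (u - y_t)]`, so these quantities are fed to it as gains (negative
losses). For `ε = 0` this is the algorithm itself; the freedom that remains is which sign change of
the potential is used. -/
def IsCalibrationAlgorithm {N T : ℕ} (ε : ℝ) (J : Fin N → Set ℝ) (F : Forecaster N T) : Prop :=
  (∀ e, F.weight [] e = 1 / (Fintype.card (Expert N) : ℝ)) ∧
  (∀ (h : List (Round T)) (r : Round T), h.length < T →
    IsMsMwCUpdate T ε (squareSum J F h) (fun e => -expertGain J (F.dist h) r.1 e)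
      (F.weight h) (F.weight (r :: h))) ∧
  (∀ h : List (Round T), h.length < T → IsSamplingRule (potential J (F.weight h)) (F.dist h))

/-- The Bernoulli distribution with mean `p`. -/
def ber (p : unitInterval) : PMF Bool :=
  PMF.ofFintype (fun b => if b then ENNReal.ofReal p else ENNReal.ofReal (1 - p)) (by
    rw [Fintype.sum_bool]
    simp only [if_true, Bool.false_eq_true, if_false]
    rw [← ENNReal.ofReal_add p.2.1 (sub_nonneg.2 p.2.2)]
    simp)

/-- The law of the history after `n` rounds: given the history, the outcome of the next round is
Bernoulli with mean `q_n`, and the forecaster's point is drawn independently of it from its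
sampling distribution. -/
def historyLaw {N T : ℕ} (q : ℕ → unitInterval) (F : Forecaster N T) : ℕ → PMF (List (Round T))
  | 0 => PMF.pure []
  | n + 1 => (historyLaw q F n).bind fun h =>
      (ber (q n)).bind fun y => (F.dist h).map fun k => (y, k) :: h

/-- The (outcome, forecast) pairs of a history. -/
def play {N T : ℕ} (J : Fin N → Set ℝ) (h : List (Round T)) : List (Bool × ℝ) :=
  h.map fun r => (r.1, forecast J (gridPoint T r.2))

/-- The probability that the calibration error after `T` rounds is at most `B`. -/
def probCalErrorLE {N T : ℕ} (q : ℕ → unitInterval) (J : Fin N → Set ℝ) (F : Forecaster N T)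
    (B : ℝ) : ENNReal :=
  (historyLaw q F T).toOuterMeasure {h | calError (play J h) ≤ B}

/-! ### Computational cost: a random access machine with real arithmetic

Integer registers hold words bounded by a word size `W`; the cells of the real arrays hold real
numbers. Every operation has unit cost. There is no conversion from reals to integers. -/

/-- Integer expressions (subtraction is truncated, division rounds down). -/
inductive IntExp : Type
  | lit (n : ℕ)
  | reg (x : ℕ)
  | add (a b : IntExp)
  | sub (a b : IntExp)
  | mul (a b : IntExp)
  | div (a b : IntExp)

/-- Real expressions; `cell a i` reads the cell `i` of the array `a`. -/
inductive RealExp : Type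
  | ofInt (a : IntExp)
  | cell (a : ℕ) (i : IntExp)
  | add (a b : RealExp)
  | sub (a b : RealExp)
  | mul (a b : RealExp)
  | div (a b : RealExp)
  | exp (a : RealExp)
  | log (a : RealExp)
  | sqrt (a : RealExp)

/-- Tests. -/
inductive Test : Type
  | intLT (a b : IntExp)
  | realLT (a b : RealExp)
  | not (b : Test)

/-- Programs. -/
inductive Prog : Type
  | skip
  | setInt (x : ℕ) (a : IntExp)
  | setReal (a : ℕ) (i : IntExp) (v : RealExp)
  | seq (c d : Prog)
  | ite (b : Test) (c d : Prog)
  | while (b : Test) (c : Prog)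

/-- The memory: integer registers and real arrays. -/
@[ext] structure Memory where
  int : ℕ → ℕ
  real : ℕ → ℕ → ℝ

/-- The value of an integer expression. -/
def IntExp.eval (m : Memory) : IntExp → ℕ
  | .lit n => n
  | .reg x => m.int x
  | .add a b => a.eval m + b.eval m
  | .sub a b => a.eval m - b.eval m
  | .mul a b => a.eval m * b.eval m
  | .div a b => a.eval m / b.eval m

/-- The cost of an integer expression: the number of its nodes. -/
def IntExp.cost : IntExp → ℕ
  | .lit _ => 1
  | .reg _ => 1
  | .add a b => a.cost + b.cost + 1
  | .sub a b => a.cost + b.cost + 1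
  | .mul a b => a.cost + b.cost + 1
  | .div a b => a.cost + b.cost + 1

/-- The value of a real expression. -/
def RealExp.eval (m : Memory) : RealExp → ℝ
  | .ofInt a => (a.eval m : ℝ)
  | .cell a i => m.real a (i.eval m)
  | .add a b => a.eval m + b.eval m
  | .sub a b => a.eval m - b.eval m
  | .mul a b => a.eval m * b.eval m
  | .div a b => a.eval m / b.eval m
  | .exp a => Real.exp (a.eval m)
  | .log a => Real.log (a.eval m)
  | .sqrt a => √(a.eval m)

/-- The cost of a real expression: the number of its nodes. -/
def RealExp.cost : RealExp → ℕ
  | .ofInt a => a.cost + 1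
  | .cell _ i => i.cost + 1
  | .add a b => a.cost + b.cost + 1
  | .sub a b => a.cost + b.cost + 1
  | .mul a b => a.cost + b.cost + 1
  | .div a b => a.cost + b.cost + 1
  | .exp a => a.cost + 1
  | .log a => a.cost + 1
  | .sqrt a => a.cost + 1

/-- When a test succeeds. -/
def Test.holds (m : Memory) : Test → Prop
  | .intLT a b => a.eval m < b.eval m
  | .realLT a b => a.eval m < b.eval m
  | .not b => ¬ b.holds m

/-- The cost of a test. -/
def Test.cost : Test → ℕ
  | .intLT a b => a.cost + b.cost + 1
  | .realLT a b => a.cost + b.cost + 1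
  | .not b => b.cost + 1

/-- The memory after a write to an integer register. -/
def Memory.setInt (m : Memory) (x v : ℕ) : Memory :=
  { m with int := Function.update m.int x v }

/-- The memory after a write to a cell of a real array. -/
def Memory.setReal (m : Memory) (a i : ℕ) (v : ℝ) : Memory :=
  { m with real := Function.update m.real a (Function.update (m.real a) i v) }

/-- `Exec W c m n m'`: with word size `W`, the program `c` started in the memory `m` stops after
`n` steps in the memory `m'`. -/
inductive Exec (W : ℕ) : Prog → Memory → ℕ → Memory → Prop
  | skip (m : Memory) : Exec W .skip m 1 m
  | setInt (x : ℕ) (a : IntExp) (m : Memory) (hW : a.eval m ≤ W) :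
      Exec W (.setInt x a) m (a.cost + 1) (m.setInt x (a.eval m))
  | setReal (a : ℕ) (i : IntExp) (v : RealExp) (m : Memory) :
      Exec W (.setReal a i v) m (i.cost + v.cost + 1) (m.setReal a (i.eval m) (v.eval m))
  | seq (c d : Prog) (m₀ m₁ m₂ : Memory) (n₁ n₂ : ℕ) (h₁ : Exec W c m₀ n₁ m₁)
      (h₂ : Exec W d m₁ n₂ m₂) : Exec W (.seq c d) m₀ (n₁ + n₂) m₂
  | iteTrue (b : Test) (c d : Prog) (m₀ m₁ : Memory) (n : ℕ) (hb : b.holds m₀)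
      (h : Exec W c m₀ n m₁) : Exec W (.ite b c d) m₀ (b.cost + n + 1) m₁
  | iteFalse (b : Test) (c d : Prog) (m₀ m₁ : Memory) (n : ℕ) (hb : ¬ b.holds m₀)
      (h : Exec W d m₀ n m₁) : Exec W (.ite b c d) m₀ (b.cost + n + 1) m₁
  | whileFalse (b : Test) (c : Prog) (m : Memory) (hb : ¬ b.holds m) :
      Exec W (.while b c) m (b.cost + 1) m
  | whileTrue (b : Test) (c : Prog) (m₀ m₁ m₂ : Memory) (n₁ n₂ : ℕ) (hb : b.holds m₀)
      (h₁ : Exec W c m₀ n₁ m₁) (h₂ : Exec W (.while b c) m₁ n₂ m₂) :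
      Exec W (.while b c) m₀ (b.cost + n₁ + n₂ + 1) m₂

/-- A forecasting program: `init` is run once, `predict` at the start of every round, and `update`
at its end, when the outcome is known. -/
structure ForecastProg where
  init : Prog
  predict : Prog
  update : Prog

/-- The memory at the start: `T` in register 0, `N` in register 1, zeros elsewhere. -/
def inputMemory (T N : ℕ) : Memory where
  int := fun x => if x = 0 then T else if x = 1 then N else 0
  real := fun _ _ => 0

/-- After `predict`, the memory `m` announces the sampling distribution `P` and the forecasts:
with the probability `θ` in cell 0 of array 0 the point `k₀ / T` is sampled, otherwise `k₁ / T`, where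
`k₀` and `k₁` are in the registers 2 and 3; the forecasts made in these two cases are in cell 0 of
the arrays 1 and 2. (Tossing the coin of bias `θ` is left to the environment.) -/
def Announces {N T : ℕ} (J : Fin N → Set ℝ) (m : Memory) (P : PMF (Fin (T + 1))) : Prop :=
  ∃ k₀ k₁ : Fin (T + 1), m.int 2 = k₀ ∧ m.int 3 = k₁ ∧
    0 ≤ m.real 0 0 ∧ m.real 0 0 ≤ 1 ∧
    (∀ k, (P k).toReal = (if k = k₀ then m.real 0 0 else 0) + (if k = k₁ then 1 - m.real 0 0 else 0)) ∧
    m.real 1 0 = forecast J (gridPoint T k₀) ∧ m.real 2 0 = forecast J (gridPoint T k₁)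

/-- The program `π`, with word size `W`, carries out the forecaster `F` on all histories of fewer
than `T` rounds with at most `B` steps for the initialization and at most `B` steps per round. Here
`M h` is the memory after the history `h`; the outcome of a round is given in register 4. -/
def Implements {N T : ℕ} (π : ForecastProg) (W : ℕ) (B : ℝ) (J : Fin N → Set ℝ)
    (F : Forecaster N T) : Prop :=
  ∃ M : List (Round T) → Memory,
    (∃ n : ℕ, Exec W π.init (inputMemory T N) n (M []) ∧ (n : ℝ) ≤ B) ∧
    ∀ h : List (Round T), h.length < T → ∃ (m : Memory) (n₁ : ℕ),
      Exec W π.predict (M h) n₁ m ∧ Announces J m (F.dist h) ∧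
      ∀ r : Round T, ∃ n₂ : ℕ,
        Exec W π.update (m.setInt 4 (if r.1 then 1 else 0)) n₂ (M (r :: h)) ∧
        ((n₁ + n₂ : ℕ) : ℝ) ≤ B

end OnlineCalibration

end

noncomputable section

namespace OnlineCalibration

open scoped ENNReal

/-! Let `m i = ∑_t P_t(J_i)` and `G i = ∑_t E_{u∼P_t}[1[u ∈ J_i] (u - y_t)]`. Moving a sampled point
to the right end of its interval costs at most `1/N` per round, so the calibration error is at most
`T/N + ∑_i (|D i| + |G i|)`, where the martingale `D i` compares the sampled point with its
distribution (`calError_play_le_add`).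

Gains. Whatever the outcome, the sampling rule makes the weighted average of the experts' gains at
most `1/T` in every round: the two masses balance the potential, and only the grid spacing survives
(`sampling_gain_le`). Hence `|G i|` is, up to an additive 1, at most the regret of MsMwC against one
of the experts `(i, ±1)`. The square of a loss of such an expert is at most `P_t(J_i)`, so a regret
bound in the comparator's own squared losses gives `|G i| ≲ √(L m_i) + L` with `L = log (dT)`
(`regret_step`, `pathSum_expertGain_le`). A Freedman inequality that adapts to `m i` gives a bound
of the same form for `D i` and for the outcome noise `∑_t P_t(J_i) (y_t - q_t)`
(`measure_abs_pathSum_le`).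

Occupation. What remains is `∑_i √(s m_i)` with `s = 8ι`; Cauchy-Schwarz over all intervals would
lose a factor `√N`. Let `p` attain `C` and put `c_i = ∑_t P_t(J_i) |q_t - p|`, so that `∑ c_i = C`.
Forecasting at distance `Δ_i` from `p` for `m i` rounds produces a gain of size about `Δ_i m_i`, up
to `c_i`, rounding and noise; as the gain is small, `Δ_i m_i ≲ c_i + √(s m_i) + s` (`drift_le`).
Thus `√(s m_i) ≲ √(s c_i / Δ_i) + s / Δ_i` for the far intervals, and since `∑ 1/Δ_i ≲ N log N`,
Cauchy-Schwarz gives `√(s C N log N) + s N log N`. The at most seven near intervals cost `√(s T)`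
each (`sum_sqrt_occupation_le`). The choice of `N` balances these terms against `T/N`
(`scale_relations`, `error_terms_le`).

Running time. The minimizer of a mirror step over the truncated simplex is `max (1/(dT)) (w_e exp
(-η_e (g_e + s)))` for a scalar multiplier `s` that makes the sum 1
(`mirrorObjective_add_bregman_le`). The sum is monotone in `s`, so `O(log T)` bisection steps of
cost `O(N)` bracket `s`; a convex mixture of the two bracketing vectors lies exactly in the simplex
and within `T^{-18}` of the minimizer (`mixture_isMsMwCUpdate`). Such an inaccuracy costs the regret
at most `1/T` per round. A sign change of the potential is found by binary search, so a round takes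
`O(N log T)` steps. -/

/-! ### Expectations of non-negative functions under probability mass functions -/

/-- The expectation of a non-negative function. -/
def expect {α : Type*} (p : PMF α) (f : α → ℝ≥0∞) : ℝ≥0∞ := ∑' a, p a * f a

theorem expect_pure {α : Type*} (a : α) (f : α → ℝ≥0∞) : expect (PMF.pure a) f = f a := by
  classical
  unfold expect
  rw [tsum_eq_single a]
  · simp
  · intro b hb
    simp [PMF.pure_apply, hb]

theorem expect_bind {α β : Type*} (p : PMF α) (g : α → PMF β) (f : β → ℝ≥0∞) :
    expect (p.bind g) f = expect p fun a => expect (g a) f := by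
  unfold expect
  simp only [PMF.bind_apply, ← ENNReal.tsum_mul_right, ← ENNReal.tsum_mul_left]
  rw [ENNReal.tsum_comm]
  simp only [mul_assoc]

theorem expect_map {α β : Type*} (p : PMF α) (g : α → β) (f : β → ℝ≥0∞) :
    expect (p.map g) f = expect p fun a => f (g a) := by
  rw [← PMF.bind_pure_comp, expect_bind]
  simp only [Function.comp_apply, expect_pure]

theorem expect_mono_support {α : Type*} (p : PMF α) {f g : α → ℝ≥0∞}
    (h : ∀ a ∈ p.support, f a ≤ g a) : expect p f ≤ expect p g := by
  refine ENNReal.tsum_le_tsum fun a => ?_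
  by_cases ha : p a = 0
  · simp [ha]
  · exact mul_le_mul_right (h a ((PMF.mem_support_iff p a).2 ha)) _

theorem toOuterMeasure_le_expect {α : Type*} (p : PMF α) (s : Set α) (f : α → ℝ≥0∞)
    (h : ∀ a ∈ s, 1 ≤ f a) : p.toOuterMeasure s ≤ expect p f := by
  rw [PMF.toOuterMeasure_apply]
  refine ENNReal.tsum_le_tsum fun a => ?_
  by_cases ha : a ∈ s
  · simpa [ha] using mul_le_mul_right (h a ha) (p a)
  · simp [ha]

/-! ### The law of the history -/

theorem ber_true (p : unitInterval) : (ber p true).toReal = p := by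
  simp [ber, ENNReal.toReal_ofReal p.2.1]

theorem ber_false (p : unitInterval) : (ber p false).toReal = 1 - p := by
  simp [ber, ENNReal.toReal_ofReal (sub_nonneg.2 p.2.2)]

theorem sum_toReal_eq_one {α : Type*} [Fintype α] (p : PMF α) : ∑ a, (p a).toReal = 1 := by
  rw [← ENNReal.toReal_sum fun a _ => p.apply_ne_top a, ← tsum_fintype (L := .unconditional _),
    p.tsum_coe, ENNReal.toReal_one]

variable {N T : ℕ}

theorem length_of_mem_support (q : ℕ → unitInterval) (F : Forecaster N T) (n : ℕ)
    (h : List (Round T)) (hh : h ∈ (historyLaw q F n).support) : h.length = n := by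
  induction n generalizing h with
  | zero => simpa [historyLaw] using hh
  | succ n ih =>
    simp only [historyLaw, PMF.mem_support_bind_iff, PMF.mem_support_map_iff] at hh
    obtain ⟨h', hh', y, -, k, -, rfl⟩ := hh
    simp [ih h' hh']

/-- The mean of a function of the next round, after a history `h`. -/
def roundMean (q : ℕ → unitInterval) (F : Forecaster N T) (h : List (Round T))
    (f : Round T → ℝ) : ℝ :=
  ∑ y, (ber (q h.length) y).toReal * ∑ k, (F.dist h k).toReal * f (y, k)

/-- The law uses `q n` while `roundMean` uses `q h.length`; they agree because every history in the
support has length `n`. -/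
theorem expect_historyLaw_succ (q : ℕ → unitInterval) (F : Forecaster N T) (n : ℕ)
    (f : List (Round T) → ℝ) (hf : ∀ h, 0 ≤ f h) :
    expect (historyLaw q F (n + 1)) (fun h => ENNReal.ofReal (f h)) =
      expect (historyLaw q F n) fun h => ENNReal.ofReal (roundMean q F h fun r => f (r :: h)) := by
  simp only [historyLaw, expect_bind, expect_map]
  refine le_antisymm (expect_mono_support _ fun h hh => ?_) (expect_mono_support _ fun h hh => ?_)
  all_goals
    have hn := length_of_mem_support q F n h hh
    refine le_of_eq ?_
    have key : ∀ (α : Type) [Fintype α] (p : PMF α) (g : α → ℝ), (∀ a, 0 ≤ g a) →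
        expect p (fun a => ENNReal.ofReal (g a)) = ENNReal.ofReal (∑ a, (p a).toReal * g a) := by
      intro α _ p g hg
      unfold expect
      rw [tsum_fintype, ENNReal.ofReal_sum_of_nonneg
        fun a _ => mul_nonneg ENNReal.toReal_nonneg (hg a)]
      refine Finset.sum_congr rfl fun a _ => ?_
      rw [ENNReal.ofReal_mul ENNReal.toReal_nonneg, ENNReal.ofReal_toReal (p.apply_ne_top a)]
    simp only [key (Fin (T + 1)) _ _ fun k => hf _]
    rw [key Bool _ _ fun y => Finset.sum_nonneg fun k _ => mul_nonneg ENNReal.toReal_nonneg (hf _),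
      roundMean, hn]

theorem roundMean_add (q : ℕ → unitInterval) (F : Forecaster N T) (h : List (Round T))
    (f g : Round T → ℝ) :
    roundMean q F h (fun r => f r + g r) = roundMean q F h f + roundMean q F h g := by
  simp only [roundMean, mul_add, Finset.sum_add_distrib]

theorem roundMean_const_mul (q : ℕ → unitInterval) (F : Forecaster N T) (h : List (Round T))
    (c : ℝ) (f : Round T → ℝ) :
    roundMean q F h (fun r => c * f r) = c * roundMean q F h f := by
  simp only [roundMean, Finset.mul_sum]
  refine Finset.sum_congr rfl fun y _ => Finset.sum_congr rfl fun k _ => by ring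

theorem roundMean_const (q : ℕ → unitInterval) (F : Forecaster N T) (h : List (Round T)) (c : ℝ) :
    roundMean q F h (fun _ => c) = c := by
  simp only [roundMean, ← Finset.sum_mul, sum_toReal_eq_one, one_mul]

theorem roundMean_mono (q : ℕ → unitInterval) (F : Forecaster N T) (h : List (Round T))
    {f g : Round T → ℝ} (hfg : ∀ r, f r ≤ g r) : roundMean q F h f ≤ roundMean q F h g := by
  unfold roundMean
  gcongr
  exact hfg _

/-! ### Martingale concentration -/

/-- The sum of the increments `X` along a history. -/
def pathSum {R : Type*} (X : List R → R → ℝ) : List R → ℝ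
  | [] => 0
  | r :: h => pathSum X h + X h r

theorem exp_le_quadratic {x : ℝ} (hx : |x| ≤ 1) : Real.exp x ≤ 1 + x + x ^ 2 := by
  have h := Real.abs_exp_sub_one_sub_id_le hx
  have := (abs_le.1 h).2
  linarith

/-- The exponential is a supermartingale: by `exp x ≤ 1 + x + x²` and since the increments have mean
zero, one round multiplies the conditional mean by at most `exp (s² v)`, which the compensator
cancels. -/
theorem expect_exp_le_one (q : ℕ → unitInterval) (F : Forecaster N T)
    (X : List (Round T) → Round T → ℝ) (v : List (Round T) → ℝ)
    (hX : ∀ h r, |X h r| ≤ 1) (hmean : ∀ h, roundMean q F h (X h) = 0)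
    (hvar : ∀ h, roundMean q F h (fun r => X h r ^ 2) ≤ v h) (s : ℝ) (hs : |s| ≤ 1) (n : ℕ) :
    expect (historyLaw q F n) (fun h => ENNReal.ofReal
      (Real.exp (s * pathSum X h - s ^ 2 * pathSum (fun h _ => v h) h))) ≤ 1 := by
  induction n with
  | zero => simp [historyLaw, expect_pure, pathSum]
  | succ n ih =>
    rw [expect_historyLaw_succ q F n _ fun h => (Real.exp_pos _).le]
    refine le_trans (expect_mono_support _ fun h _ => ?_) ih
    refine ENNReal.ofReal_le_ofReal ?_
    set A := Real.exp (s * pathSum X h - s ^ 2 * pathSum (fun h _ => v h) h) with hA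
    have hpos : 0 < A := Real.exp_pos _
    have h1 : roundMean q F h (fun r => Real.exp (s * pathSum X (r :: h)
          - s ^ 2 * pathSum (fun h _ => v h) (r :: h)))
        = (A * Real.exp (-(s ^ 2 * v h))) * roundMean q F h (fun r => Real.exp (s * X h r)) := by
      rw [← roundMean_const_mul]
      congr 1
      funext r
      rw [hA, ← Real.exp_add, ← Real.exp_add]
      congr 1
      simp only [pathSum]
      ring
    have h2 : roundMean q F h (fun r => Real.exp (s * X h r)) ≤ Real.exp (s ^ 2 * v h) := by
      calc roundMean q F h (fun r => Real.exp (s * X h r))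
          ≤ roundMean q F h (fun r => (1 + s * X h r) + s ^ 2 * X h r ^ 2) := by
            refine roundMean_mono q F h fun r => ?_
            have : |s * X h r| ≤ 1 := by
              rw [abs_mul]
              exact mul_le_one₀ hs (abs_nonneg _) (hX h r)
            have := exp_le_quadratic this
            rw [mul_pow] at this
            exact this
        _ = 1 + s ^ 2 * roundMean q F h (fun r => X h r ^ 2) := by
            rw [roundMean_add, roundMean_add, roundMean_const, roundMean_const_mul,
              roundMean_const_mul, hmean, mul_zero, add_zero]
        _ ≤ s ^ 2 * v h + 1 := by
            have := mul_le_mul_of_nonneg_left (hvar h) (sq_nonneg s)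
            linarith
        _ ≤ Real.exp (s ^ 2 * v h) := Real.add_one_le_exp _
    rw [h1]
    calc A * Real.exp (-(s ^ 2 * v h)) * roundMean q F h (fun r => Real.exp (s * X h r))
        ≤ A * Real.exp (-(s ^ 2 * v h)) * Real.exp (s ^ 2 * v h) := by gcongr
      _ = A := by rw [mul_assoc, ← Real.exp_add]; simp

/-- Markov's inequality for this supermartingale. -/
theorem measure_exceed_le (q : ℕ → unitInterval) (F : Forecaster N T)
    (X : List (Round T) → Round T → ℝ) (v : List (Round T) → ℝ)
    (hX : ∀ h r, |X h r| ≤ 1) (hmean : ∀ h, roundMean q F h (X h) = 0)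
    (hvar : ∀ h, roundMean q F h (fun r => X h r ^ 2) ≤ v h) (s : ℝ) (hs : |s| ≤ 1) (n : ℕ)
    (c : ℝ) :
    (historyLaw q F n).toOuterMeasure
      {h | c < s * pathSum X h - s ^ 2 * pathSum (fun h _ => v h) h} ≤
        ENNReal.ofReal (Real.exp (-c)) := by
  calc _ ≤ expect (historyLaw q F n) (fun h => ENNReal.ofReal (Real.exp (-c)) * ENNReal.ofReal
      (Real.exp (s * pathSum X h - s ^ 2 * pathSum (fun h _ => v h) h))) := by
        refine toOuterMeasure_le_expect _ _ _ fun h hh => ?_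
        rw [← ENNReal.ofReal_mul (Real.exp_pos _).le, ← Real.exp_add, ENNReal.one_le_ofReal,
          Real.one_le_exp_iff]
        have : c < s * pathSum X h - s ^ 2 * pathSum (fun h _ => v h) h := hh
        linarith
    _ = ENNReal.ofReal (Real.exp (-c)) * expect (historyLaw q F n) (fun h => ENNReal.ofReal
      (Real.exp (s * pathSum X h - s ^ 2 * pathSum (fun h _ => v h) h))) := by
        simp only [expect, ← ENNReal.tsum_mul_left]
        refine tsum_congr fun h => by ring
    _ ≤ ENNReal.ofReal (Real.exp (-c)) * 1 := by
        gcongr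
        exact expect_exp_le_one q F X v hX hmean hvar s hs n
    _ = _ := mul_one _

/-- A bound of Freedman's type that adapts to the realized variance. -/
theorem measure_abs_pathSum_le (q : ℕ → unitInterval) (F : Forecaster N T)
    (X : List (Round T) → Round T → ℝ) (v : List (Round T) → ℝ)
    (hX : ∀ h r, |X h r| ≤ 1) (hmean : ∀ h, roundMean q F h (X h) = 0)
    (hvar : ∀ h, roundMean q F h (fun r => X h r ^ 2) ≤ v h)
    (hV : ∀ h, 0 ≤ pathSum (fun h _ => v h) h)
    (hV' : ∀ h, pathSum (fun h _ => v h) h ≤ h.length) (κ : ℝ) (hκ : 1 ≤ κ) (n : ℕ) :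
    (historyLaw q F n).toOuterMeasure {h | h.length = n ∧
      3 * (√(κ * pathSum (fun h _ => v h) h) + κ) < |pathSum X h|} ≤
        2 * (n + 1) * ENNReal.ofReal (Real.exp (-κ)) := by
  classical
  set V := pathSum (fun h (_ : Round T) => v h) with hVdef
  -- The best tilt is about `√(κ / V)`, but `V` is random. It is replaced by a deterministic grid,
  -- one tilt for each integer value of `V`; the extra `κ` in the denominator keeps every tilt at
  -- most 1.
  let s : ℕ → ℝ := fun m => √(κ / (κ + m))
  have hκ0 : 0 < κ := by linarith
  have hs : ∀ m, |s m| ≤ 1 := by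
    intro m
    rw [abs_of_nonneg (Real.sqrt_nonneg _), Real.sqrt_le_one, div_le_one (by positivity)]
    linarith [(Nat.cast_nonneg m : (0 : ℝ) ≤ m)]
  let S : ℕ → Set (List (Round T)) := fun m =>
    {h | κ < s m * pathSum X h - s m ^ 2 * V h} ∪
      {h | κ < (-s m) * pathSum X h - (-s m) ^ 2 * V h}
  have hS : ∀ m, (historyLaw q F n).toOuterMeasure (S m) ≤
      2 * ENNReal.ofReal (Real.exp (-κ)) := by
    intro m
    refine (MeasureTheory.measure_union_le _ _).trans ?_
    rw [two_mul]
    exact add_le_add (measure_exceed_le q F X v hX hmean hvar _ (hs m) n κ)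
      (measure_exceed_le q F X v hX hmean hvar _ (by rw [abs_neg]; exact hs m) n κ)
  calc _ ≤ (historyLaw q F n).toOuterMeasure (⋃ m ∈ Finset.range (n + 1), S m) := by
        refine MeasureTheory.measure_mono ?_
        rintro h ⟨hlen, hh⟩
        simp only [Set.mem_iUnion, exists_prop]
        have hVn : V h ≤ n := by rw [← hlen]; exact hV' h
        -- Rounding `V` up changes it by less than 1, hence by less than `κ`, and `V ≤ n` keeps the
        -- index within the `n + 1` grid values of the union bound.
        refine ⟨⌈V h⌉₊, ?_, ?_⟩
        · simpa [Nat.lt_succ_iff] using hVn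
        set m := ⌈V h⌉₊ with hm
        have hm1 : V h ≤ m := Nat.le_ceil _
        have hm2 : (m : ℝ) < V h + 1 := Nat.ceil_lt_add_one (hV h)
        have hκm : 0 < κ + m := by positivity
        have hs0 : 0 < s m := Real.sqrt_pos.2 (by positivity)
        have hs2 : s m ^ 2 = κ / (κ + m) := Real.sq_sqrt (by positivity)
        have hge : √(κ * V h) * √(κ * V h) = κ * V h := Real.mul_self_sqrt (mul_nonneg hκ0.le (hV h))
        have hr0 : 0 ≤ √(κ * V h) := Real.sqrt_nonneg _
        -- `κ / s = √(κ (κ + m))`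
        have hb : √(κ * (κ + m)) ≤ √(κ * V h) + 2 * κ := by
          rw [Real.sqrt_le_left (by positivity)]
          nlinarith [hV h]
        have hsb : s m * √(κ * (κ + m)) = κ := by
          change √(κ / (κ + m)) * √(κ * (κ + m)) = κ
          rw [← Real.sqrt_mul (by positivity)]
          rw [show κ / (κ + m) * (κ * (κ + m)) = κ * κ by field_simp]
          exact Real.sqrt_mul_self hκ0.le
        have hsv : s m * V h ≤ √(κ * V h) := by
          refine Real.le_sqrt_of_sq_le ?_
          rw [mul_pow, hs2, div_mul_eq_mul_div, div_le_iff₀ hκm]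
          have := hV h
          nlinarith [mul_nonneg hκ0.le this, mul_nonneg (mul_nonneg hκ0.le this) (sub_nonneg.2 hm1)]
        have hkey : κ + s m ^ 2 * V h < s m * |pathSum X h| := by
          have : √(κ * (κ + m)) + s m * V h < |pathSum X h| := by linarith
          calc κ + s m ^ 2 * V h = s m * (√(κ * (κ + m)) + s m * V h) := by rw [mul_add, hsb]; ring
            _ < _ := by gcongr
        rcases abs_cases (pathSum X h) with ⟨ha, -⟩ | ⟨ha, -⟩
        · left
          rw [ha] at hkey
          change κ < _
          linarith
        · right
          rw [ha] at hkey
          change κ < _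
          rw [neg_sq]
          linarith
    _ ≤ ∑ m ∈ Finset.range (n + 1), (historyLaw q F n).toOuterMeasure (S m) :=
        MeasureTheory.measure_biUnion_finset_le _ _
    _ ≤ ∑ m ∈ Finset.range (n + 1), 2 * ENNReal.ofReal (Real.exp (-κ)) :=
        Finset.sum_le_sum fun m _ => hS m
    _ = _ := by
        rw [Finset.sum_const, Finset.card_range, nsmul_eq_mul]
        push_cast
        ring


/-! ### Mirror descent steps in the truncated simplex -/

section Mirror

variable {E : Type} [Fintype E]

/-- The Bregman divergence of `∑ (1 / η_e) w_e log w_e`. -/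
def bregman (η u v : E → ℝ) : ℝ :=
  ∑ e, 1 / η e * (u e * Real.log (u e / v e) - u e + v e)

theorem mirrorObjective_eq (η g v w : E → ℝ) :
    mirrorObjective η g v w = ∑ e, w e * g e + bregman η w v := rfl

theorem klTerm_nonneg {u v : ℝ} (hu : 0 < u) (hv : 0 < v) :
    0 ≤ u * Real.log (u / v) - u + v := by
  have h := Real.log_le_sub_one_of_pos (div_pos hv hu)
  rw [← inv_div, Real.log_inv]
  have : u * Real.log (v / u) ≤ u * (v / u - 1) := mul_le_mul_of_nonneg_left h hu.le
  rw [mul_sub, mul_div_cancel₀ v hu.ne'] at this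
  linarith

theorem klTerm_pos {u v : ℝ} (hu : 0 < u) (hv : 0 < v) (huv : u ≠ v) :
    0 < u * Real.log (u / v) - u + v := by
  have h := Real.log_lt_sub_one_of_pos (div_pos hv hu)
    (fun h => huv ((div_eq_one_iff_eq hu.ne').1 h).symm)
  rw [← inv_div, Real.log_inv]
  have : u * Real.log (v / u) < u * (v / u - 1) := mul_lt_mul_of_pos_left h hu
  rw [mul_sub, mul_div_cancel₀ v hu.ne'] at this
  linarith

theorem bregman_nonneg {η u v : E → ℝ} (hη : ∀ e, 0 < η e) (hu : ∀ e, 0 < u e)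
    (hv : ∀ e, 0 < v e) : 0 ≤ bregman η u v :=
  Finset.sum_nonneg fun e _ =>
    mul_nonneg (one_div_pos.2 (hη e)).le (klTerm_nonneg (hu e) (hv e))

theorem eq_of_bregman_nonpos {η u v : E → ℝ} (hη : ∀ e, 0 < η e) (hu : ∀ e, 0 < u e)
    (hv : ∀ e, 0 < v e) (h : bregman η u v ≤ 0) : u = v := by
  have h0 : bregman η u v = 0 := le_antisymm h (bregman_nonneg hη hu hv)
  have h1 := (Finset.sum_eq_zero_iff_of_nonneg fun e _ =>
    mul_nonneg (one_div_pos.2 (hη e)).le (klTerm_nonneg (hu e) (hv e))).1 h0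
  funext e
  by_contra hne
  have := mul_pos (one_div_pos.2 (hη e)) (klTerm_pos (hu e) (hv e) hne)
  exact this.ne' (h1 e (Finset.mem_univ e))

/-- The multiplicative update with Lagrange multiplier `s`, truncated from below at `c`. -/
def clippedStep (c : ℝ) (η g w : E → ℝ) (s : ℝ) (e : E) : ℝ :=
  max c (w e * Real.exp (-(η e * (g e + s))))

theorem clippedStep_antitone {E : Type} {c : ℝ} {η g w : E → ℝ} (hη : ∀ e, 0 < η e) (hw : ∀ e, 0 ≤ w e)
    (e : E) : Antitone fun s => clippedStep c η g w s e := by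
  intro s t hst
  refine max_le_max le_rfl (mul_le_mul_of_nonneg_left (Real.exp_le_exp.2 ?_) (hw e))
  have := mul_le_mul_of_nonneg_left hst (hη e).le
  linarith

/-- Intermediate values: at `s = -B` no exponent is negative, so no weight decreases and the sum is
at least 1; at `s = B` no exponent is positive, and since `c ≤ w e` clipping does not lift a weight
above its old value. -/
theorem exists_clippedStep_sum_eq {c : ℝ} {η g w : E → ℝ} (hη : ∀ e, 0 < η e)
    (hc : 0 < c) (hw : ∀ e, c ≤ w e) (hw1 : ∑ e, w e = 1) {B : ℝ} (hg : ∀ e, |g e| ≤ B)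
    (hB : 0 ≤ B) :
    ∃ s ∈ Set.Icc (-B) B, ∑ e, clippedStep c η g w s e = 1 := by
  have hcont : Continuous fun s => ∑ e, clippedStep c η g w s e := by
    unfold clippedStep
    fun_prop
  have := intermediate_value_Icc' (show -B ≤ B by linarith) hcont.continuousOn
  refine this ⟨?_, ?_⟩
  · rw [← hw1]
    refine Finset.sum_le_sum fun e _ => max_le (hw e) ?_
    refine mul_le_of_le_one_right (hc.le.trans (hw e)) (Real.exp_le_one_iff.2 ?_)
    have := mul_nonneg (hη e).le (by linarith [(abs_le.1 (hg e)).1] : 0 ≤ g e + B)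
    linarith
  · rw [← hw1]
    refine Finset.sum_le_sum fun e _ => le_max_of_le_right ?_
    refine le_mul_of_one_le_right (hc.le.trans (hw e)) (Real.one_le_exp_iff.2 ?_)
    have := mul_nonneg (hη e).le (by linarith [(abs_le.1 (hg e)).2] : 0 ≤ -(g e + -B))
    linarith

/-- The KKT conditions with the three-point identity. The gap in a coordinate is `(u e - v e)` times
the derivative `g e + log (v e / w e) / η e`. The derivative equals `-s` at an unclipped coordinate;
at a clipped one it is at least `-s`, while `u e - v e ≥ 0`. The lower bounds `-s (u e - v e)` sum
to zero because `u` and `v` both have sum 1. -/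
theorem mirrorObjective_add_bregman_le {c : ℝ} {η g w u : E → ℝ} {s : ℝ} (hη : ∀ e, 0 < η e)
    (hc : 0 < c) (hw : ∀ e, 0 < w e) (hv1 : ∑ e, clippedStep c η g w s e = 1)
    (hu : ∀ e, c ≤ u e) (hu1 : ∑ e, u e = 1) :
    mirrorObjective η g w (clippedStep c η g w s) + bregman η u (clippedStep c η g w s) ≤
      mirrorObjective η g w u := by
  set v := clippedStep c η g w s with hv
  have hvc : ∀ e, c ≤ v e := fun e => le_max_left _ _
  have key : ∀ e, -s * (u e - v e) ≤ (u e * g e + 1 / η e * (u e * Real.log (u e / w e) - u e + w e))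
      - (v e * g e + 1 / η e * (v e * Real.log (v e / w e) - v e + w e))
      - 1 / η e * (u e * Real.log (u e / v e) - u e + v e) := by
    intro e
    have hu0 := hc.trans_le (hu e)
    have hv0 := hc.trans_le (hvc e)
    have hid : (u e * g e + 1 / η e * (u e * Real.log (u e / w e) - u e + w e))
      - (v e * g e + 1 / η e * (v e * Real.log (v e / w e) - v e + w e))
      - 1 / η e * (u e * Real.log (u e / v e) - u e + v e) =
      (u e - v e) * (g e + 1 / η e * Real.log (v e / w e)) := by
      rw [Real.log_div hu0.ne' (hw e).ne', Real.log_div hv0.ne' (hw e).ne',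
        Real.log_div hu0.ne' hv0.ne']
      ring
    have hexp : Real.log (w e * Real.exp (-(η e * (g e + s))) / w e) = -(η e * (g e + s)) := by
      rw [mul_div_cancel_left₀ _ (hw e).ne', Real.log_exp]
    have hcancel : ∀ x, 1 / η e * (η e * x) = x := fun x => by
      rw [← mul_assoc, one_div_mul_cancel (hη e).ne', one_mul]
    rw [hid]
    rcases le_total c (w e * Real.exp (-(η e * (g e + s)))) with h | h
    · have hve : v e = w e * Real.exp (-(η e * (g e + s))) := max_eq_right h
      have : Real.log (v e / w e) = -(η e * (g e + s)) := by rw [hve, hexp]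
      rw [this, mul_neg, hcancel]
      linarith
    · have hve : v e = c := max_eq_left h
      have hl : -(η e * (g e + s)) ≤ Real.log (v e / w e) := by
        rw [← hexp]
        refine Real.log_le_log (by have := hw e; positivity) ?_
        rw [hve]
        exact div_le_div_of_nonneg_right h (hw e).le
      have h1 := mul_le_mul_of_nonneg_left hl (one_div_pos.2 (hη e)).le
      rw [mul_neg, hcancel] at h1
      have h2 : 0 ≤ u e - v e := by rw [hve]; linarith [hu e]
      nlinarith
  have hsum := Finset.sum_le_sum fun e (_ : e ∈ Finset.univ) => key e
  rw [← Finset.mul_sum, Finset.sum_sub_distrib, Finset.sum_sub_distrib, Finset.sum_sub_distrib,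
    Finset.sum_add_distrib, Finset.sum_add_distrib, hu1, hv1] at hsum
  rw [mirrorObjective, mirrorObjective, bregman]
  linarith

/-- Uniqueness of the minimizer: the Bregman gap in the previous inequality would be non-positive at
`v`, and a non-positive divergence forces equality. -/
theorem eq_clippedStep_of_isMinOn {c : ℝ} {η g w v : E → ℝ} {s : ℝ} (hη : ∀ e, 0 < η e)
    (hc : 0 < c) (hw : ∀ e, 0 < w e) (hv1 : ∑ e, clippedStep c η g w s e = 1)
    (hv : v ∈ {w : E → ℝ | (∀ e, c ≤ w e) ∧ ∑ e, w e = 1})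
    (hmin : IsMinOn (mirrorObjective η g w) {w : E → ℝ | (∀ e, c ≤ w e) ∧ ∑ e, w e = 1} v) :
    v = clippedStep c η g w s := by
  have h1 := mirrorObjective_add_bregman_le hη hc hw hv1 hv.1 hv.2
  have h2 : mirrorObjective η g w v ≤ mirrorObjective η g w (clippedStep c η g w s) :=
    hmin ⟨fun e => le_max_left _ _, hv1⟩
  exact eq_of_bregman_nonpos hη (fun e => hc.trans_le (hv.1 e))
    (fun e => hc.trans_le (le_max_left _ _)) (by linarith)

theorem isMinOn_clippedStep {c : ℝ} {η g w : E → ℝ} {s : ℝ} (hη : ∀ e, 0 < η e)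
    (hc : 0 < c) (hw : ∀ e, 0 < w e) (hv1 : ∑ e, clippedStep c η g w s e = 1) :
    IsMinOn (mirrorObjective η g w) {w : E → ℝ | (∀ e, c ≤ w e) ∧ ∑ e, w e = 1}
      (clippedStep c η g w s) := by
  intro u hu
  have h1 := mirrorObjective_add_bregman_le hη hc hw hv1 hu.1 hu.2
  have h2 := bregman_nonneg hη (fun e => hc.trans_le (hu.1 e))
    (fun e => hc.trans_le (le_max_left c (w e * Real.exp (-(η e * (g e + s))))))
  exact (le_add_of_nonneg_right h2).trans h1

/-- Coordinatewise, this is non-negativity of the divergence between `v e` and the unconstrained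
step `w e * exp (-η e * g e)`, with the exponential expanded to second order. -/
theorem stability_bound {η g w v : E → ℝ} (hη : ∀ e, 0 < η e) (hw : ∀ e, 0 < w e)
    (hv : ∀ e, 0 < v e) (hg : ∀ e, |η e * g e| ≤ 1) :
    ∑ e, (w e - v e) * g e ≤ bregman η v w + ∑ e, w e * (η e * g e ^ 2) := by
  rw [bregman, ← Finset.sum_add_distrib]
  refine Finset.sum_le_sum fun e _ => ?_
  have h1 := klTerm_nonneg (hv e) (mul_pos (hw e) (Real.exp_pos (-(η e * g e))))
  rw [← div_div, Real.log_div (div_pos (hv e) (hw e)).ne' (Real.exp_pos _).ne', Real.log_exp] at h1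
  have h2 : Real.exp (-(η e * g e)) ≤ 1 - η e * g e + (η e * g e) ^ 2 := by
    have := exp_le_quadratic (x := -(η e * g e)) (by rw [abs_neg]; exact hg e)
    linarith
  have h3 := mul_le_mul_of_nonneg_left h2 (hw e).le
  have h4 : 0 ≤ 1 / η e * (v e * Real.log (v e / w e) - v e + w e
      + v e * (η e * g e) - w e * (η e * g e) + w e * (η e * g e) ^ 2) :=
    mul_nonneg (one_div_pos.2 (hη e)).le (by linarith)
  have h5 : 1 / η e * (v e * Real.log (v e / w e) - v e + w e
      + v e * (η e * g e) - w e * (η e * g e) + w e * (η e * g e) ^ 2)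
      = 1 / η e * (v e * Real.log (v e / w e) - v e + w e) + v e * g e - w e * g e
        + w e * (η e * g e ^ 2) := by
    have := (hη e).ne'
    field_simp
  linarith

end Mirror


/-! ### The regret of MsMwC -/

section Regret

variable {E : Type} [Fintype E]

/-- The logarithm of the inverse of the smallest weight. -/
def logRatio (E : Type) [Fintype E] (T : ℕ) : ℝ := Real.log ((Fintype.card E : ℝ) * T)

/-- The inverse of the learning rate. -/
def invRate (E : Type) [Fintype E] (T : ℕ) (V : ℝ) : ℝ := max 64 (√(V / logRatio E T))

theorem learningRate_eq (T : ℕ) (V : ℝ) : learningRate E T V = 1 / invRate E T V := rfl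

theorem one_le_logRatio {T : ℕ} (hT : 2 ≤ T) (hd : 2 ≤ Fintype.card E) : 1 ≤ logRatio E T := by
  rw [logRatio, Real.le_log_iff_exp_le (by positivity)]
  have h1 : (2 : ℝ) ≤ Fintype.card E := by exact_mod_cast hd
  have h2 : (2 : ℝ) ≤ T := by exact_mod_cast hT
  have := Real.exp_one_lt_d9
  nlinarith

theorem le_invRate (T : ℕ) (V : ℝ) : 64 ≤ invRate E T V := le_max_left _ _

theorem invRate_pos (T : ℕ) (V : ℝ) : 0 < invRate E T V := by
  linarith [le_invRate (E := E) T V]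

theorem learningRate_pos (T : ℕ) (V : ℝ) : 0 < learningRate E T V :=
  one_div_pos.2 (invRate_pos T V)

theorem learningRate_le (T : ℕ) (V : ℝ) : learningRate E T V ≤ 1 / 64 :=
  one_div_le_one_div_of_le (by norm_num) (le_invRate T V)

theorem invRate_mono {T : ℕ} (hL : 0 < logRatio E T) {V V' : ℝ} (h : V ≤ V') :
    invRate E T V ≤ invRate E T V' :=
  max_le_max le_rfl (Real.sqrt_le_sqrt (div_le_div_of_nonneg_right h hL.le))

/-- The squared inverse rate is `max (64²) (V / L)`, which grows by at most `x / L ≤ x`; factor the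
difference of squares. -/
theorem invRate_sub_mul_le {T : ℕ} (hL : 1 ≤ logRatio E T) {V x : ℝ} (hV : 0 ≤ V) (hx : 0 ≤ x) :
    (invRate E T (V + x) - invRate E T V) * invRate E T V ≤ x := by
  have hL0 : 0 < logRatio E T := by linarith
  have hmono := invRate_mono hL0 (show V ≤ V + x by linarith)
  have hpos := invRate_pos (E := E) T V
  have hsq : ∀ V, 0 ≤ V → invRate E T V ^ 2 = max (64 ^ 2) (V / logRatio E T) := by
    intro V hV
    rw [invRate]
    rcases le_total 64 (√(V / logRatio E T)) with h | h
    · rw [max_eq_right h, Real.sq_sqrt (by positivity), max_eq_right]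
      exact (Real.le_sqrt' (by norm_num)).1 h
    · rw [max_eq_left h, max_eq_left]
      exact (Real.sqrt_le_left (by norm_num)).1 h
  have h1 : invRate E T (V + x) ^ 2 ≤ invRate E T V ^ 2 + x := by
    rw [hsq _ hV, hsq _ (by linarith)]
    have h2 : (V + x) / logRatio E T ≤ V / logRatio E T + x := by
      rw [add_div]
      gcongr
      exact div_le_self hx hL
    refine max_le ?_ (h2.trans ?_)
    · exact (le_max_left _ _).trans (le_add_of_nonneg_right hx)
    · gcongr
      exact le_max_right _ _
  nlinarith

theorem invRate_le_add {T : ℕ} (V : ℝ) : invRate E T V ≤ 64 + √(V / logRatio E T) :=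
  max_le (le_add_of_nonneg_right (Real.sqrt_nonneg _)) (by linarith)

theorem invRate_le {T : ℕ} (hT : 1 ≤ T) (hL : 1 ≤ logRatio E T) {V : ℝ} (hV0 : 0 ≤ V)
    (hV : V ≤ T) : invRate E T V ≤ 64 * T := by
  have hT' : (1 : ℝ) ≤ T := by exact_mod_cast hT
  refine max_le (by linarith) ?_
  rw [Real.sqrt_le_left (by positivity)]
  have : V / logRatio E T ≤ V := div_le_self hV0 hL
  nlinarith

variable [DecidableEq E]

/-- The vertex `e₀` of the simplex, mixed with the uniform weights. -/
def comparator (E : Type) [Fintype E] [DecidableEq E] (T : ℕ) (e₀ e : E) : ℝ :=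
  (if e = e₀ then 1 - 1 / (T : ℝ) else 0) + 1 / ((Fintype.card E : ℝ) * T)

theorem sum_comparator_mul {T : ℕ} (e₀ : E) (f : E → ℝ) :
    ∑ e, comparator E T e₀ e * f e =
      (1 - 1 / (T : ℝ)) * f e₀ + 1 / ((Fintype.card E : ℝ) * T) * ∑ e, f e := by
  simp [comparator, add_mul, Finset.sum_add_distrib, Finset.mul_sum]

theorem le_comparator {T : ℕ} (hT : 1 ≤ T) (e₀ e : E) :
    1 / ((Fintype.card E : ℝ) * T) ≤ comparator E T e₀ e := by
  refine le_add_of_nonneg_left ?_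
  split_ifs
  · rw [sub_nonneg, div_le_one (by positivity)]
    exact_mod_cast hT
  · rfl

theorem sum_comparator {T : ℕ} (hT : 1 ≤ T) (hd : 2 ≤ Fintype.card E) (e₀ : E) :
    ∑ e, comparator E T e₀ e = 1 := by
  have h := sum_comparator_mul (T := T) e₀ (fun _ => 1)
  simp only [mul_one, Finset.sum_const, Finset.card_univ, nsmul_eq_mul] at h
  rw [h]
  have : (0 : ℝ) < Fintype.card E := by positivity
  have : (0 : ℝ) < T := by positivity
  field_simp
  ring

theorem comparator_le_one {T : ℕ} (hT : 1 ≤ T) (hd : 2 ≤ Fintype.card E) (e₀ e : E) :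
    comparator E T e₀ e ≤ 1 := by
  rw [← sum_comparator hT hd e₀]
  refine Finset.single_le_sum (fun e _ => ?_) (Finset.mem_univ e)
  exact le_trans (by positivity) (le_comparator hT e₀ e)

/-- The inverse learning rates turn a bound of the logarithms into one of the divergence terms. -/
theorem klTerm_comparator_le {T : ℕ} (hT : 2 ≤ T) (hd : 2 ≤ Fintype.card E) (e₀ e : E) {x : ℝ}
    (hx : 1 / ((Fintype.card E : ℝ) * T) ≤ x) :
    comparator E T e₀ e * Real.log (comparator E T e₀ e / x) - comparator E T e₀ e + x ≤
      (if e = e₀ then logRatio E T else 0) + x := by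
  have hT1 : 1 ≤ T := by omega
  have hc : 0 < 1 / ((Fintype.card E : ℝ) * T) := by positivity
  have hx0 : 0 < x := hc.trans_le hx
  have hu := le_comparator hT1 e₀ e
  have hu1 := comparator_le_one hT1 hd e₀ e
  have hu0 := hc.trans_le hu
  have hL := one_le_logRatio hT hd
  have h : comparator E T e₀ e * Real.log (comparator E T e₀ e / x) ≤
      (if e = e₀ then logRatio E T else 0) := by
    split_ifs with he
    · have h1 : Real.log (comparator E T e₀ e / x) ≤ logRatio E T := by
        refine Real.log_le_log (by positivity) ?_
        rw [div_le_iff₀ hx0]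
        have : 1 ≤ (Fintype.card E : ℝ) * T * x := by
          rw [div_le_iff₀ (by positivity)] at hx
          linarith
        linarith
      nlinarith
    -- Away from `e₀` the comparator equals the lower bound of the truncated simplex, so the
    -- logarithm is non-positive. Only `e₀` pays for a change of its learning rate.
    · refine mul_nonpos_of_nonneg_of_nonpos hu0.le (Real.log_nonpos (by positivity) ?_)
      rw [div_le_one hx0]
      simpa [comparator, he] using hx
  linarith

/-- The progress of an approximate MsMwC update. -/
theorem regret_step {T : ℕ} {ε : ℝ} {V l w w' : E → ℝ} (hT : 2 ≤ T) (hd : 2 ≤ Fintype.card E)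
    (hε : (Fintype.card E : ℝ) * (64 * T) * (2 * (Fintype.card E * T)) * ε ≤ 1 / T)
    (hw : w ∈ truncSimplex E T) (hl : ∀ e, |l e| ≤ 1) (hV : ∀ e, 0 ≤ V e)
    (hV' : ∀ e, V e + l e ^ 2 ≤ T) (hupd : IsMsMwCUpdate T ε V l w w') (e₀ : E) :
    ∑ e, w e * l e - l e₀ +
        bregman (fun e => learningRate E T (V e + l e ^ 2)) (comparator E T e₀) w' ≤
      bregman (fun e => learningRate E T (V e)) (comparator E T e₀) w
        + 32 * (learningRate E T (V e₀) * l e₀ ^ 2)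
        + (invRate E T (V e₀ + l e₀ ^ 2) - invRate E T (V e₀)) * logRatio E T + 4 / T := by
  have hT1 : 1 ≤ T := by omega
  have hTpos : (0 : ℝ) < T := by positivity
  have hdpos : (0 : ℝ) < Fintype.card E := by positivity
  set c := 1 / ((Fintype.card E : ℝ) * T) with hcdef
  have hc : 0 < c := by positivity
  have hL := one_le_logRatio hT hd
  have hL0 : 0 < logRatio E T := by linarith
  set η : E → ℝ := fun e => learningRate E T (V e) with hηdef
  set R : E → ℝ := fun e => invRate E T (V e) with hRdef
  set R' : E → ℝ := fun e => invRate E T (V e + l e ^ 2) with hRdef'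
  set u := comparator E T e₀ with hudef
  set g : E → ℝ := fun e => l e + 32 * η e * l e ^ 2 with hgdef
  have hη : ∀ e, 0 < η e := fun e => learningRate_pos T _
  have hη' : ∀ e, η e ≤ 1 / 64 := fun e => learningRate_le T _
  have hηR : ∀ e, 1 / η e = R e := fun e => one_div_one_div _
  have hRη : ∀ e, R e * η e = 1 := fun e => by rw [← hηR, one_div_mul_cancel (hη e).ne']
  have hRR : ∀ e, R e ≤ R' e := fun e => invRate_mono hL0 (by nlinarith [sq_nonneg (l e)])
  have hR0 : ∀ e, 0 < R e := fun e => invRate_pos T _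
  have hw0 : ∀ e, 0 < w e := fun e => hc.trans_le (hw.1 e)
  have hu : ∀ e, c ≤ u e := le_comparator hT1 e₀
  have hu0 : ∀ e, 0 < u e := fun e => hc.trans_le (hu e)
  have hu1 : ∀ e, u e ≤ 1 := comparator_le_one hT1 hd e₀
  have husum : ∑ e, u e = 1 := sum_comparator hT1 hd e₀
  have hcorr : ∀ e, |32 * η e * l e ^ 2| ≤ 1 / 2 * |l e| := by
    intro e
    rw [abs_of_nonneg (by have := hη e; positivity), ← sq_abs]
    have h1 := hη e
    have h2 := hη' e
    have h3 := hl e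
    have h4 := abs_nonneg (l e)
    have : |l e| ^ 2 ≤ |l e| := by nlinarith
    calc 32 * η e * |l e| ^ 2 ≤ 32 * (1 / 64) * |l e| := by gcongr
      _ = _ := by ring
  have hgl : ∀ e, |g e| ≤ 3 / 2 * |l e| := by
    intro e
    have := abs_add_le (l e) (32 * η e * l e ^ 2)
    have h2 := hcorr e
    change |l e + 32 * η e * l e ^ 2| ≤ _
    linarith
  have hg : ∀ e, |g e| ≤ 3 / 2 := fun e => (hgl e).trans (by linarith [hl e])
  have hg2 : ∀ e, g e ^ 2 ≤ 9 / 4 * l e ^ 2 := by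
    intro e
    rw [← sq_abs, ← sq_abs (l e)]
    nlinarith [hgl e, abs_nonneg (g e), abs_nonneg (l e)]
  have hηg : ∀ e, |η e * g e| ≤ 1 := by
    intro e
    rw [abs_mul, abs_of_pos (hη e)]
    nlinarith [hη e, hη' e, hg e, abs_nonneg (g e)]
  obtain ⟨hw', v, hv, hmin, hclose⟩ := hupd
  have hε0 : 0 ≤ ε := (abs_nonneg _).trans (hclose e₀)
  obtain ⟨s, hs, hsum⟩ := exists_clippedStep_sum_eq hη hc hw.1 hw.2 hg (by norm_num)
  have hveq : v = clippedStep c η g w s := eq_clippedStep_of_isMinOn hη hc hw0 hsum hv hmin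
  have hv0 : ∀ e, 0 < v e := fun e => hc.trans_le (hv.1 e)
  -- Both `g` and the multiplier are at most `3/2` in absolute value and `η ≤ 1/64`, so the exponent
  -- is at most `3/64`; the clipping level is below `w e` anyway.
  have hvw : ∀ e, v e ≤ 2 * w e := by
    intro e
    rw [hveq]
    refine max_le (by linarith [hw.1 e]) ?_
    rw [mul_comm]
    refine mul_le_mul_of_nonneg_right ?_ (hw0 e).le
    have h1 : -(η e * (g e + s)) ≤ 3 / 64 := by
      have h2 : -3 ≤ g e + s := by linarith [(abs_le.1 (hg e)).1, hs.1]
      nlinarith [hη e, hη' e]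
    refine (Real.exp_le_exp.2 h1).trans ((exp_le_quadratic ?_).trans ?_)
    · rw [abs_of_nonneg] <;> norm_num
    · norm_num
  -- Adding `hA` and `hB` cancels the divergence of `v` from `w` and the products of `v` with `g`.
  have hA := stability_bound hη hw0 hv0 hηg
  have hB := mirrorObjective_add_bregman_le hη hc hw0 hsum hu husum
  rw [← hveq, mirrorObjective_eq, mirrorObjective_eq] at hB
  -- the change of the learning rates
  have hC : ∑ e, R' e * (u e * Real.log (u e / v e) - u e + v e) ≤
      bregman η u v + (R' e₀ - R e₀) * logRatio E T + ∑ e, 2 * (w e * (η e * l e ^ 2)) := by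
    have h1 : (R' e₀ - R e₀) * logRatio E T =
        ∑ e, (R' e - R e) * (if e = e₀ then logRatio E T else 0) := by
      simp
    rw [h1, bregman, ← Finset.sum_add_distrib, ← Finset.sum_add_distrib]
    refine Finset.sum_le_sum fun e _ => ?_
    rw [hηR]
    have h2 := klTerm_comparator_le hT hd e₀ e (hv.1 e)
    have h3 : (R' e - R e) * v e ≤ 2 * (w e * (η e * l e ^ 2)) := by
      have h4 : R' e - R e ≤ η e * l e ^ 2 := by
        have h5 := invRate_sub_mul_le hL (hV e) (sq_nonneg (l e))
        calc R' e - R e = η e * ((R' e - R e) * R e) := by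
              rw [mul_comm (R' e - R e), ← mul_assoc, mul_comm (η e), hRη, one_mul]
          _ ≤ _ := mul_le_mul_of_nonneg_left h5 (hη e).le
      calc (R' e - R e) * v e ≤ (η e * l e ^ 2) * (2 * w e) :=
            mul_le_mul h4 (hvw e) (hv0 e).le (mul_nonneg (hη e).le (sq_nonneg _))
        _ = _ := by ring
    have h6 := mul_le_mul_of_nonneg_left h2 (sub_nonneg.2 (hRR e))
    rw [mul_add (R' e - R e) (ite _ _ _)] at h6
    linarith
  -- the inaccuracy of the update
  have hD : bregman (fun e => learningRate E T (V e + l e ^ 2)) u w' ≤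
      ∑ e, R' e * (u e * Real.log (u e / v e) - u e + v e) + 1 / T := by
    have h1 : ∀ e, R' e * (u e * Real.log (u e / w' e) - u e + w' e) ≤
        R' e * (u e * Real.log (u e / v e) - u e + v e)
          + (64 * T) * (2 * (Fintype.card E * T)) * ε := by
      intro e
      have hw0' := hc.trans_le (hw'.1 e)
      have h2 : Real.log (u e / w' e) = Real.log (u e / v e) + Real.log (v e / w' e) := by
        rw [Real.log_div (hu0 e).ne' hw0'.ne', Real.log_div (hu0 e).ne' (hv0 e).ne',
          Real.log_div (hv0 e).ne' hw0'.ne']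
        ring
      have h3 : Real.log (v e / w' e) ≤ Fintype.card E * T * ε := by
        refine (Real.log_le_sub_one_of_pos (div_pos (hv0 e) hw0')).trans ?_
        rw [div_sub_one hw0'.ne', div_le_iff₀ hw0']
        have h4 := hw'.1 e
        rw [div_le_iff₀ (by positivity)] at h4
        have h5 := (abs_le.1 (hclose e)).1
        have : ε * 1 ≤ ε * (w' e * (Fintype.card E * T)) := mul_le_mul_of_nonneg_left h4 hε0
        linarith
      have h6 := (abs_le.1 (hclose e)).2
      have h7 : 1 ≤ (Fintype.card E : ℝ) * T := by
        have : 2 ≤ (Fintype.card E : ℝ) := by exact_mod_cast hd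
        have : 2 ≤ (T : ℝ) := by exact_mod_cast hT
        nlinarith
      have h8 : u e * Real.log (v e / w' e) + (w' e - v e) ≤ 2 * (Fintype.card E * T) * ε := by
        have h9 : u e * Real.log (v e / w' e) ≤ 1 * (Fintype.card E * T * ε) := by
          refine (mul_le_mul_of_nonneg_left h3 (hu0 e).le).trans ?_
          exact mul_le_mul_of_nonneg_right (hu1 e) (by positivity)
        have : 1 * ε ≤ (Fintype.card E : ℝ) * T * ε := mul_le_mul_of_nonneg_right h7 hε0
        linarith
      have hR1 : R' e ≤ 64 * T :=
        invRate_le hT1 hL (add_nonneg (hV e) (sq_nonneg _)) (hV' e)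
      have h10 := mul_le_mul_of_nonneg_left h8 (invRate_pos (E := E) T (V e + l e ^ 2)).le
      have h11 : R' e * (2 * (Fintype.card E * T) * ε) ≤
          64 * T * (2 * (Fintype.card E * T) * ε) :=
        mul_le_mul_of_nonneg_right hR1 (by positivity)
      change R' e * _ ≤ _ at h10
      rw [h2]
      linarith
    calc bregman (fun e => learningRate E T (V e + l e ^ 2)) u w'
        = ∑ e, R' e * (u e * Real.log (u e / w' e) - u e + w' e) := by
          refine Finset.sum_congr rfl fun e _ => ?_
          change 1 / learningRate E T (V e + l e ^ 2) * _ = _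
          rw [learningRate_eq, one_div_one_div]
      _ ≤ ∑ e, (R' e * (u e * Real.log (u e / v e) - u e + v e)
          + (64 * T) * (2 * (Fintype.card E * T)) * ε) := Finset.sum_le_sum fun e _ => h1 e
      _ ≤ _ := by
          rw [Finset.sum_add_distrib, Finset.sum_const, Finset.card_univ, nsmul_eq_mul]
          linarith
  have hE : ∑ e, u e * (η e * l e ^ 2) ≤ η e₀ * l e₀ ^ 2 + 1 / 64 * (1 / T) := by
    rw [hudef, sum_comparator_mul]
    have h1 : ∑ e, η e * l e ^ 2 ≤ ∑ _e : E, (1 / 64 : ℝ) := by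
      refine Finset.sum_le_sum fun e _ => ?_
      have : l e ^ 2 ≤ 1 := by rw [← sq_abs]; exact pow_le_one₀ (abs_nonneg _) (hl e)
      nlinarith [hη e, hη' e, sq_nonneg (l e)]
    have h2 : c * ∑ e, η e * l e ^ 2 ≤ 1 / 64 * (1 / T) := by
      refine (mul_le_mul_of_nonneg_left h1 hc.le).trans (le_of_eq ?_)
      rw [Finset.sum_const, Finset.card_univ, nsmul_eq_mul, hcdef]
      field_simp
    have h3 : (1 - 1 / (T : ℝ)) * (η e₀ * l e₀ ^ 2) ≤ η e₀ * l e₀ ^ 2 := by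
      refine mul_le_of_le_one_left (mul_nonneg (hη e₀).le (sq_nonneg _)) ?_
      have : 0 < 1 / (T : ℝ) := by positivity
      linarith
    linarith
  have hF : ∑ e, u e * l e ≤ l e₀ + 2 * (1 / T) := by
    rw [hudef, sum_comparator_mul]
    have h1 : ∑ e, l e ≤ ∑ _e : E, (1 : ℝ) :=
      Finset.sum_le_sum fun e _ => (abs_le.1 (hl e)).2
    have h2 : c * ∑ e, l e ≤ 1 / T := by
      refine (mul_le_mul_of_nonneg_left h1 hc.le).trans (le_of_eq ?_)
      rw [Finset.sum_const, Finset.card_univ, nsmul_eq_mul, hcdef]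
      field_simp
    have h3 : -(1 / (T : ℝ) * l e₀) ≤ 1 / T := by
      have : 0 < 1 / (T : ℝ) := by positivity
      nlinarith [(abs_le.1 (hl e₀)).1]
    linarith
  -- This is where the correction pays off: the stability term costs `9/4` and the change of
  -- learning rates costs 2 times `∑ w η l²`, while the corrected loss of `w` contributes 32 times
  -- this sum on the left.
  have hG : ∑ e, w e * (η e * g e ^ 2) ≤ 9 / 4 * ∑ e, w e * (η e * l e ^ 2) := by
    rw [Finset.mul_sum]
    refine Finset.sum_le_sum fun e _ => ?_
    have := mul_le_mul_of_nonneg_left (hg2 e) (mul_pos (hw0 e) (hη e)).le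
    linarith
  have hH : 0 ≤ ∑ e, w e * (η e * l e ^ 2) :=
    Finset.sum_nonneg fun e _ => mul_nonneg (hw0 e).le (mul_nonneg (hη e).le (sq_nonneg _))
  have hgsum : ∀ x : E → ℝ, ∑ e, x e * g e =
      ∑ e, x e * l e + 32 * ∑ e, x e * (η e * l e ^ 2) := by
    intro x
    rw [Finset.mul_sum, ← Finset.sum_add_distrib]
    refine Finset.sum_congr rfl fun e _ => ?_
    change x e * (l e + 32 * η e * l e ^ 2) = _
    ring
  simp only [sub_mul, Finset.sum_sub_distrib] at hA
  rw [← Finset.mul_sum] at hC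
  rw [hgsum w, hgsum v] at hA
  rw [hgsum v, hgsum u] at hB
  -- The remainders are `1/T` from the inaccuracy, `2/T` from the mixing of the comparator, and `32
  -- * (1/64) / T` from its corrected loss.
  have h4T : (4 : ℝ) / T = 4 * (1 / T) := by ring
  have h0T : 0 < 1 / (T : ℝ) := by positivity
  rw [h4T]
  change ∑ e, w e * l e - l e₀ + _ ≤ bregman η u w + 32 * (η e₀ * l e₀ ^ 2)
    + (R' e₀ - R e₀) * logRatio E T + _
  linarith

end Regret


/-! ### The uniform partition -/

/-- The index of the interval of the uniform partition that contains `k / T`. -/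
def cell (N T k : ℕ) : ℕ := k * N / T - k / T

theorem cell_lt {N T k : ℕ} (hN : 0 < N) (hT : 0 < T) (hk : k ≤ T) : cell N T k < N := by
  unfold cell
  rcases hk.lt_or_eq with h | rfl
  · rw [Nat.div_eq_of_lt h, Nat.sub_zero, Nat.div_lt_iff_lt_mul hT, Nat.mul_comm N]
    exact Nat.mul_lt_mul_of_pos_right h hN
  · rw [Nat.mul_div_cancel_left N hT, Nat.div_self hT]
    omega

/-- For `k < T` the index is the floor of `k N / T`. At `k = T` this floor is `N`, and the term `k /
T = 1` moves the point 1 back into the closed last interval. -/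
theorem mem_uniformPartition_iff {N T : ℕ} (hT : 0 < T) (k : Fin (T + 1)) (i : Fin N) :
    gridPoint T k ∈ uniformPartition N i ↔ (i : ℕ) = cell N T k := by
  have hN : 0 < N := i.pos
  have hk : (k : ℕ) ≤ T := Nat.le_of_lt_succ k.2
  have hT' : (0 : ℝ) < T := by exact_mod_cast hT
  have hN' : (0 : ℝ) < N := by exact_mod_cast hN
  have h1 : ∀ j : ℕ, ((j : ℝ) / N ≤ gridPoint T k ↔ j ≤ k * N / T) := by
    intro j
    rw [gridPoint, div_le_div_iff₀ hN' hT', Nat.le_div_iff_mul_le hT]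
    norm_cast
  have h2 : gridPoint T k < ((i : ℝ) + 1) / N ↔ (k : ℕ) * N / T < i + 1 := by
    rw [← not_le, ← not_le]
    exact_mod_cast not_congr (h1 (i + 1))
  have h3 : gridPoint T k ≤ 1 := by
    rw [gridPoint, div_le_one hT']
    exact_mod_cast hk
  have hi := i.2
  have hdiv : (k : ℕ) / T ≤ 1 := by
    rw [Nat.div_le_iff_le_mul_add_pred hT]
    omega
  unfold uniformPartition
  split_ifs with h
  · rw [Set.mem_Icc, h1]
    have h4 := cell_lt hN hT hk
    have h5 : (k : ℕ) * N / T ≤ N := Nat.div_le_of_le_mul (Nat.mul_le_mul_right N hk)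
    simp only [h3, and_true]
    have h6 : (k : ℕ) / T = 1 → (k : ℕ) * N / T = N := by
      intro h7
      have : (k : ℕ) = T := by
        by_contra hne
        rw [Nat.div_eq_of_lt (lt_of_le_of_ne hk hne)] at h7
        omega
      rw [this, Nat.mul_div_cancel_left N hT]
    unfold cell at *
    generalize (k : ℕ) * N / T = a at *
    generalize (k : ℕ) / T = b at *
    omega
  · rw [Set.mem_Ico, h1, h2]
    unfold cell
    rcases hk.lt_or_eq with hlt | heq
    · rw [Nat.div_eq_of_lt hlt]
      generalize (k : ℕ) * N / T = a
      omega
    · rw [heq, Nat.mul_div_cancel_left N hT, Nat.div_self hT]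
      omega

theorem sSup_uniformPartition {N : ℕ} (i : Fin N) :
    sSup (uniformPartition N i) = ((i : ℝ) + 1) / N := by
  have hN' : (0 : ℝ) < N := by exact_mod_cast i.pos
  unfold uniformPartition
  split_ifs with h
  · have h' : ((i : ℝ) + 1) = N := by exact_mod_cast h
    rw [csSup_Icc, h', div_self hN'.ne']
    rw [div_le_one hN']
    linarith
  · rw [csSup_Ico]
    gcongr
    linarith

/-- The indicator of the `i`-th interval at the point `k / T`. -/
def inCell {T : ℕ} (N : ℕ) (i : Fin N) (k : Fin (T + 1)) : ℝ :=
  if (i : ℕ) = cell N T k then 1 else 0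

theorem indicator_uniformPartition {N T : ℕ} (hT : 0 < T) (k : Fin (T + 1)) (i : Fin N) (c : ℝ) :
    (uniformPartition N i).indicator (fun _ => c) (gridPoint T k) = inCell N i k * c := by
  unfold inCell
  simp only [Set.indicator, mem_uniformPartition_iff hT]
  split_ifs <;> simp

theorem inCell_nonneg {N T : ℕ} (i : Fin N) (k : Fin (T + 1)) : 0 ≤ inCell N i k := by
  unfold inCell
  split_ifs <;> norm_num

theorem inCell_mul_self {N T : ℕ} (i : Fin N) (k : Fin (T + 1)) :
    inCell N i k * inCell N i k = inCell N i k := by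
  unfold inCell
  split_ifs <;> norm_num

theorem sum_inCell_mul {N T : ℕ} (hN : 0 < N) (hT : 0 < T) (k : Fin (T + 1)) (f : Fin N → ℝ) :
    ∑ i, inCell N i k * f i = f ⟨cell N T k, cell_lt hN hT (Nat.le_of_lt_succ k.2)⟩ := by
  rw [Finset.sum_eq_single ⟨cell N T k, cell_lt hN hT (Nat.le_of_lt_succ k.2)⟩]
  · simp [inCell]
  · intro i _ hi
    have : (i : ℕ) ≠ cell N T k := fun h => hi (Fin.ext h)
    simp [inCell, this]
  · simp

theorem sum_inCell {N T : ℕ} (hN : 0 < N) (hT : 0 < T) (k : Fin (T + 1)) :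
    ∑ i, inCell N i k = 1 := by
  simpa using sum_inCell_mul hN hT k fun _ => 1

theorem forecast_uniformPartition {N T : ℕ} (hN : 0 < N) (hT : 0 < T) (k : Fin (T + 1)) :
    forecast (uniformPartition N) (gridPoint T k) = ((cell N T k : ℝ) + 1) / N := by
  simp only [forecast, indicator_uniformPartition hT, sSup_uniformPartition, sum_inCell_mul hN hT]

theorem gridPoint_mem_Icc {T : ℕ} (hT : 0 < T) (k : Fin (T + 1)) :
    0 ≤ gridPoint T k ∧ gridPoint T k ≤ 1 := by
  have hT' : (0 : ℝ) < T := by exact_mod_cast hT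
  refine ⟨by unfold gridPoint; positivity, ?_⟩
  rw [gridPoint, div_le_one hT']
  exact_mod_cast Nat.le_of_lt_succ k.2

theorem abs_gridPoint_sub_outcome_le {T : ℕ} (hT : 0 < T) (k : Fin (T + 1)) (y : Bool) :
    |gridPoint T k - outcome y| ≤ 1 := by
  have := gridPoint_mem_Icc hT k
  rw [abs_le]
  cases y <;> simp [outcome] <;> constructor <;> linarith

/-! ### Gains -/

/-- The probability that the sampled point lies in the `i`-th interval. -/
def cellMass {N T : ℕ} (P : PMF (Fin (T + 1))) (i : Fin N) : ℝ :=
  ∑ k, (P k).toReal * inCell N i k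

/-- The expectation of `1[u ∈ J_i] (u - y)`. -/
def cellGain {N T : ℕ} (P : PMF (Fin (T + 1))) (y : Bool) (i : Fin N) : ℝ :=
  ∑ k, (P k).toReal * (inCell N i k * (gridPoint T k - outcome y))

theorem expertGain_eq {N T : ℕ} (hT : 0 < T) (P : PMF (Fin (T + 1))) (y : Bool) (e : Expert N) :
    expertGain (uniformPartition N) P y e = signValue e.2 * cellGain P y e.1 := by
  rw [expertGain, cellGain, Finset.mul_sum]
  refine Finset.sum_congr rfl fun k _ => ?_
  rw [indicator_uniformPartition hT]
  ring

theorem cellMass_nonneg {N T : ℕ} (P : PMF (Fin (T + 1))) (i : Fin N) : 0 ≤ cellMass P i :=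
  Finset.sum_nonneg fun k _ => mul_nonneg ENNReal.toReal_nonneg (inCell_nonneg i k)

theorem sum_cellMass {N T : ℕ} (hN : 0 < N) (hT : 0 < T) (P : PMF (Fin (T + 1))) :
    ∑ i : Fin N, cellMass P i = 1 := by
  simp only [cellMass]
  rw [Finset.sum_comm]
  simp only [← Finset.mul_sum, sum_inCell hN hT, mul_one, sum_toReal_eq_one]

theorem cellMass_le_one {N T : ℕ} (hT : 0 < T) (P : PMF (Fin (T + 1))) (i : Fin N) :
    cellMass P i ≤ 1 := by
  rw [← sum_cellMass i.pos hT P]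
  exact Finset.single_le_sum (fun j _ => cellMass_nonneg P j) (Finset.mem_univ i)

theorem abs_cellGain_le {N T : ℕ} (hT : 0 < T) (P : PMF (Fin (T + 1))) (y : Bool) (i : Fin N) :
    |cellGain P y i| ≤ cellMass P i := by
  refine (Finset.abs_sum_le_sum_abs _ _).trans (Finset.sum_le_sum fun k _ => ?_)
  rw [abs_mul, abs_mul, abs_of_nonneg ENNReal.toReal_nonneg, abs_of_nonneg (inCell_nonneg i k)]
  have h1 := abs_gridPoint_sub_outcome_le hT k y
  have h2 : 0 ≤ (P k).toReal := ENNReal.toReal_nonneg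
  gcongr
  exact mul_le_of_le_one_right (inCell_nonneg i k) h1

theorem abs_signValue (s : ℤˣ) : |signValue s| = 1 := by
  rcases Int.units_eq_one_or s with rfl | rfl <;> simp [signValue]

theorem abs_expertGain_le {N T : ℕ} (hT : 0 < T) (P : PMF (Fin (T + 1))) (y : Bool)
    (e : Expert N) : |expertGain (uniformPartition N) P y e| ≤ cellMass P e.1 := by
  rw [expertGain_eq hT, abs_mul, abs_signValue, one_mul]
  exact abs_cellGain_le hT P y e.1

/-! ### The gain of the algorithm -/

theorem sum_eq_of_two_points {α : Type*} [Fintype α] [DecidableEq α] (P : PMF α) {a b : α}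
    (hab : a ≠ b) (h : (P a).toReal + (P b).toReal = 1) (f : α → ℝ) :
    ∑ k, (P k).toReal * f k = (P a).toReal * f a + (P b).toReal * f b := by
  have h1 := sum_toReal_eq_one P
  rw [← Finset.sum_subset (Finset.subset_univ {a, b}), Finset.sum_pair hab]
  intro k _ hk
  have h2 : ∑ k ∈ ({a, b} : Finset α)ᶜ, (P k).toReal = 0 := by
    have := Finset.sum_add_sum_compl ({a, b} : Finset α) fun k => (P k).toReal
    rw [h1, Finset.sum_pair hab] at this
    linarith
  rw [(Finset.sum_eq_zero_iff_of_nonneg fun k _ => ENNReal.toReal_nonneg).1 h2 k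
    (Finset.mem_compl.2 hk), zero_mul]

theorem sum_pure_toReal {α : Type*} [Fintype α] (a : α) (f : α → ℝ) :
    ∑ k, (PMF.pure a k).toReal * f k = f a := by
  classical
  rw [Finset.sum_eq_single a]
  · simp
  · intro b _ hb
    simp [PMF.pure_apply, hb]
  · simp

/-- At an end point the sign of `Φ` is opposite to that of `u - y`, whatever `y` is. Otherwise the
masses are chosen so that `Φ` has mean zero; if the two points had the same `u - y` the gain would
vanish, and they differ only by the spacing `1/T`. -/
theorem sampling_gain_le {T : ℕ} (hT : 0 < T) {Φ : ℝ → ℝ} (hΦ : ∀ u, |Φ u| ≤ 1)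
    {P : PMF (Fin (T + 1))} (hP : IsSamplingRule Φ P) (y : Bool) :
    ∑ k, (P k).toReal * (Φ (gridPoint T k) * (gridPoint T k - outcome y)) ≤ 1 / T := by
  have hT' : (0 : ℝ) < T := by exact_mod_cast hT
  have hpos : (0 : ℝ) ≤ 1 / T := by positivity
  obtain ⟨h1, h2, h3⟩ := hP
  rcases lt_or_ge 0 (Φ 0) with h0 | h0
  · rw [h1 h0, sum_pure_toReal]
    refine le_trans ?_ hpos
    have : gridPoint T 0 = 0 := by simp [gridPoint]
    rw [this]
    refine mul_nonpos_of_nonneg_of_nonpos h0.le ?_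
    cases y <;> simp [outcome]
  rcases lt_or_ge 0 (Φ 1) with h1' | h1'
  swap
  · rw [h2 h0 h1', sum_pure_toReal]
    refine le_trans ?_ hpos
    have : gridPoint T (Fin.last T) = 1 := by simp [gridPoint, hT'.ne']
    rw [this]
    refine mul_nonpos_of_nonpos_of_nonneg h1' ?_
    cases y <;> simp [outcome]
  obtain ⟨k, hk1, hk2, hk3⟩ := h3 h0 h1'
  rw [sum_eq_of_two_points P (Fin.castSucc_lt_succ (i := k)).ne hk2]
  set A := Φ (gridPoint T k.castSucc)
  set B := Φ (gridPoint T k.succ) with hB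
  set a := (P k.castSucc).toReal
  have hb : (P k.succ).toReal = 1 - a := by linarith
  have hx : gridPoint T k.succ = gridPoint T k.castSucc + 1 / T := by
    simp [gridPoint, add_div]
  have ha0 : 0 ≤ a := ENNReal.toReal_nonneg
  have hb0 : 0 ≤ 1 - a := by rw [← hb]; exact ENNReal.toReal_nonneg
  -- If both potentials are non-negative, the sign condition makes one of them vanish, and the mass
  -- identity still gives the balance; when both vanish, any `a` will do.
  have hbal : a * A + (1 - a) * B = 0 := by
    rcases abs_cases A with ⟨hA', hA⟩ | ⟨hA', hA⟩ <;> rcases abs_cases B with ⟨hB', hB⟩ | ⟨hB', hB⟩ <;>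
      rw [hA', hB'] at hk3
    · have : A * B = 0 := le_antisymm hk1 (mul_nonneg hA hB)
      rcases mul_eq_zero.1 this with h | h <;> rw [h] at hk3 ⊢ <;> linarith
    · linarith
    · linarith
    · nlinarith [mul_pos_of_neg_of_neg hA hB]
  rw [hb, hx]
  have hB1 : (1 - a) * B ≤ 1 := by
    have := (abs_le.1 (hΦ (gridPoint T k.succ))).2
    rw [← hB] at this
    nlinarith
  have : (1 - a) * B * (1 / T) ≤ 1 * (1 / T) := mul_le_mul_of_nonneg_right hB1 hpos
  have heq : a * (A * (gridPoint T k.castSucc - outcome y)) +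
      (1 - a) * (B * (gridPoint T k.castSucc + 1 / T - outcome y)) =
      (a * A + (1 - a) * B) * (gridPoint T k.castSucc - outcome y) + (1 - a) * B * (1 / T) := by
    ring
  rw [heq, hbal]
  linarith

theorem abs_potential_le {N T : ℕ} (J : Fin N → Set ℝ) {w : Expert N → ℝ}
    (hw : w ∈ truncSimplex (Expert N) T) (u : ℝ) : |potential J w u| ≤ 1 := by
  rw [← hw.2, potential]
  refine (Finset.abs_sum_le_sum_abs _ _).trans (Finset.sum_le_sum fun e _ => ?_)
  have hw0 : 0 ≤ w e := le_trans (by positivity) (hw.1 e)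
  rw [abs_mul, abs_mul, abs_signValue, abs_of_nonneg hw0, mul_one]
  refine mul_le_of_le_one_right hw0 ?_
  by_cases h : u ∈ J e.1 <;> simp [h]

/-- Exchanging the sums turns the weighted gain into the mean of `Φ(u) (u - y)`. -/
theorem sum_weight_mul_expertGain_le {N T : ℕ} (hT : 0 < T) (J : Fin N → Set ℝ)
    {w : Expert N → ℝ} (hw : w ∈ truncSimplex (Expert N) T) {P : PMF (Fin (T + 1))}
    (hP : IsSamplingRule (potential J w) P) (y : Bool) :
    ∑ e, w e * expertGain J P y e ≤ 1 / T := by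
  refine le_trans (le_of_eq ?_) (sampling_gain_le hT (abs_potential_le J hw) hP y)
  simp only [expertGain, potential, Finset.mul_sum, Finset.sum_mul]
  rw [Finset.sum_comm]
  refine Finset.sum_congr rfl fun k _ => Finset.sum_congr rfl fun e _ => ?_
  ring

/-! ### The regret along a history -/

section History

variable {N T : ℕ}

theorem card_expert (N : ℕ) : Fintype.card (Expert N) = 2 * N := by
  rw [Fintype.card_prod, Fintype.card_fin, Fintype.card_units_int, mul_comm]

theorem weight_mem_truncSimplex {ε : ℝ} {J : Fin N → Set ℝ} {F : Forecaster N T} (hN : 0 < N)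
    (hT : 0 < T) (hF : IsCalibrationAlgorithm ε J F) (h : List (Round T)) (hh : h.length ≤ T) :
    F.weight h ∈ truncSimplex (Expert N) T := by
  cases h with
  | nil =>
    have hd : (0 : ℝ) < Fintype.card (Expert N) := by rw [card_expert]; positivity
    constructor
    · intro e
      rw [hF.1]
      refine one_div_le_one_div_of_le hd (le_mul_of_one_le_right hd.le ?_)
      exact_mod_cast hT
    · simp only [hF.1, Finset.sum_const, Finset.card_univ, nsmul_eq_mul]
      field_simp
  | cons r h => exact (hF.2.1 h r hh).1

theorem squareSum_eq_pathSum (J : Fin N → Set ℝ) (F : Forecaster N T) (h : List (Round T))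
    (e : Expert N) :
    squareSum J F h e = pathSum (fun h r => expertGain J (F.dist h) r.1 e ^ 2) h := by
  induction h with
  | nil => rfl
  | cons r h ih => rw [squareSum, pathSum, ih]

theorem pathSum_mono {R : Type*} {X Y : List R → R → ℝ} (hXY : ∀ h r, X h r ≤ Y h r) (h : List R) :
    pathSum X h ≤ pathSum Y h := by
  induction h with
  | nil => exact le_rfl
  | cons r h ih => exact add_le_add ih (hXY h r)

theorem pathSum_const {R : Type*} (c : ℝ) (h : List R) :
    pathSum (fun _ _ => c) h = c * h.length := by
  induction h with
  | nil => simp [pathSum]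
  | cons r h ih => rw [pathSum, ih]; push_cast [List.length_cons]; ring

theorem pathSum_nonneg {R : Type*} {X : List R → R → ℝ} (hX : ∀ h r, 0 ≤ X h r) (h : List R) :
    0 ≤ pathSum X h := by
  have := pathSum_mono hX h
  rwa [pathSum_const, zero_mul] at this

/-- A discrete integration that makes `∑ η l²` telescope. The difference of the two roots is `L x`
over their sum, and this sum is at most `4 R L` since `V ≤ L R²` for the inverse rate `R ≥ 64`. -/
theorem div_invRate_le {E : Type} [Fintype E] {L V x : ℝ} (hL : L = logRatio E T) (hL1 : 1 ≤ L)
    (hV : 0 ≤ V) (hx : 0 ≤ x) (hx1 : x ≤ 1) :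
    learningRate E T V * x ≤ 4 * (√(L * (V + x + 1)) - √(L * (V + 1))) := by
  rw [learningRate_eq, one_div_mul_eq_div, div_le_iff₀ (invRate_pos T V)]
  set R := invRate E T V with hR
  have hR64 : 64 ≤ R := le_invRate T V
  have hL0 : 0 < L := by linarith
  have hRV : V ≤ L * R ^ 2 := by
    have h1 : √(V / L) ≤ R := by rw [hL]; exact le_max_right _ _
    have h2 := (Real.sqrt_le_left (by linarith)).1 h1
    rwa [div_le_iff₀ hL0, mul_comm] at h2
  have hp := Real.mul_self_sqrt (show 0 ≤ L * (V + 1) by positivity)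
  have hq := Real.mul_self_sqrt (show 0 ≤ L * (V + x + 1) by positivity)
  have hpq : √(L * (V + 1)) ≤ √(L * (V + x + 1)) := Real.sqrt_le_sqrt (by nlinarith)
  have hq2 : √(L * (V + x + 1)) ≤ 2 * R * L := by
    rw [Real.sqrt_le_left (by positivity)]
    have h3 : V + x + 1 ≤ 4 * (L * R ^ 2) := by nlinarith
    nlinarith
  set p := √(L * (V + 1))
  set q := √(L * (V + x + 1))
  have hpq2 : (q - p) * (q + p) = L * x := by
    rw [mul_comm L x]
    linarith
  have h4 : (q - p) * (q + p) ≤ (q - p) * (4 * R * L) :=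
    mul_le_mul_of_nonneg_left (by linarith) (by linarith)
  have h5 : L * x ≤ L * (4 * (q - p) * R) := by rw [← hpq2]; linarith
  exact le_of_mul_le_mul_left h5 hL0

theorem bregman_uniform_le {E : Type} [Fintype E] [DecidableEq E] (hT : 2 ≤ T)
    (hd : 2 ≤ Fintype.card E) (e₀ : E) (w : E → ℝ) (hw : ∀ e, w e = 1 / (Fintype.card E : ℝ)) :
    bregman (fun _ => learningRate E T 0) (comparator E T e₀) w ≤ 64 * logRatio E T := by
  have hdpos : (0 : ℝ) < Fintype.card E := by positivity
  have hT1 : 1 ≤ T := by omega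
  have hL := one_le_logRatio hT hd
  have hsum := sum_comparator hT1 hd e₀
  have h64 : 1 / learningRate E T 0 = 64 := by
    rw [learningRate_eq, one_div_one_div, invRate]
    simp
  rw [bregman, h64, ← Finset.mul_sum]
  refine mul_le_mul_of_nonneg_left ?_ (by norm_num)
  rw [Finset.sum_add_distrib, Finset.sum_sub_distrib, hsum]
  have h1 : ∑ e, w e = 1 := by
    simp only [hw, Finset.sum_const, Finset.card_univ, nsmul_eq_mul]
    field_simp
  rw [h1, sub_add_cancel]
  calc ∑ e, comparator E T e₀ e * Real.log (comparator E T e₀ e / w e)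
      ≤ ∑ e, comparator E T e₀ e * logRatio E T := by
        refine Finset.sum_le_sum fun e _ => ?_
        have hu := le_comparator hT1 e₀ e
        have hu0 : 0 < comparator E T e₀ e := lt_of_lt_of_le (by positivity) hu
        refine mul_le_mul_of_nonneg_left (Real.log_le_log (by rw [hw]; positivity) ?_) hu0.le
        rw [hw, div_div_eq_mul_div, div_one, mul_comm]
        refine mul_le_mul_of_nonneg_left ((comparator_le_one hT1 hd e₀ e).trans ?_) hdpos.le
        exact_mod_cast hT1
    _ = logRatio E T := by rw [← Finset.sum_mul, hsum, one_mul]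

/-- The steps telescope: the terms `32 η l²` add up to `32 * 4` times a square root by
`div_invRate_le`, and the increments of the inverse rate of `e₀` add up to its current value. The
divergence stays on the left so that the induction closes. -/
theorem regret_along_history {ε : ℝ} {F : Forecaster N T} (hN : 0 < N) (hT : 2 ≤ T)
    (hε : (Fintype.card (Expert N) : ℝ) * (64 * T) * (2 * (Fintype.card (Expert N) * T)) * ε ≤ 1 / T)
    (hF : IsCalibrationAlgorithm ε (uniformPartition N) F) (e₀ : Expert N)
    (h : List (Round T)) (hh : h.length ≤ T) :
    pathSum (fun h r => expertGain (uniformPartition N) (F.dist h) r.1 e₀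
        - ∑ e, F.weight h e * expertGain (uniformPartition N) (F.dist h) r.1 e) h
      + bregman (fun e => learningRate (Expert N) T (squareSum (uniformPartition N) F h e))
        (comparator (Expert N) T e₀) (F.weight h) ≤
      64 * logRatio (Expert N) T
      + 128 * √(logRatio (Expert N) T * (squareSum (uniformPartition N) F h e₀ + 1))
      + invRate (Expert N) T (squareSum (uniformPartition N) F h e₀) * logRatio (Expert N) T
      + 4 / T * h.length := by
  have hT0 : 0 < T := by omega
  have hd : 2 ≤ Fintype.card (Expert N) := by rw [card_expert]; omega
  have hL := one_le_logRatio hT hd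
  have hg : ∀ h y e, |expertGain (uniformPartition N) (F.dist h) y e| ≤ 1 := fun h y e =>
    (abs_expertGain_le hT0 _ _ _).trans (cellMass_le_one hT0 _ _)
  have hg2 : ∀ h y e, expertGain (uniformPartition N) (F.dist h) y e ^ 2 ≤ 1 := by
    intro h y e
    rw [← sq_abs]
    exact pow_le_one₀ (abs_nonneg _) (hg h y e)
  induction h with
  | nil =>
    have := bregman_uniform_le hT hd e₀ (F.weight []) hF.1
    simp only [pathSum, squareSum, zero_add, List.length_nil, Nat.cast_zero, mul_zero, add_zero]
    have h1 : 0 ≤ invRate (Expert N) T 0 * logRatio (Expert N) T :=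
      mul_nonneg (invRate_pos T 0).le (by linarith)
    have h2 := Real.sqrt_nonneg (logRatio (Expert N) T * 1)
    linarith
  | cons r h ih =>
    have hlt : h.length < T := hh
    have ih := ih hlt.le
    have hV0 : ∀ e, 0 ≤ squareSum (uniformPartition N) F h e := by
      intro e
      rw [squareSum_eq_pathSum]
      exact pathSum_nonneg (fun _ _ => sq_nonneg _) h
    have hV1 : ∀ e, squareSum (uniformPartition N) F h e ≤ h.length := by
      intro e
      rw [squareSum_eq_pathSum]
      have := pathSum_mono (fun h (r : Round T) => hg2 h r.1 e) h
      rwa [pathSum_const, one_mul] at this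
    have hlen : (h.length : ℝ) + 1 ≤ T := by exact_mod_cast hlt
    have step := regret_step hT hd hε (weight_mem_truncSimplex hN hT0 hF h hlt.le)
      (fun e => by rw [abs_neg]; exact hg h r.1 e) hV0
      (fun e => by rw [neg_sq]; linarith [hV1 e, hg2 h r.1 e]) (hF.2.1 h r hlt) e₀
    have hmass := div_invRate_le (E := Expert N) (T := T) rfl hL (hV0 e₀)
      (sq_nonneg (expertGain (uniformPartition N) (F.dist h) r.1 e₀)) (hg2 h r.1 e₀)
    simp only [neg_sq, mul_neg, Finset.sum_neg_distrib] at step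
    rw [pathSum, List.length_cons]
    simp only [squareSum]
    push_cast
    linarith

/-- The regret bound of MsMwC, applied to the calibration algorithm. -/
theorem pathSum_expertGain_le {ε : ℝ} {F : Forecaster N T} (hN : 0 < N) (hT : 2 ≤ T)
    (hε : (Fintype.card (Expert N) : ℝ) * (64 * T) * (2 * (Fintype.card (Expert N) * T)) * ε ≤ 1 / T)
    (hF : IsCalibrationAlgorithm ε (uniformPartition N) F) (e₀ : Expert N)
    (h : List (Round T)) (hh : h.length ≤ T) :
    pathSum (fun h r => expertGain (uniformPartition N) (F.dist h) r.1 e₀) h ≤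
      300 * (√(logRatio (Expert N) T * pathSum (fun h _ => cellMass (F.dist h) e₀.1) h)
        + logRatio (Expert N) T) := by
  have hT0 : 0 < T := by omega
  have hTpos : (0 : ℝ) < T := by exact_mod_cast hT0
  have hd : 2 ≤ Fintype.card (Expert N) := by rw [card_expert]; omega
  have hL := one_le_logRatio hT hd
  have hmain := regret_along_history hN hT hε hF e₀ h hh
  have hweight : ∀ e, 0 < F.weight h e := fun e =>
    lt_of_lt_of_le (by positivity) ((weight_mem_truncSimplex hN hT0 hF h hh).1 e)
  have hbreg := bregman_nonneg
    (fun e => learningRate_pos (E := Expert N) T (squareSum (uniformPartition N) F h e))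
    (fun e => lt_of_lt_of_le (by positivity) (le_comparator (T := T) (by omega) e₀ e)) hweight
  -- The algorithm itself gains at most `1/T` per round, so the regret bounds the gain of `e₀`
  -- alone, up to 1 in total.
  have hsplit : ∀ h : List (Round T), h.length ≤ T →
      pathSum (fun h r => expertGain (uniformPartition N) (F.dist h) r.1 e₀) h ≤
      pathSum (fun h r => expertGain (uniformPartition N) (F.dist h) r.1 e₀
        - ∑ e, F.weight h e * expertGain (uniformPartition N) (F.dist h) r.1 e) h
      + 1 / T * h.length := by
    intro h hh
    induction h with
    | nil => simp [pathSum]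
    | cons r h ih =>
      have hlt : h.length < T := hh
      have := ih hlt.le
      have h2 := sum_weight_mul_expertGain_le hT0 (uniformPartition N)
        (weight_mem_truncSimplex hN hT0 hF h hlt.le) (hF.2.2 h hlt) r.1
      rw [pathSum, pathSum, List.length_cons]
      push_cast
      linarith
  have h1 := hsplit h hh
  have hlen : (h.length : ℝ) ≤ T := by exact_mod_cast hh
  have h2 : 1 / (T : ℝ) * h.length ≤ 1 := by
    rw [one_div_mul_eq_div, div_le_one hTpos]
    exact hlen
  have h3 : 4 / (T : ℝ) * h.length = 4 * (1 / T * h.length) := by ring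
  set L := logRatio (Expert N) T with hLdef
  set V := squareSum (uniformPartition N) F h e₀ with hVdef
  set m := pathSum (fun h (_ : Round T) => cellMass (F.dist h) e₀.1) h with hm
  have hV0 : 0 ≤ V := by
    rw [hVdef, squareSum_eq_pathSum]
    exact pathSum_nonneg (fun _ _ => sq_nonneg _) h
  -- A gain is bounded by the mass of its interval, which is at most 1, hence so is its square. The
  -- regret is thereby expressed through the expected number of visits.
  have hVm : V ≤ m := by
    rw [hVdef, squareSum_eq_pathSum]
    refine pathSum_mono (fun h r => ?_) h
    have h4 := abs_expertGain_le hT0 (F.dist h) r.1 e₀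
    have h5 := cellMass_le_one hT0 (F.dist h) e₀.1
    rw [← sq_abs]
    nlinarith [abs_nonneg (expertGain (uniformPartition N) (F.dist h) r.1 e₀)]
  have hL0 : 0 < L := by linarith
  have h6 : √(L * (V + 1)) ≤ √(L * m) + L := by
    rw [Real.sqrt_le_left (by positivity)]
    have h7 := Real.mul_self_sqrt (mul_nonneg hL0.le (hV0.trans hVm))
    have h8 := mul_le_mul_of_nonneg_left hVm hL0.le
    nlinarith [Real.sqrt_nonneg (L * m)]
  have h9 : invRate (Expert N) T V * L ≤ 64 * L + √(L * m) := by
    have h10 : √(V / L) * L = √(L * V) := by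
      rw [Real.sqrt_div hV0, Real.sqrt_mul hL0.le, div_mul_eq_mul_div, mul_div_assoc,
        Real.div_sqrt, mul_comm]
    have h11 := mul_le_mul_of_nonneg_right (invRate_le_add (E := Expert N) (T := T) V) hL0.le
    rw [add_mul, ← hLdef, h10] at h11
    exact h11.trans (add_le_add le_rfl (Real.sqrt_le_sqrt (mul_le_mul_of_nonneg_left hVm hL0.le)))
  have := Real.sqrt_nonneg (L * m)
  linarith

/-- The two signs of an interval give the two sides of the absolute value. -/
theorem abs_pathSum_cellGain_le {ε : ℝ} {F : Forecaster N T} (hN : 0 < N) (hT : 2 ≤ T)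
    (hε : (Fintype.card (Expert N) : ℝ) * (64 * T) * (2 * (Fintype.card (Expert N) * T)) * ε ≤ 1 / T)
    (hF : IsCalibrationAlgorithm ε (uniformPartition N) F) (i : Fin N)
    (h : List (Round T)) (hh : h.length ≤ T) :
    |pathSum (fun h r => cellGain (F.dist h) r.1 i) h| ≤
      300 * (√(logRatio (Expert N) T * pathSum (fun h _ => cellMass (F.dist h) i) h)
        + logRatio (Expert N) T) := by
  have hT0 : 0 < T := by omega
  have h1 := pathSum_expertGain_le hN hT hε hF (i, 1) h hh
  have h2 := pathSum_expertGain_le hN hT hε hF (i, -1) h hh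
  have hneg : ∀ h : List (Round T), pathSum (fun h r => -cellGain (F.dist h) r.1 i) h =
      -pathSum (fun h r => cellGain (F.dist h) r.1 i) h := by
    intro h
    induction h with
    | nil => simp [pathSum]
    | cons r h ih => rw [pathSum, pathSum, ih]; ring
  simp only [expertGain_eq hT0, signValue, Units.val_one, Units.val_neg, Int.cast_one,
    Int.cast_neg, one_mul, neg_mul, hneg] at h1 h2
  rw [abs_le]
  constructor <;> linarith

end History


/-! ### Sums over the intervals of the partition -/

section Occupation

/-- Every distance to `j` occurs at most twice, which leaves two harmonic sums. The possible
distance 0 contributes nothing, as its inverse is 0 here. -/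
theorem sum_inv_natAbs_le (N : ℕ) (j : ℤ) (hj : 0 ≤ j) (hjN : j ≤ N) :
    ∑ i : Fin N, ((((i : ℤ) + 1 - j).natAbs : ℝ))⁻¹ ≤ 2 * (1 + Real.log N) := by
  have hmaps : ∀ i ∈ (Finset.univ : Finset (Fin N)),
      ((i : ℤ) + 1 - j).natAbs ∈ Finset.range (N + 1) := by
    intro i _
    have := i.2
    rw [Finset.mem_range]
    omega
  have hharm : ∑ n ∈ Finset.range (N + 1), ((n : ℝ))⁻¹ ≤ 1 + Real.log N := by
    have := harmonic_le_one_add_log N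
    rw [Finset.sum_range_succ']
    simpa [harmonic] using this
  rw [← Finset.sum_fiberwise_of_maps_to hmaps]
  calc _
      ≤ ∑ n ∈ Finset.range (N + 1), 2 * ((n : ℝ))⁻¹ := by
        refine Finset.sum_le_sum fun n _ => ?_
        rw [Finset.sum_congr rfl (g := fun _ => ((n : ℝ))⁻¹)
          fun i hi => by rw [(Finset.mem_filter.1 hi).2], Finset.sum_const, nsmul_eq_mul]
        gcongr
        have hcard : (Finset.univ.filter fun i : Fin N => ((i : ℤ) + 1 - j).natAbs = n).card ≤
            ({j + n, j - n} : Finset ℤ).card := by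
          refine Finset.card_le_card_of_injOn (fun i => (i : ℤ) + 1) ?_ ?_
          · intro i hi
            have := (Finset.mem_filter.1 hi).2
            simp only [Finset.coe_insert, Finset.coe_singleton, Set.mem_insert_iff,
              Set.mem_singleton_iff]
            omega
          · intro a _ b _ hab
            refine Fin.ext ?_
            simp only [add_left_inj, Nat.cast_inj] at hab
            exact hab
        exact_mod_cast hcard.trans Finset.card_le_two
    _ ≤ 2 * (1 + Real.log N) := by
        rw [← Finset.mul_sum]
        exact mul_le_mul_of_nonneg_left hharm zero_le_two

theorem card_near_le (N : ℕ) (j : ℤ) :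
    (Finset.univ.filter fun i : Fin N => ((i : ℤ) + 1 - j).natAbs < 4).card ≤ 7 := by
  have h : (Finset.univ.filter fun i : Fin N => ((i : ℤ) + 1 - j).natAbs < 4).card ≤
      (Finset.Icc (j - 3) (j + 3)).card := by
    refine Finset.card_le_card_of_injOn (fun i => (i : ℤ) + 1) ?_ ?_
    · intro i hi
      have := (Finset.mem_filter.1 hi).2
      simp only [Finset.coe_Icc, Set.mem_Icc]
      omega
    · intro a _ b _ hab
      refine Fin.ext ?_
      simp only [add_left_inj, Nat.cast_inj] at hab
      exact hab
  rw [Int.card_Icc] at h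
  omega

/-- The drift inequality is quadratic in `x = √(s m)`: after multiplication by `s / δ` it reads `x²
≤ 2 z² + 4 t x + 4 t²`, with `z² = s c / δ` and `t = κ s / δ`, and this forces `x ≤ 2 z + 5 t`. -/
theorem sqrt_le_of_drift {κ s δ m c : ℝ} (hκ : 1 ≤ κ) (hs : 0 ≤ s) (hδ : 0 < δ) (hδ1 : δ ≤ 1)
    (hm : 0 ≤ m) (hc : 0 ≤ c) (h : δ * m ≤ 2 * (c + 2 * κ * (√(s * m) + s))) :
    √(s * m) ≤ 2 * (√(s * c) * √(1 / δ)) + 5 * κ * s * (1 / δ) := by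
  set x := √(s * m) with hx
  have hx2 : x * x = s * m := Real.mul_self_sqrt (mul_nonneg hs hm)
  have hx0 : 0 ≤ x := Real.sqrt_nonneg _
  set z := √(s * c) * √(1 / δ) with hz
  have hz0 : 0 ≤ z := by positivity
  have hz2 : z * z * δ = s * c := by
    have h1 := Real.mul_self_sqrt (mul_nonneg hs hc)
    have h2 := Real.mul_self_sqrt (one_div_pos.2 hδ).le
    calc z * z * δ = (√(s * c) * √(s * c)) * ((√(1 / δ) * √(1 / δ)) * δ) := by rw [hz]; ring
      _ = s * c := by rw [h1, h2, one_div_mul_cancel hδ.ne', mul_one]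
  set y := s * (1 / δ) with hy
  have hyδ : y * δ = s := by rw [hy, mul_assoc, one_div_mul_cancel hδ.ne', mul_one]
  have hy0 : 0 ≤ y := by positivity
  have hsy : s ≤ y := by rw [← hyδ]; exact mul_le_of_le_one_right hy0 hδ1
  have h1 : δ * (x * x) ≤ δ * (2 * (z * z) + 4 * κ * (y * x) + 4 * κ * (y * y)) := by
    have h2 := mul_le_mul_of_nonneg_left h hs
    have h3 : s * (δ * m) = δ * (x * x) := by rw [hx2]; ring
    have h4 : s * (2 * (c + 2 * κ * (x + s))) = 2 * (s * c) + 4 * κ * (s * x) + 4 * κ * (s * s) := by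
      ring
    have h5 : δ * (2 * (z * z) + 4 * κ * (y * x) + 4 * κ * (y * y)) =
        2 * (z * z * δ) + 4 * κ * ((y * δ) * x) + 4 * κ * (y * (y * δ)) := by ring
    rw [h3, h4] at h2
    rw [h5, hz2, hyδ]
    have h6 : s * s ≤ y * s := mul_le_mul_of_nonneg_right hsy hs
    nlinarith
  have h7 := le_of_mul_le_mul_left h1 hδ
  have h8 : 5 * κ * s * (1 / δ) = 5 * (κ * y) := by rw [hy]; ring
  rw [h8]
  have hκy : y ≤ κ * y := le_mul_of_one_le_left hy0 hκ
  have h9 : x * x ≤ 2 * (z * z) + 4 * ((κ * y) * x) + 4 * ((κ * y) * (κ * y)) := by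
    have : κ * (y * y) ≤ (κ * y) * (κ * y) := by nlinarith
    linarith
  by_contra hcon
  push Not at hcon
  set t := κ * y
  have ht : 0 ≤ t := hy0.trans hκy
  nlinarith [mul_nonneg hz0 ht, mul_nonneg hz0 hz0, mul_nonneg ht ht]

/-- Few visits are possible far from `p`. Distances are measured in cells from `⌊p N⌋`. Fewer than
four cells away, at most seven intervals are bounded trivially by `T'`; beyond, the drift inequality
is solved for `√(s m)` and summed against the harmonic series. -/
theorem sum_sqrt_occupation_le {N : ℕ} (hN : 0 < N) {κ s p T' C : ℝ} (hκ : 1 ≤ κ) (hs : 0 ≤ s)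
    (hp0 : 0 ≤ p) (hp1 : p ≤ 1) (m c : Fin N → ℝ) (hm : ∀ i, 0 ≤ m i) (hc : ∀ i, 0 ≤ c i)
    (hmT : ∀ i, m i ≤ T') (hcC : ∑ i, c i ≤ C)
    (h : ∀ i : Fin N, |((i : ℝ) + 1) / N - p| * m i ≤
      m i / N + c i + 2 * κ * (√(s * m i) + s)) :
    ∑ i, √(s * m i) ≤ 7 * √(s * T') + 4 * √(s * C * (N * (1 + Real.log N)))
      + 20 * κ * s * (N * (1 + Real.log N)) := by
  have hN' : (0 : ℝ) < N := by exact_mod_cast hN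
  set j : ℤ := ⌊p * N⌋ with hj
  have hj0 : 0 ≤ j := Int.floor_nonneg.2 (by positivity)
  have hjN : j ≤ N := by
    have : p * N ≤ N := mul_le_of_le_one_left hN'.le hp1
    have h2 : (j : ℝ) ≤ N := (Int.floor_le _).trans this
    exact_mod_cast h2
  let x : Fin N → ℝ := fun i => (((i : ℤ) + 1 - j).natAbs : ℝ)
  have hxabs : ∀ i, x i = |(i : ℝ) + 1 - j| := by
    intro i
    change (((i : ℤ) + 1 - j).natAbs : ℝ) = _
    rw [Nat.cast_natAbs]
    push_cast
    rfl
  set H := 1 + Real.log N with hH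
  have hH0 : 0 ≤ H := by
    have : 0 ≤ Real.log N := Real.log_natCast_nonneg N
    linarith
  have hsumx : ∑ i, (x i)⁻¹ ≤ 2 * H := sum_inv_natAbs_le N j hj0 hjN
  have hx0 : ∀ i, 0 ≤ x i := fun i => Nat.cast_nonneg _
  have hC : 0 ≤ C := (Finset.sum_nonneg fun i _ => hc i).trans hcC
  have hcard := card_near_le N j
  have hfar : ∀ i : Fin N, 4 ≤ ((i : ℤ) + 1 - j).natAbs → √(s * m i) ≤
      2 * (√(s * c i) * √(2 * N * (x i)⁻¹)) + 5 * κ * s * (2 * N * (x i)⁻¹) := by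
    intro i hi
    have hx4 : 4 ≤ x i := Nat.ofNat_le_cast.2 hi
    have hxN : x i ≤ N := by
      have h1 : ((i : ℤ) + 1 - j).natAbs ≤ N := by
        have := i.2
        omega
      exact Nat.cast_le.2 h1
    -- Rounding `p N` down loses at most one cell, and `x - 1 ≥ x / 2 + 1` for `x ≥ 4`. The spare `1
    -- / N` absorbs the discretization term `m i / N`.
    have hdrift : x i / (2 * N) + 1 / N ≤ |((i : ℝ) + 1) / N - p| := by
      have h1 : ((i : ℝ) + 1) / N - p = ((i : ℝ) + 1 - p * N) / N := by field_simp
      rw [h1, abs_div, abs_of_pos hN', le_div_iff₀ hN']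
      have h2 : x i - 1 ≤ |(i : ℝ) + 1 - p * N| := by
        have h3 := Int.floor_le (p * N)
        have h4 := Int.lt_floor_add_one (p * N)
        rw [← hj] at h3 h4
        have h5 : |(i : ℝ) + 1 - j| ≤ |(i : ℝ) + 1 - p * N| + |p * N - j| := abs_sub_le _ _ _
        have h6 : |p * N - j| ≤ 1 := by rw [abs_le]; constructor <;> linarith
        rw [hxabs]
        linarith
      have h3 : (x i / (2 * N) + 1 / N) * N = x i / 2 + 1 := by field_simp
      rw [h3]
      linarith
    have hδ : 0 < x i / (2 * N) := by positivity
    have hinv : 1 / (x i / (2 * N)) = 2 * N * (x i)⁻¹ := by field_simp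
    rw [← hinv]
    refine sqrt_le_of_drift hκ hs hδ ?_ (hm i) (hc i) ?_
    · rw [div_le_one (by positivity)]
      linarith
    · have h1 := mul_le_mul_of_nonneg_right hdrift (hm i)
      have h2 := h i
      have h3 : (1 : ℝ) / N * m i = m i / N := by ring
      have h4 : 0 ≤ √(s * m i) := Real.sqrt_nonneg _
      have h5 : 0 ≤ 2 * κ * (√(s * m i) + s) := by positivity
      have h6 := hc i
      rw [add_mul] at h1
      linarith
  have hall : ∀ i : Fin N, √(s * m i) ≤ (if ((i : ℤ) + 1 - j).natAbs < 4 then √(s * T') else 0) +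
      (2 * (√(s * c i) * √(2 * N * (x i)⁻¹)) + 5 * κ * s * (2 * N * (x i)⁻¹)) := by
    intro i
    have hxi := hx0 i
    have h0 : 0 ≤ 2 * (√(s * c i) * √(2 * N * (x i)⁻¹)) + 5 * κ * s * (2 * N * (x i)⁻¹) := by
      positivity
    split_ifs with hi
    · have := Real.sqrt_le_sqrt (mul_le_mul_of_nonneg_left (hmT i) hs)
      linarith
    · have := hfar i (not_lt.1 hi)
      linarith
  refine (Finset.sum_le_sum fun i _ => hall i).trans ?_
  rw [Finset.sum_add_distrib, Finset.sum_add_distrib, ← Finset.mul_sum, ← Finset.mul_sum,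
    ← Finset.mul_sum, ← Finset.sum_filter, Finset.sum_const, nsmul_eq_mul]
  have h1 : ((Finset.univ.filter fun i : Fin N => ((i : ℤ) + 1 - j).natAbs < 4).card : ℝ) *
      √(s * T') ≤ 7 * √(s * T') :=
    mul_le_mul_of_nonneg_right (by exact_mod_cast hcard) (Real.sqrt_nonneg _)
  -- Cauchy-Schwarz, separating the total deviation `∑ c i ≤ C` from the harmonic sum.
  have h2 : ∑ i, √(s * c i) * √(2 * N * (x i)⁻¹) ≤ 2 * √(s * C * (N * H)) := by
    refine (Real.sum_sqrt_mul_sqrt_le _ (fun i => mul_nonneg hs (hc i))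
      fun i => by have := hx0 i; positivity).trans ?_
    rw [← Finset.mul_sum, ← Finset.mul_sum, ← Real.sqrt_mul (by
      exact mul_nonneg hs (Finset.sum_nonneg fun i _ => hc i))]
    have h4 : s * (∑ i, c i) * (2 * N * ∑ i, (x i)⁻¹) ≤ (2 ^ 2) * (s * C * (N * H)) := by
      have : s * (∑ i, c i) ≤ s * C := mul_le_mul_of_nonneg_left hcC hs
      calc s * (∑ i, c i) * (2 * N * ∑ i, (x i)⁻¹) ≤ (s * C) * (2 * N * (2 * H)) := by gcongr
        _ = _ := by ring
    refine (Real.sqrt_le_sqrt h4).trans (le_of_eq ?_)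
    rw [Real.sqrt_mul (by norm_num), Real.sqrt_sq (by norm_num)]
  have h3 : 5 * κ * s * (2 * N * ∑ i, (x i)⁻¹) ≤ 20 * κ * s * (N * H) := by
    calc 5 * κ * s * (2 * N * ∑ i, (x i)⁻¹) ≤ 5 * κ * s * (2 * N * (2 * H)) := by gcongr
      _ = _ := by ring
  linarith

end Occupation


/-! ### Linearity of sums along histories -/

section PathSum

variable {R : Type*}

theorem pathSum_add (X Y : List R → R → ℝ) (h : List R) :
    pathSum (fun h r => X h r + Y h r) h = pathSum X h + pathSum Y h := by
  induction h with
  | nil => simp [pathSum]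
  | cons r h ih => simp only [pathSum, ih]; ring

theorem pathSum_const_mul (c : ℝ) (X : List R → R → ℝ) (h : List R) :
    pathSum (fun h r => c * X h r) h = c * pathSum X h := by
  induction h with
  | nil => simp [pathSum]
  | cons r h ih => simp only [pathSum, ih]; ring

theorem pathSum_sum {α : Type*} (s : Finset α) (X : α → List R → R → ℝ) (h : List R) :
    pathSum (fun h r => ∑ i ∈ s, X i h r) h = ∑ i ∈ s, pathSum (X i) h := by
  induction h with
  | nil => simp [pathSum]
  | cons r h ih => simp only [pathSum, ih, Finset.sum_add_distrib]

theorem abs_pathSum_le_of_abs_le {X Y : List R → R → ℝ} (hXY : ∀ h r, |X h r| ≤ Y h r)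
    (h : List R) : |pathSum X h| ≤ pathSum Y h := by
  induction h with
  | nil => simp [pathSum]
  | cons r h ih =>
    exact (abs_add_le _ _).trans (add_le_add ih (hXY h r))

theorem pathSum_length_eq (f : ℕ → ℝ) (h : List R) :
    pathSum (fun h _ => f h.length) h = ∑ t ∈ Finset.range h.length, f t := by
  induction h with
  | nil => simp [pathSum]
  | cons r h ih => rw [pathSum, ih, List.length_cons, Finset.sum_range_succ]

end PathSum

/-! ### The calibration error of a history -/

section Calibration

variable {N T : ℕ}

theorem calError_eq_sum_abs (l : List (Bool × ℝ)) :
    calError l = ∑ p ∈ (l.map Prod.snd).toFinset,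
      |(l.map fun r => if r.2 = p then outcome r.1 - r.2 else 0).sum| := by
  refine Finset.sum_congr rfl fun p hp => ?_
  have hpos : (0 : ℝ) < visits l p := by
    rw [visits, Nat.cast_pos, List.count_pos_iff]
    exact List.mem_toFinset.1 hp
  rw [abs_mul, abs_of_pos (one_div_pos.2 hpos), ← mul_assoc, mul_one_div_cancel hpos.ne', one_mul]

/-- Distinct intervals have distinct right ends, so grouping by forecast is grouping by interval;
intervals never visited only add non-negative terms. -/
theorem calError_play_le (hN : 0 < N) (hT : 0 < T) (h : List (Round T)) :
    calError (play (uniformPartition N) h) ≤ ∑ i : Fin N,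
      |pathSum (fun _ (r : Round T) => inCell N i r.2 * (outcome r.1 - ((i : ℝ) + 1) / N)) h| := by
  have hN' : (N : ℝ) ≠ 0 := by positivity
  have hinj : ∀ i j : ℕ, ((i : ℝ) + 1) / N = ((j : ℝ) + 1) / N → i = j := by
    intro i j hij
    rw [div_left_inj' hN'] at hij
    exact_mod_cast add_right_cancel hij
  set S : ℝ → ℝ := fun p => |((play (uniformPartition N) h).map fun r =>
    if r.2 = p then outcome r.1 - r.2 else 0).sum| with hS
  rw [calError_eq_sum_abs]
  change ∑ p ∈ _, S p ≤ _
  calc ∑ p ∈ ((play (uniformPartition N) h).map Prod.snd).toFinset, S p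
      ≤ ∑ p ∈ Finset.univ.image (fun i : Fin N => ((i : ℝ) + 1) / N), S p := by
        refine Finset.sum_le_sum_of_subset_of_nonneg ?_ fun _ _ _ => abs_nonneg _
        intro p hp
        simp only [play, List.map_map, List.mem_toFinset, List.mem_map, Function.comp_apply] at hp
        obtain ⟨r, -, rfl⟩ := hp
        rw [forecast_uniformPartition hN hT]
        exact Finset.mem_image.2
          ⟨⟨cell N T r.2, cell_lt hN hT (Nat.le_of_lt_succ r.2.2)⟩, Finset.mem_univ _, rfl⟩
    _ = ∑ i : Fin N, S (((i : ℝ) + 1) / N) :=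
        Finset.sum_image fun i _ j _ hij => Fin.ext (hinj i j hij)
    _ = _ := by
        refine Finset.sum_congr rfl fun i _ => ?_
        refine congrArg abs ?_
        clear hS S
        induction h with
        | nil => simp [play, pathSum]
        | cons r h ih =>
          rw [pathSum, ← ih]
          simp only [play, List.map_cons, List.sum_cons, forecast_uniformPartition hN hT]
          rw [add_comm]
          congr 1
          unfold inCell
          by_cases hi : (i : ℕ) = cell N T r.2
          · simp [hi]
          · have : ¬ (((cell N T r.2 : ℝ) + 1) / N = ((i : ℝ) + 1) / N) :=
              fun h => hi (hinj _ _ h).symm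
            simp [hi, this]

/-- The trivial bound, needed when the real number that is rounded up to `N` does not exceed 1. -/
theorem calError_play_le_length (hN : 0 < N) (hT : 0 < T) (h : List (Round T)) :
    calError (play (uniformPartition N) h) ≤ h.length := by
  refine (calError_play_le hN hT h).trans ?_
  have hN' : (0 : ℝ) < N := by exact_mod_cast hN
  calc _ ≤ ∑ i : Fin N, pathSum (fun _ (r : Round T) => inCell N i r.2) h := by
        refine Finset.sum_le_sum fun i _ => abs_pathSum_le_of_abs_le (fun _ r => ?_) h
        rw [abs_mul, abs_of_nonneg (inCell_nonneg i r.2)]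
        refine mul_le_of_le_one_right (inCell_nonneg i r.2) ?_
        have h1 : ((i : ℝ) + 1) / N ≤ 1 := by
          rw [div_le_one hN']
          exact_mod_cast i.2
        have h2 : 0 ≤ ((i : ℝ) + 1) / N := by positivity
        rw [abs_le]
        cases r.1 <;> simp only [outcome] <;> constructor <;> norm_num <;> linarith
    _ = h.length := by
        rw [← pathSum_sum]
        simp only [sum_inCell hN hT, pathSum_const, one_mul]

theorem inCell_mul_abs_sub_le (hT : 0 < T) (i : Fin N) (k : Fin (T + 1)) :
    inCell N i k * |gridPoint T k - ((i : ℝ) + 1) / N| ≤ inCell N i k * (1 / N) := by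
  have hN' : (0 : ℝ) < N := by exact_mod_cast i.pos
  by_cases hi : (i : ℕ) = cell N T k
  · refine mul_le_mul_of_nonneg_left ?_ (inCell_nonneg i k)
    have hmem := (mem_uniformPartition_iff hT k i).2 hi
    have h1 : ((i : ℝ) + 1) / N = i / N + 1 / N := add_div _ _ _
    have h2 : (i : ℝ) / N ≤ gridPoint T k ∧ gridPoint T k ≤ ((i : ℝ) + 1) / N := by
      unfold uniformPartition at hmem
      split_ifs at hmem with hlast
      · have : ((i : ℝ) + 1) = N := by exact_mod_cast hlast
        rw [this, div_self hN'.ne']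
        exact hmem
      · exact ⟨hmem.1, hmem.2.le⟩
    have h3 : 0 < 1 / (N : ℝ) := by positivity
    rw [abs_le]
    constructor <;> linarith
  · simp [inCell, hi]

/-- The deviation of a realized round from its mean over the sampled point. -/
def sampleDev (F : Forecaster N T) (i : Fin N) (h : List (Round T)) (r : Round T) : ℝ :=
  inCell N i r.2 * (gridPoint T r.2 - outcome r.1) - cellGain (F.dist h) r.1 i

/-- The deviation of an outcome from its mean, weighted with the mass of an interval. -/
def outcomeDev (q : ℕ → unitInterval) (F : Forecaster N T) (i : Fin N) (h : List (Round T))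
    (r : Round T) : ℝ :=
  cellMass (F.dist h) i * (outcome r.1 - q h.length)

/-- In `y - (i+1)/N = (u - (i+1)/N) - (u - y)` the first part is at most `1/N` on the interval; the
second is its conditional mean plus the sampling noise. -/
theorem calError_play_le_add (hN : 0 < N) (hT : 0 < T) (F : Forecaster N T) (h : List (Round T)) :
    calError (play (uniformPartition N) h) ≤ h.length / N + ∑ i : Fin N,
      (|pathSum (sampleDev F i) h| + |pathSum (fun h r => cellGain (F.dist h) r.1 i) h|) := by
  refine (calError_play_le hN hT h).trans ?_
  have hlen : (h.length : ℝ) / N =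
      ∑ i : Fin N, pathSum (fun _ (r : Round T) => inCell N i r.2 * (1 / N)) h := by
    rw [← pathSum_sum]
    simp only [sum_inCell_mul hN hT, pathSum_const]
    ring
  rw [hlen, ← Finset.sum_add_distrib]
  refine Finset.sum_le_sum fun i _ => ?_
  have heq : (fun (h : List (Round T)) (r : Round T) =>
      inCell N i r.2 * (outcome r.1 - ((i : ℝ) + 1) / N)) = fun h r =>
      inCell N i r.2 * (gridPoint T r.2 - ((i : ℝ) + 1) / N) +
        (-1) * (sampleDev F i h r + cellGain (F.dist h) r.1 i) := by
    funext h r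
    unfold sampleDev
    ring
  rw [heq, pathSum_add, pathSum_const_mul, pathSum_add]
  refine (abs_add_le _ _).trans (add_le_add ?_ ?_)
  · refine abs_pathSum_le_of_abs_le (fun _ r => ?_) h
    rw [abs_mul, abs_of_nonneg (inCell_nonneg i r.2)]
    exact inCell_mul_abs_sub_le hT i r.2
  · rw [abs_mul, abs_neg, abs_one, one_mul]
    exact abs_add_le _ _

/-- Inside the interval, `(i+1)/N - p = (u - y) + (y - q) - (u - (i+1)/N) + (q - p)`. Averaged over
`P` and summed over the rounds, the four parts are the gain, the outcome noise, the rounding and the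
non-stationarity. -/
theorem drift_le (hT : 0 < T) (q : ℕ → unitInterval) (F : Forecaster N T) (p : ℝ) (i : Fin N)
    (h : List (Round T)) :
    |((i : ℝ) + 1) / N - p| * pathSum (fun h _ => cellMass (F.dist h) i) h ≤
      pathSum (fun h _ => cellMass (F.dist h) i) h / N
      + pathSum (fun h _ => cellMass (F.dist h) i * |(q h.length : ℝ) - p|) h
      + (|pathSum (fun h r => cellGain (F.dist h) r.1 i) h|
        + |pathSum (outcomeDev q F i) h|) := by
  have hm : 0 ≤ pathSum (fun h (_ : Round T) => cellMass (F.dist h) i) h :=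
    pathSum_nonneg (fun h _ => cellMass_nonneg _ i) h
  have h1 : (((i : ℝ) + 1) / N - p) * pathSum (fun h (_ : Round T) => cellMass (F.dist h) i) h =
      (pathSum (fun h r => cellGain (F.dist h) r.1 i) h + pathSum (outcomeDev q F i) h)
      + (-1) * pathSum (fun h (r : Round T) => ∑ k, (F.dist h k).toReal * (inCell N i k *
        ((gridPoint T k - ((i : ℝ) + 1) / N) - (q h.length - p)))) h := by
    rw [← pathSum_add, ← pathSum_const_mul, ← pathSum_const_mul, ← pathSum_add]
    congr 1
    funext h r
    simp only [outcomeDev, cellMass, cellGain, Finset.mul_sum, Finset.sum_mul,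
      ← Finset.sum_add_distrib]
    refine Finset.sum_congr rfl fun k _ => ?_
    ring
  have h2 : |pathSum (fun h (r : Round T) => ∑ k, (F.dist h k).toReal * (inCell N i k *
        ((gridPoint T k - ((i : ℝ) + 1) / N) - (q h.length - p)))) h| ≤
      pathSum (fun h _ => cellMass (F.dist h) i) h / N
      + pathSum (fun h _ => cellMass (F.dist h) i * |(q h.length : ℝ) - p|) h := by
    have h3 : pathSum (fun h (_ : Round T) => cellMass (F.dist h) i) h / N =
        pathSum (fun h (_ : Round T) => 1 / (N : ℝ) * cellMass (F.dist h) i) h := by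
      rw [pathSum_const_mul]
      ring
    rw [h3, ← pathSum_add]
    refine abs_pathSum_le_of_abs_le (fun h r => ?_) h
    simp only [cellMass, Finset.mul_sum, Finset.sum_mul, ← Finset.sum_add_distrib]
    refine (Finset.abs_sum_le_sum_abs _ _).trans (Finset.sum_le_sum fun k _ => ?_)
    have h4 : 0 ≤ (F.dist h k).toReal := ENNReal.toReal_nonneg
    rw [abs_mul, abs_of_nonneg h4, abs_mul, abs_of_nonneg (inCell_nonneg i k)]
    have h5 := abs_sub (gridPoint T k - ((i : ℝ) + 1) / N) ((q h.length : ℝ) - p)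
    have h6 := mul_le_mul_of_nonneg_left h5 (inCell_nonneg i k)
    have h7 := inCell_mul_abs_sub_le hT i k
    have h8 := mul_le_mul_of_nonneg_left (show inCell N i k *
      |gridPoint T k - ((i : ℝ) + 1) / N - ((q h.length : ℝ) - p)| ≤
      inCell N i k * (1 / N) + inCell N i k * |(q h.length : ℝ) - p| by linarith) h4
    linarith
  calc _ = |(((i : ℝ) + 1) / N - p) * pathSum (fun h (_ : Round T) => cellMass (F.dist h) i) h| := by
        rw [abs_mul, abs_of_nonneg hm]
    _ ≤ _ := by
        rw [h1]
        refine (abs_add_le _ _).trans ?_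
        rw [abs_mul, abs_neg, abs_one, one_mul, add_comm]
        exact add_le_add h2 (abs_add_le _ _)

/-! ### The deviations are martingale differences -/

theorem roundMean_sampleDev (q : ℕ → unitInterval) (F : Forecaster N T) (i : Fin N)
    (h : List (Round T)) : roundMean q F h (sampleDev F i h) = 0 := by
  unfold roundMean
  refine Finset.sum_eq_zero fun y _ => ?_
  simp only [sampleDev, mul_sub, Finset.sum_sub_distrib, ← Finset.sum_mul, sum_toReal_eq_one,
    one_mul]
  rw [cellGain]
  simp only [mul_sub, Finset.sum_sub_distrib]
  ring

theorem roundMean_outcomeDev (q : ℕ → unitInterval) (F : Forecaster N T) (i : Fin N)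
    (h : List (Round T)) : roundMean q F h (outcomeDev q F i h) = 0 := by
  simp only [roundMean, outcomeDev, ← Finset.sum_mul, sum_toReal_eq_one, one_mul]
  rw [Fintype.sum_bool, ber_true, ber_false]
  simp only [outcome, if_true, Bool.false_eq_true, if_false]
  ring

theorem cell_dev_sq_le (hT : 0 < T) (k : Fin (T + 1)) (i : Fin N) (y : Bool) :
    (inCell N i k * (gridPoint T k - outcome y)) ^ 2 ≤ inCell N i k := by
  have h1 := abs_gridPoint_sub_outcome_le hT k y
  have h2 : (gridPoint T k - outcome y) ^ 2 ≤ 1 := by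
    rw [← sq_abs]
    exact pow_le_one₀ (abs_nonneg _) h1
  rw [mul_pow, sq (inCell N i k), inCell_mul_self]
  exact mul_le_of_le_one_right (inCell_nonneg i k) h2

/-- A variance is at most the second moment, and the square of an indicator times a number of
modulus at most 1 is at most the indicator. -/
theorem roundMean_sampleDev_sq_le (hT : 0 < T) (q : ℕ → unitInterval) (F : Forecaster N T)
    (i : Fin N) (h : List (Round T)) :
    roundMean q F h (fun r => sampleDev F i h r ^ 2) ≤ cellMass (F.dist h) i := by
  unfold roundMean
  calc ∑ y, (ber (q h.length) y).toReal * ∑ k, (F.dist h k).toReal * sampleDev F i h (y, k) ^ 2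
      ≤ ∑ y, (ber (q h.length) y).toReal * cellMass (F.dist h) i := by
        refine Finset.sum_le_sum fun y _ => mul_le_mul_of_nonneg_left ?_ ENNReal.toReal_nonneg
        have h1 : ∑ k, (F.dist h k).toReal * sampleDev F i h (y, k) ^ 2 =
            ∑ k, (F.dist h k).toReal * (inCell N i k * (gridPoint T k - outcome y)) ^ 2
              - cellGain (F.dist h) y i ^ 2 := by
          have h2 : ∀ k, (F.dist h k).toReal * sampleDev F i h (y, k) ^ 2 =
              (F.dist h k).toReal * (inCell N i k * (gridPoint T k - outcome y)) ^ 2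
              - 2 * cellGain (F.dist h) y i *
                ((F.dist h k).toReal * (inCell N i k * (gridPoint T k - outcome y)))
              + cellGain (F.dist h) y i ^ 2 * (F.dist h k).toReal := by
            intro k
            simp only [sampleDev]
            ring
          simp only [h2, Finset.sum_add_distrib, Finset.sum_sub_distrib, ← Finset.mul_sum,
            sum_toReal_eq_one]
          rw [← cellGain]
          ring
        have h3 : ∑ k, (F.dist h k).toReal * (inCell N i k * (gridPoint T k - outcome y)) ^ 2 ≤
            cellMass (F.dist h) i :=
          Finset.sum_le_sum fun k _ =>
            mul_le_mul_of_nonneg_left (cell_dev_sq_le hT k i y) ENNReal.toReal_nonneg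
        have := sq_nonneg (cellGain (F.dist h) y i)
        linarith
    _ = cellMass (F.dist h) i := by rw [← Finset.sum_mul, sum_toReal_eq_one, one_mul]

theorem abs_outcome_sub_le (q : unitInterval) (y : Bool) : |outcome y - (q : ℝ)| ≤ 1 := by
  have h0 := q.2.1
  have h1 := q.2.2
  rw [abs_le]
  cases y <;> simp only [outcome] <;> constructor <;> norm_num <;> linarith

theorem abs_outcomeDev_le (hT : 0 < T) (q : ℕ → unitInterval) (F : Forecaster N T) (i : Fin N)
    (h : List (Round T)) (r : Round T) : |outcomeDev q F i h r| ≤ 1 := by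
  rw [outcomeDev, abs_mul, abs_of_nonneg (cellMass_nonneg _ i)]
  exact mul_le_one₀ (cellMass_le_one hT _ i) (abs_nonneg _) (abs_outcome_sub_le _ _)

theorem roundMean_outcomeDev_sq_le (hT : 0 < T) (q : ℕ → unitInterval) (F : Forecaster N T)
    (i : Fin N) (h : List (Round T)) :
    roundMean q F h (fun r => outcomeDev q F i h r ^ 2) ≤ cellMass (F.dist h) i := by
  rw [← roundMean_const q F h (cellMass (F.dist h) i)]
  refine roundMean_mono q F h fun r => ?_
  have h1 := cellMass_le_one hT (F.dist h) i
  have h0 := cellMass_nonneg (F.dist h) i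
  have h2 : (outcome r.1 - (q h.length : ℝ)) ^ 2 ≤ 1 := by
    rw [← sq_abs]
    exact pow_le_one₀ (abs_nonneg _) (abs_outcome_sub_le _ _)
  rw [outcomeDev, mul_pow]
  nlinarith [sq_nonneg (cellMass (F.dist h) i)]

/-- The triangle inequality would give only 2. For a fixed outcome, the sampled values and their
mean lie in a common interval of length 1: `[0,1]` or `[-1,0]`. -/
theorem abs_sampleDev_le (hT : 0 < T) (F : Forecaster N T) (i : Fin N)
    (h : List (Round T)) (r : Round T) : |sampleDev F i h r| ≤ 1 := by
  have hg := fun k => gridPoint_mem_Icc hT k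
  have hi : ∀ k : Fin (T + 1), inCell N i k ≤ 1 := by
    intro k
    unfold inCell
    split_ifs <;> norm_num
  have h0 := fun k => inCell_nonneg (T := T) i k
  have hP : ∀ k, 0 ≤ (F.dist h k).toReal := fun k => ENNReal.toReal_nonneg
  obtain ⟨y, k⟩ := r
  have key : ∀ a b : ℝ, (∀ k, a ≤ inCell N i k * (gridPoint T k - outcome y)) →
      (∀ k, inCell N i k * (gridPoint T k - outcome y) ≤ b) → b - a = 1 →
      |sampleDev F i h (y, k)| ≤ 1 := by
    intro a b ha hb hab
    have hA : a ≤ cellGain (F.dist h) y i := by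
      calc a = ∑ k, (F.dist h k).toReal * a := by rw [← Finset.sum_mul, sum_toReal_eq_one, one_mul]
        _ ≤ _ := Finset.sum_le_sum fun k _ => mul_le_mul_of_nonneg_left (ha k) (hP k)
    have hB : cellGain (F.dist h) y i ≤ b := by
      calc _ ≤ ∑ k, (F.dist h k).toReal * b :=
            Finset.sum_le_sum fun k _ => mul_le_mul_of_nonneg_left (hb k) (hP k)
        _ = b := by rw [← Finset.sum_mul, sum_toReal_eq_one, one_mul]
    have h1 := ha k
    have h2 := hb k
    simp only [sampleDev]
    rw [abs_le]
    constructor <;> linarith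
  cases y
  · refine key 0 1 (fun k => ?_) (fun k => ?_) (by norm_num)
    · simpa [outcome] using mul_nonneg (h0 k) (hg k).1
    · simpa [outcome] using mul_le_one₀ (hi k) (hg k).1 (hg k).2
  · refine key (-1) 0 (fun k => ?_) (fun k => ?_) (by norm_num)
    · simp only [outcome, if_true]
      nlinarith [h0 k, hi k, (hg k).1, (hg k).2]
    · simp only [outcome, if_true]
      exact mul_nonpos_of_nonneg_of_nonpos (h0 k) (by linarith [(hg k).2])

/-! ### Union bound over the intervals and the error on the good event -/

theorem measure_deviation_le (hT : 0 < T) (q : ℕ → unitInterval) (F : Forecaster N T) (κ : ℝ)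
    (hκ : 1 ≤ κ) :
    (historyLaw q F T).toOuterMeasure {h | h.length = T ∧ ∃ i : Fin N,
      (3 * (√(κ * pathSum (fun h _ => cellMass (F.dist h) i) h) + κ) < |pathSum (sampleDev F i) h| ∨
      3 * (√(κ * pathSum (fun h _ => cellMass (F.dist h) i) h) + κ) <
        |pathSum (outcomeDev q F i) h|)} ≤
      ENNReal.ofReal (4 * N * (T + 1) * Real.exp (-κ)) := by
  let A : Fin N → Set (List (Round T)) := fun i => {h | h.length = T ∧
    3 * (√(κ * pathSum (fun h _ => cellMass (F.dist h) i) h) + κ) < |pathSum (sampleDev F i) h|}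
  let B : Fin N → Set (List (Round T)) := fun i => {h | h.length = T ∧
    3 * (√(κ * pathSum (fun h _ => cellMass (F.dist h) i) h) + κ) < |pathSum (outcomeDev q F i) h|}
  have hV : ∀ (i : Fin N) (h : List (Round T)),
      0 ≤ pathSum (fun h (_ : Round T) => cellMass (F.dist h) i) h :=
    fun i h => pathSum_nonneg (fun h _ => cellMass_nonneg _ i) h
  have hV' : ∀ (i : Fin N) (h : List (Round T)),
      pathSum (fun h (_ : Round T) => cellMass (F.dist h) i) h ≤ h.length := by
    intro i h
    have := pathSum_mono (fun h (_ : Round T) => cellMass_le_one hT (F.dist h) i) h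
    rwa [pathSum_const, one_mul] at this
  have hAB : ∀ i, (historyLaw q F T).toOuterMeasure (A i ∪ B i) ≤
      4 * (T + 1) * ENNReal.ofReal (Real.exp (-κ)) := by
    intro i
    refine (MeasureTheory.measure_union_le _ _).trans ?_
    have h1 := measure_abs_pathSum_le q F (sampleDev F i) (fun h => cellMass (F.dist h) i)
      (abs_sampleDev_le hT F i) (roundMean_sampleDev q F i) (roundMean_sampleDev_sq_le hT q F i)
      (hV i) (hV' i) κ hκ T
    have h2 := measure_abs_pathSum_le q F (outcomeDev q F i) (fun h => cellMass (F.dist h) i)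
      (abs_outcomeDev_le hT q F i) (roundMean_outcomeDev q F i)
      (roundMean_outcomeDev_sq_le hT q F i) (hV i) (hV' i) κ hκ T
    refine (add_le_add h1 h2).trans (le_of_eq ?_)
    ring
  calc _ ≤ (historyLaw q F T).toOuterMeasure (⋃ i ∈ (Finset.univ : Finset (Fin N)), A i ∪ B i) := by
        refine MeasureTheory.measure_mono ?_
        rintro h ⟨hlen, i, hi⟩
        simp only [Set.mem_iUnion, exists_prop]
        exact ⟨i, Finset.mem_univ i, hi.imp (fun h => ⟨hlen, h⟩) fun h => ⟨hlen, h⟩⟩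
    _ ≤ ∑ i : Fin N, (historyLaw q F T).toOuterMeasure (A i ∪ B i) :=
        MeasureTheory.measure_biUnion_finset_le _ _
    _ ≤ ∑ _i : Fin N, 4 * (T + 1) * ENNReal.ofReal (Real.exp (-κ)) :=
        Finset.sum_le_sum fun i _ => hAB i
    _ = _ := by
        rw [Finset.sum_const, Finset.card_univ, Fintype.card_fin, nsmul_eq_mul,
          ENNReal.ofReal_mul (by positivity), ENNReal.ofReal_mul (by positivity),
          ENNReal.ofReal_mul (by positivity), ENNReal.ofReal_natCast,
          ENNReal.ofReal_add (by positivity) (by positivity), ENNReal.ofReal_natCast,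
          ENNReal.ofReal_one, ENNReal.ofReal_ofNat]
        ring

/-- Subadditivity on `G ∪ B`, which contains the support of the law, replaces complementation; no
measurability is involved. -/
theorem one_sub_le_toOuterMeasure (q : ℕ → unitInterval) (F : Forecaster N T) (n : ℕ)
    (G B : Set (List (Round T))) {δ : ℝ} (hδ : 0 ≤ δ)
    (hB : (historyLaw q F n).toOuterMeasure B ≤ ENNReal.ofReal δ)
    (hGB : ∀ h, h.length = n → h ∉ B → h ∈ G) :
    ENNReal.ofReal (1 - δ) ≤ (historyLaw q F n).toOuterMeasure G := by
  set p := historyLaw q F n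
  have h1 : 1 ≤ p.toOuterMeasure G + p.toOuterMeasure B := by
    have h2 : p.toOuterMeasure (G ∪ B) = 1 := by
      rw [PMF.toOuterMeasure_apply_eq_one_iff]
      intro h hh
      have hlen := length_of_mem_support q F n h hh
      by_cases hb : h ∈ B
      · exact Or.inr hb
      · exact Or.inl (hGB h hlen hb)
    rw [← h2]
    exact MeasureTheory.measure_union_le _ _
  rw [ENNReal.ofReal_sub _ hδ, ENNReal.ofReal_one, tsub_le_iff_right]
  exact h1.trans (add_le_add le_rfl hB)

/-- The calibration error of a history on which all deviations are small. -/
theorem calError_play_le_of_deviation {ε : ℝ} {F : Forecaster N T} (hN : 0 < N) (hT : 2 ≤ T)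
    (hε : (Fintype.card (Expert N) : ℝ) * (64 * T) * (2 * (Fintype.card (Expert N) * T)) * ε ≤ 1 / T)
    (hF : IsCalibrationAlgorithm ε (uniformPartition N) F) (q : ℕ → unitInterval) (s : ℝ)
    (hs : logRatio (Expert N) T ≤ s) (h : List (Round T)) (hlen : h.length = T)
    (hdev : ∀ i : Fin N,
      |pathSum (sampleDev F i) h| ≤ 3 * (√(s * pathSum (fun h _ => cellMass (F.dist h) i) h) + s) ∧
      |pathSum (outcomeDev q F i) h| ≤
        3 * (√(s * pathSum (fun h _ => cellMass (F.dist h) i) h) + s)) :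
    calError (play (uniformPartition N) h) ≤ T / N + 5000000 * (√(s * T)
      + √(s * deviation T q * (N * (1 + Real.log N))) + s * (N * (1 + Real.log N))) := by
  have hT0 : 0 < T := by omega
  have hN' : (0 : ℝ) < N := by exact_mod_cast hN
  have hd : 2 ≤ Fintype.card (Expert N) := by rw [card_expert]; omega
  have hL := one_le_logRatio hT hd
  have hs0 : 0 ≤ s := by linarith
  -- By compactness the infimum defining `C` is attained; the minimizer is the centre of the
  -- occupation argument.
  obtain ⟨p, hp⟩ : ∃ p : unitInterval, deviation T q = ∑ t ∈ Finset.range T, |(q t : ℝ) - (p : ℝ)| := by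
    have hcont : Continuous fun p : unitInterval => ∑ t ∈ Finset.range T, |(q t : ℝ) - (p : ℝ)| := by
      fun_prop
    obtain ⟨p, -, hp⟩ := isCompact_univ.exists_isMinOn Set.univ_nonempty hcont.continuousOn
    refine ⟨p, le_antisymm (ciInf_le ⟨0, ?_⟩ p) (le_ciInf fun p' => hp (Set.mem_univ p'))⟩
    rintro _ ⟨p', rfl⟩
    exact Finset.sum_nonneg fun _ _ => abs_nonneg _
  set m : Fin N → ℝ := fun i => pathSum (fun h _ => cellMass (F.dist h) i) h with hm
  set c : Fin N → ℝ := fun i => pathSum (fun h _ => cellMass (F.dist h) i * |(q h.length : ℝ) - p|) h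
    with hc
  have hm0 : ∀ i, 0 ≤ m i := fun i => pathSum_nonneg (fun h _ => cellMass_nonneg _ i) h
  have hc0 : ∀ i, 0 ≤ c i := fun i =>
    pathSum_nonneg (fun h _ => mul_nonneg (cellMass_nonneg _ i) (abs_nonneg _)) h
  have hmT : ∀ i, m i ≤ T := by
    intro i
    have := pathSum_mono (fun h (_ : Round T) => cellMass_le_one hT0 (F.dist h) i) h
    rwa [pathSum_const, one_mul, hlen] at this
  have hcC : ∑ i, c i ≤ deviation T q := by
    refine le_of_eq ?_
    simp only [hc]
    rw [← pathSum_sum]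
    simp only [← Finset.sum_mul, sum_cellMass hN hT0, one_mul]
    rw [pathSum_length_eq (fun t => |(q t : ℝ) - p|), hlen, hp]
  have hgain : ∀ i, |pathSum (fun h r => cellGain (F.dist h) r.1 i) h| ≤
      300 * (√(s * m i) + s) := by
    intro i
    refine (abs_pathSum_cellGain_le hN hT hε hF i h hlen.le).trans ?_
    have := Real.sqrt_le_sqrt (mul_le_mul_of_nonneg_right hs (hm0 i))
    linarith
  -- The coefficient 300 of the gain and 3 of the outcome noise together stay below `2 * 300`.
  have hdrift : ∀ i : Fin N, |((i : ℝ) + 1) / N - p| * m i ≤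
      m i / N + c i + 2 * 300 * (√(s * m i) + s) := by
    intro i
    have h1 := drift_le hT0 q F p i h
    have h2 := hgain i
    have h3 := (hdev i).2
    have h4 := Real.sqrt_nonneg (s * m i)
    change _ ≤ m i / N + c i + _ at h1
    change _ ≤ 3 * (√(s * m i) + s) at h3
    linarith
  have hsum := sum_sqrt_occupation_le hN (κ := 300) (by norm_num) hs0 p.2.1 p.2.2 m c hm0 hc0 hmT
    hcC hdrift
  have hcal := calError_play_le_add hN hT0 F h
  rw [hlen] at hcal
  -- `303 = 300 + 3`, from the gain and the sampling noise.
  have hfin : ∑ i : Fin N,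
      (|pathSum (sampleDev F i) h| + |pathSum (fun h r => cellGain (F.dist h) r.1 i) h|) ≤
      303 * ∑ i, √(s * m i) + 303 * (s * N) := by
    have h5 : 303 * ∑ i, √(s * m i) + 303 * (s * N) = ∑ i, (303 * √(s * m i) + 303 * s) := by
      rw [Finset.sum_add_distrib, Finset.mul_sum, Finset.sum_const, Finset.card_univ,
        Fintype.card_fin, nsmul_eq_mul]
      ring
    rw [h5]
    refine Finset.sum_le_sum fun i _ => ?_
    have h1 := (hdev i).1
    have h2 := hgain i
    change _ ≤ 3 * (√(s * m i) + s) at h1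
    linarith
  have hlogN : 0 ≤ Real.log N := Real.log_natCast_nonneg N
  have hsN : s * N ≤ s * (N * (1 + Real.log N)) := by
    refine mul_le_mul_of_nonneg_left (le_mul_of_one_le_right hN'.le (by linarith)) hs0
  have h6 : 0 ≤ s * (N * (1 + Real.log N)) := by positivity
  have h7 := Real.sqrt_nonneg (s * T)
  have h8 := Real.sqrt_nonneg (s * deviation T q * (N * (1 + Real.log N)))
  linarith

end Calibration


/-! ### The size of the partition -/

section GridSize

theorem deviation_nonneg (T : ℕ) (q : ℕ → unitInterval) : 0 ≤ deviation T q :=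
  Real.iInf_nonneg fun _ => Finset.sum_nonneg fun _ _ => abs_nonneg _

theorem deviation_le (T : ℕ) (q : ℕ → unitInterval) : deviation T q ≤ T := by
  refine (ciInf_le ⟨0, ?_⟩ (0 : unitInterval)).trans ?_
  · rintro _ ⟨p', rfl⟩
    exact Finset.sum_nonneg fun _ _ => abs_nonneg _
  · calc _ ≤ ∑ _t ∈ Finset.range T, (1 : ℝ) := by
          refine Finset.sum_le_sum fun t _ => ?_
          change |(q t : ℝ) - 0| ≤ 1
          rw [sub_zero, abs_of_nonneg (q t).2.1]
          exact (q t).2.2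
      _ = T := by simp

theorem half_le_log {T : ℕ} (hT : 2 ≤ T) : 69 / 100 ≤ Real.log T := by
  have h1 : Real.log 2 ≤ Real.log T := Real.log_le_log (by norm_num) (by exact_mod_cast hT)
  have := Real.log_two_gt_d9
  linarith

theorem log_le_confidence {T : ℕ} {δ : ℝ} (hT : 2 ≤ T) (hδ : 0 < δ) (hδ1 : δ < 1) :
    Real.log T ≤ confidence T δ := by
  have hT0 : (0 : ℝ) < T := by positivity
  refine Real.log_le_log hT0 ?_
  rw [le_div_iff₀ hδ]
  exact mul_le_of_le_one_right hT0.le hδ1.le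

theorem rpow_third_pow {x : ℝ} (hx : 0 ≤ x) : (x ^ (1 / 3 : ℝ)) ^ 3 = x := by
  rw [← Real.rpow_natCast, ← Real.rpow_mul hx]
  norm_num

theorem le_of_cube_le {x y : ℝ} (hy : 0 ≤ y) (h : x ^ 3 ≤ y ^ 3) : x ≤ y :=
  le_of_pow_le_pow_left₀ (by norm_num) hy h

theorem eq_of_cube_eq {x y : ℝ} (hx : 0 ≤ x) (hy : 0 ≤ y) (h : x ^ 3 = y ^ 3) : x = y :=
  le_antisymm (le_of_cube_le hy h.le) (le_of_cube_le hx h.ge)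

/-- The two scales that determine the size of the partition, and the matching error terms. -/
theorem scale_relations {T : ℕ} {a C : ℝ} (hT : 2 ≤ T) (ha : 47 / 100 ≤ a) (hC : 0 ≤ C) :
    √(T / a) * √(a * T) = T ∧ a * √(T / a) = √(a * T) ∧
    ((T : ℝ) ^ 2 / (a * (1 + C))) ^ (1 / 3 : ℝ) * (a * T * (1 + C)) ^ (1 / 3 : ℝ) = T ∧
    a * (1 + C) * ((T : ℝ) ^ 2 / (a * (1 + C))) ^ (1 / 3 : ℝ) =
      ((a * T * (1 + C)) ^ (1 / 3 : ℝ)) ^ 2 ∧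
    (a * T * (1 + C)) ^ (1 / 3 : ℝ) ≤ 2 * (√(a * T) + (a * T * C) ^ (1 / 3 : ℝ)) := by
  have ha0 : 0 < a := by linarith
  have hT2 : (2 : ℝ) ≤ T := by exact_mod_cast hT
  have hT0 : (0 : ℝ) < T := by linarith
  have hC1 : 0 < 1 + C := by linarith
  have h1 : a * √(T / a) = √(a * T) := by
    rw [← Real.sqrt_sq ha0.le, ← Real.sqrt_mul (sq_nonneg a), Real.sqrt_sq ha0.le]
    congr 1
    field_simp
  set Z := ((T : ℝ) ^ 2 / (a * (1 + C))) ^ (1 / 3 : ℝ) with hZ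
  set Q := (a * T * (1 + C)) ^ (1 / 3 : ℝ) with hQ
  set G := (a * T * C) ^ (1 / 3 : ℝ) with hG
  have hZ3 : Z ^ 3 = (T : ℝ) ^ 2 / (a * (1 + C)) := rpow_third_pow (by positivity)
  have hQ3 : Q ^ 3 = a * T * (1 + C) := rpow_third_pow (by positivity)
  have hG3 : G ^ 3 = a * T * C := rpow_third_pow (by positivity)
  have hZ0 : 0 ≤ Z := by positivity
  have hQ0 : 0 ≤ Q := by positivity
  have hG0 : 0 ≤ G := by positivity
  have hW2 := Real.mul_self_sqrt (show 0 ≤ a * T by positivity)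
  set W := √(a * T) with hW
  have hW0 : 0 ≤ W := Real.sqrt_nonneg _
  have hZQ : Z * Q = T := by
    refine eq_of_cube_eq (by positivity) hT0.le ?_
    rw [mul_pow, hZ3, hQ3]
    field_simp
  refine ⟨?_, h1, hZQ, ?_, ?_⟩
  · have : a * (√(T / a) * W) = a * T := by rw [← mul_assoc, h1, hW2]
    exact mul_left_cancel₀ ha0.ne' this
  · have h2 : T * (a * (1 + C) * Z) = T * Q ^ 2 := by
      calc T * (a * (1 + C) * Z) = Q ^ 3 * Z := by rw [hQ3]; ring
        _ = (Z * Q) * Q ^ 2 := by ring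
        _ = T * Q ^ 2 := by rw [hZQ]
    exact mul_left_cancel₀ hT0.ne' h2
  · refine le_of_cube_le (by positivity) ?_
    -- In `Q³ = a T + a T C` the second part is `G³`. The first is `W²`, which is at most `8 W³`
    -- once `8 W ≥ 1`; this is why `a` has to stay away from zero.
    have hW1 : 1 / 8 ≤ W := by
      refine Real.le_sqrt_of_sq_le ?_
      nlinarith
    have h3 : 2 * (W + G) * (2 * (W + G)) * (2 * (W + G)) ≥ 8 * W * (W * W) + 8 * G ^ 3 := by
      have : 0 ≤ W * G * (W + G) := by positivity
      nlinarith
    have h4 : 1 * (a * T) ≤ 8 * W * (a * T) :=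
      mul_le_mul_of_nonneg_right (by linarith) (by positivity)
    rw [hW2, hG3] at h3
    calc Q ^ 3 = a * T + a * T * C := by rw [hQ3]; ring
      _ ≤ 8 * W * (a * T) + 8 * (a * T * C) := by
          have : 0 ≤ a * T * C := by positivity
          linarith
      _ ≤ (2 * (W + G)) ^ 3 := by
          calc _ ≤ _ := h3
            _ = _ := by ring

/-- Here `n` is within a factor 2 of `X = min U Z`. The lower bound on `n` controls `T / n`. The
terms that grow with `n` use one scale each: `X ≤ U` turns `ι n H` into `W`, and `X ≤ Z` turns the
root containing `C` into `Q`. -/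
theorem error_terms_le {T n X U W Z Q l ι C H : ℝ} (hX0 : 0 < X) (hXn : X ≤ n) (hnX : n ≤ 2 * X)
    (hXU : X ≤ U) (hXZ : X ≤ Z) (hTX : T ≤ X * (W + Q)) (hW : W = √(ι * l * T))
    (haU : ι * l * U = W) (haZ : ι * l * (1 + C) * Z = Q ^ 2) (hH0 : 0 ≤ H) (hH : H ≤ 5 * l)
    (hl : 69 / 100 ≤ l) (hι : 0 ≤ ι) (hT : 0 ≤ T) (hC : 0 ≤ C) (hQ : 0 ≤ Q) :
    T / n + 5000000 * (√(8 * ι * T) + √(8 * ι * C * (n * H)) + 8 * ι * (n * H)) ≤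
      10 ^ 9 * (W + Q) := by
  have hW0 : 0 ≤ W := by rw [hW]; exact Real.sqrt_nonneg _
  have hn : 0 < n := hX0.trans_le hXn
  have hl0 : 0 ≤ l := by linarith
  have hNH : n * H ≤ 10 * l * X := by
    calc n * H ≤ (2 * X) * (5 * l) := mul_le_mul hnX hH hH0 (by linarith)
      _ = _ := by ring
  have h1 : T / n ≤ W + Q := by
    rw [div_le_iff₀ hn]
    have := mul_le_mul_of_nonneg_right hXn (add_nonneg hW0 hQ)
    linarith
  have h2 : √(8 * ι * T) ≤ 4 * W := by
    have hW2 : W ^ 2 = ι * l * T := by rw [hW, Real.sq_sqrt (by positivity)]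
    rw [Real.sqrt_le_left (by positivity), mul_pow, hW2]
    have h5 : 0 ≤ ι * T := mul_nonneg hι hT
    have h6 : 69 / 100 * (ι * T) ≤ l * (ι * T) := mul_le_mul_of_nonneg_right hl h5
    linarith
  have h3 : 8 * ι * (n * H) ≤ 80 * W := by
    calc 8 * ι * (n * H) ≤ 8 * ι * (10 * l * X) := by gcongr
      _ = 80 * (ι * l * X) := by ring
      _ ≤ 80 * (ι * l * U) := by gcongr
      _ = 80 * W := by rw [haU]
  have h4 : √(8 * ι * C * (n * H)) ≤ 9 * Q := by
    rw [Real.sqrt_le_left (by positivity)]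
    calc 8 * ι * C * (n * H) ≤ 8 * ι * C * (10 * l * X) := by gcongr
      _ = 80 * (ι * l * C * X) := by ring
      _ ≤ 80 * (ι * l * (1 + C) * Z) := by
          gcongr
          linarith
      _ = 80 * Q ^ 2 := by rw [haZ]
      _ ≤ (9 * Q) ^ 2 := by nlinarith [sq_nonneg Q]
  linarith

/-! ### The calibration bound for the prescribed number of intervals -/

theorem calibration_bound {T : ℕ} {δ ε : ℝ} {q : ℕ → unitInterval} (hT : 2 ≤ T) (hδ : 0 < δ)
    (hδ1 : δ < 1) {N : ℕ} (hN : N = gridSize T δ (deviation T q))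
    (hε0 : 0 ≤ ε) (hε : ε ≤ 1 / (T : ℝ) ^ 18) (F : Forecaster N T)
    (hF : IsCalibrationAlgorithm ε (uniformPartition N) F) :
    ENNReal.ofReal (1 - δ) ≤ probCalErrorLE q (uniformPartition N) F
      (10 ^ 10 * (√(confidence T δ * T * Real.log T)
        + (confidence T δ * T * deviation T q * Real.log T) ^ (1 / 3 : ℝ))) := by
  have hT0 : 0 < T := by omega
  have hT2 : (2 : ℝ) ≤ T := by exact_mod_cast hT
  have hTpos : (0 : ℝ) < T := by linarith
  set C := deviation T q with hCdef
  have hC : 0 ≤ C := deviation_nonneg T q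
  set ι := confidence T δ with hι
  set l := Real.log T with hl
  have hl0 : 69 / 100 ≤ l := half_le_log hT
  have hlι : l ≤ ι := log_le_confidence hT hδ hδ1
  set a := ι * l with ha
  have ha0 : 47 / 100 ≤ a := by nlinarith
  have hapos : 0 < a := by linarith
  obtain ⟨hUW, haU, hZQ, haZ, hQG⟩ := scale_relations hT ha0 hC
  have hrew1 : ι * T * l = a * T := by rw [ha]; ring
  have hrew2 : ι * T * C * l = a * T * C := by rw [ha]; ring
  rw [hrew1, hrew2]
  have hNdef : N = ⌈min (√(T / a)) (((T : ℝ) ^ 2 / (a * (1 + C))) ^ (1 / 3 : ℝ))⌉₊ := by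
    rw [hN, gridSize, ← hι, ← hl, ha]
    congr 4
    ring
  set U := √(T / a) with hU
  set W := √(a * T) with hW
  set Z := ((T : ℝ) ^ 2 / (a * (1 + C))) ^ (1 / 3 : ℝ) with hZ
  set Q := (a * T * (1 + C)) ^ (1 / 3 : ℝ) with hQ
  set G := (a * T * C) ^ (1 / 3 : ℝ) with hG
  have hU0 : 0 < U := Real.sqrt_pos.2 (by positivity)
  have hZ0 : 0 < Z := Real.rpow_pos_of_pos (by positivity) _
  have hW0 : 0 ≤ W := Real.sqrt_nonneg _
  have hQ0 : 0 ≤ Q := Real.rpow_nonneg (by positivity) _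
  have hG0 : 0 ≤ G := Real.rpow_nonneg (by positivity) _
  set X := min U Z with hX
  have hX0 : 0 < X := lt_min hU0 hZ0
  have hNpos : 0 < N := by rw [hNdef]; exact Nat.ceil_pos.2 hX0
  have hTX : T ≤ X * (W + Q) := by
    rcases le_total U Z with h | h
    · rw [hX, min_eq_left h, mul_add, hUW]
      exact le_add_of_nonneg_right (by positivity)
    · rw [hX, min_eq_right h, mul_add, hZQ]
      exact le_add_of_nonneg_left (by positivity)
  have hWQ : W + Q ≤ 3 * (W + G) := by linarith
  rcases le_or_gt X 1 with hX1 | hX1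
  · -- the bound exceeds the number of rounds
    refine one_sub_le_toOuterMeasure q F T _ ∅ hδ.le (by simp) fun h hlen _ => ?_
    change calError _ ≤ _
    refine (calError_play_le_length hNpos hT0 h).trans ?_
    rw [hlen]
    have : X * (W + Q) ≤ 1 * (W + Q) := mul_le_mul_of_nonneg_right hX1 (by positivity)
    linarith
  have hXN : X ≤ N := by rw [hNdef]; exact Nat.le_ceil _
  have hNX : (N : ℝ) ≤ 2 * X := by
    have : (N : ℝ) < X + 1 := by rw [hNdef]; exact Nat.ceil_lt_add_one hX0.le
    linarith
  have hN1 : (1 : ℝ) ≤ N := by exact_mod_cast hNpos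
  have hNposR : (0 : ℝ) < N := by linarith
  have hUT : U ≤ 2 * T := by
    rw [hU, Real.sqrt_le_left (by positivity), div_le_iff₀ hapos]
    nlinarith
  have hNT : (N : ℝ) ≤ 4 * T := by
    have := min_le_left U Z
    linarith
  have hlogT3 : Real.log (4 * T) ≤ 3 * l := by
    have : (4 * T : ℝ) ≤ (T : ℝ) ^ 3 := by nlinarith
    refine (Real.log_le_log (by positivity) this).trans (le_of_eq ?_)
    rw [Real.log_pow, ← hl]
    norm_num
  have hlogN : Real.log N ≤ 3 * l := (Real.log_le_log hNposR hNT).trans hlogT3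
  have hlogN0 : 0 ≤ Real.log N := Real.log_natCast_nonneg N
  have hH : 1 + Real.log N ≤ 5 * l := by linarith
  -- Large enough for two purposes: `2 N T ≤ T⁵` gives `L ≤ 5 log T ≤ s`, and the failure
  -- probability gains the factor `exp (-s) = (δ / T) ^ 8`.
  set s := 8 * ι with hs
  have hs1 : 1 ≤ s := by linarith
  have hLs : logRatio (Expert N) T ≤ s := by
    rw [logRatio, card_expert]
    have h1 : ((2 * N : ℕ) : ℝ) * T ≤ (T : ℝ) ^ 5 := by
      have h2 : (8 : ℝ) ≤ (T : ℝ) ^ 3 := by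
        have := pow_le_pow_left₀ (by norm_num) hT2 3
        linarith
      push_cast
      calc 2 * (N : ℝ) * T ≤ 2 * (4 * T) * T := by gcongr
        _ = 8 * (T : ℝ) ^ 2 := by ring
        _ ≤ (T : ℝ) ^ 3 * (T : ℝ) ^ 2 := by gcongr
        _ = _ := by ring
    have h3 := Real.log_le_log (by push_cast; positivity) h1
    rw [Real.log_pow] at h3
    push_cast at h3 ⊢
    linarith
  -- With `N ≤ 4 T` the left side is at most `2 ^ 13 * T ^ 4 * ε`, and `2 ^ 13 ≤ T ^ 13`. The
  -- accuracy exponent is therefore `13 + 4 + 1 = 18`.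
  have hcard : (Fintype.card (Expert N) : ℝ) * (64 * T) * (2 * (Fintype.card (Expert N) * T)) * ε
      ≤ 1 / T := by
    rw [card_expert]
    push_cast
    have h1 : (8192 : ℝ) ≤ (T : ℝ) ^ 13 := by
      have := pow_le_pow_left₀ (by norm_num) hT2 13
      linarith
    calc (2 * (N : ℝ)) * (64 * T) * (2 * (2 * N * T)) * ε
        ≤ (2 * (4 * T)) * (64 * T) * (2 * (2 * (4 * T) * T)) * (1 / (T : ℝ) ^ 18) := by gcongr
      _ = 8192 * (T : ℝ) ^ 4 * (1 / (T : ℝ) ^ 18) := by ring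
      _ ≤ (T : ℝ) ^ 13 * (T : ℝ) ^ 4 * (1 / (T : ℝ) ^ 18) := by gcongr
      _ = 1 / T := by
        field_simp
  refine one_sub_le_toOuterMeasure q F T _ _ hδ.le
    ((measure_deviation_le hT0 q F s hs1).trans (ENNReal.ofReal_le_ofReal ?_))
    fun h hlen hB => ?_
  · have hexp : Real.exp (-s) = (δ / T) ^ 8 := by
      have h1 : Real.exp ι = T / δ := Real.exp_log (by positivity)
      rw [hs, show -(8 * ι) = ((8 : ℕ) : ℝ) * (-ι) by push_cast; ring, Real.exp_nat_mul,
        Real.exp_neg, h1, inv_div]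
    -- The union bound has total weight at most `32 T²`, which is below `T ^ 8`.
    have h2 : (32 : ℝ) ≤ (T : ℝ) ^ 5 := by
      have := pow_le_pow_left₀ (by norm_num) hT2 5
      linarith
    have h3 : δ ^ 8 ≤ δ := pow_le_of_le_one hδ.le hδ1.le (by norm_num)
    rw [hexp, div_pow]
    calc 4 * (N : ℝ) * (T + 1) * (δ ^ 8 / (T : ℝ) ^ 8)
        ≤ 4 * (4 * T) * (T + T) * (δ / (T : ℝ) ^ 8) := by
          gcongr
          linarith
      _ = 32 * (T : ℝ) ^ 2 * (δ / (T : ℝ) ^ 8) := by ring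
      _ ≤ (T : ℝ) ^ 5 * (T : ℝ) ^ 3 * (δ / (T : ℝ) ^ 8) := by
          gcongr
          · linarith
          · norm_num
      _ = δ := by field_simp
  · change calError _ ≤ _
    have hdev : ∀ i : Fin N,
        |pathSum (sampleDev F i) h| ≤
          3 * (√(s * pathSum (fun h _ => cellMass (F.dist h) i) h) + s) ∧
        |pathSum (outcomeDev q F i) h| ≤
          3 * (√(s * pathSum (fun h _ => cellMass (F.dist h) i) h) + s) := by
      intro i
      constructor <;> by_contra hcon
      · exact hB ⟨hlen, i, Or.inl (not_le.1 hcon)⟩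
      · exact hB ⟨hlen, i, Or.inr (not_le.1 hcon)⟩
    refine (calError_play_le_of_deviation hNpos hT hcard hF q s hLs h hlen hdev).trans ?_
    rw [← hCdef]
    have := error_terms_le hX0 hXN hNX (min_le_left U Z) (min_le_right U Z) hTX hW haU haZ
      (by linarith : 0 ≤ 1 + Real.log N) hH hl0 (by linarith) hTpos.le hC hQ0
    refine this.trans ?_
    linarith

/-! ### Size of `N` for the step count -/

theorem gridSize_pos {T : ℕ} {δ C : ℝ} (hT : 2 ≤ T) (hδ : 0 < δ) (hδ1 : δ < 1) (hC : 0 ≤ C) :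
    0 < gridSize T δ C := by
  have hl := half_le_log hT
  have hι := (log_le_confidence hT hδ hδ1)
  have hl0 : 0 < Real.log T := by linarith
  have hι0 : 0 < confidence T δ := by linarith
  have hT0 : (0 : ℝ) < T := by positivity
  exact Nat.ceil_pos.2 (lt_min (Real.sqrt_pos.2 (by positivity))
    (Real.rpow_pos_of_pos (by positivity) _))

/-- The number of intervals, without the logarithmic factors. -/
theorem gridSize_le {T : ℕ} {δ C : ℝ} (hT : 2 ≤ T) (hδ : 0 < δ) (hδ1 : δ < 1) (hC : 0 ≤ C)
    (hCT : C ≤ T) :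
    (gridSize T δ C : ℝ) ≤ 5 * min (√(T : ℝ)) (((T : ℝ) ^ 2 / (1 + C)) ^ (1 / 3 : ℝ)) := by
  have hl := half_le_log hT
  have hι := (log_le_confidence hT hδ hδ1)
  have hT2 : (2 : ℝ) ≤ T := by exact_mod_cast hT
  have hT0 : (0 : ℝ) < T := by linarith
  have ha0 : 47 / 100 ≤ confidence T δ * Real.log T := by nlinarith
  set a := confidence T δ * Real.log T with ha
  have hC1 : 0 < 1 + C := by linarith
  set Z := ((T : ℝ) ^ 2 / (1 + C)) ^ (1 / 3 : ℝ) with hZ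
  have hZ3 : Z ^ 3 = (T : ℝ) ^ 2 / (1 + C) := rpow_third_pow (by positivity)
  have hZ0 : 0 ≤ Z := by positivity
  have hS1 : 1 ≤ √(T : ℝ) := by
    rw [Real.one_le_sqrt]
    linarith
  -- Here `C ≤ T` enters: both scales are at least 1, so the `+ 1` of the ceiling is absorbed into
  -- the constant.
  have hZ1 : 1 ≤ Z := by
    refine le_of_cube_le hZ0 ?_
    rw [hZ3, one_pow, le_div_iff₀ hC1]
    nlinarith
  have h1 : √(T / a) ≤ 3 * √(T : ℝ) := by
    rw [Real.sqrt_le_left (by positivity), mul_pow, Real.sq_sqrt hT0.le, div_le_iff₀ (by linarith)]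
    nlinarith
  have h2 : ((T : ℝ) ^ 2 / (confidence T δ * (1 + C) * Real.log T)) ^ (1 / 3 : ℝ) ≤ 3 * Z := by
    have heq : confidence T δ * (1 + C) * Real.log T = a * (1 + C) := by rw [ha]; ring
    rw [heq]
    refine le_of_cube_le (by positivity) ?_
    rw [rpow_third_pow (by positivity), mul_pow, hZ3, mul_comm a, ← div_div,
      div_le_iff₀ (by linarith)]
    have : 0 ≤ (T : ℝ) ^ 2 / (1 + C) := by positivity
    nlinarith
  have hX0 : 0 ≤ min (√(T / a)) (((T : ℝ) ^ 2 / (confidence T δ * (1 + C) * Real.log T)) ^ (1 / 3 : ℝ)) := by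
    have : 0 ≤ confidence T δ := by linarith
    have : 0 ≤ Real.log T := by linarith
    positivity
  have h3 := Nat.ceil_lt_add_one hX0
  have h4 : min (√(T / a)) (((T : ℝ) ^ 2 / (confidence T δ * (1 + C) * Real.log T)) ^ (1 / 3 : ℝ)) ≤
      3 * min (√(T : ℝ)) Z := by
    rcases le_total (√(T : ℝ)) Z with h | h
    · rw [min_eq_left h]
      exact (min_le_left _ _).trans h1
    · rw [min_eq_right h]
      exact (min_le_right _ _).trans h2
  have h5 : 1 ≤ min (√(T : ℝ)) Z := le_min hS1 hZ1
  rw [gridSize]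
  linarith

end GridSize


/-! ### Reasoning about programs -/

section Runs

theorem Memory.setInt_int (m : Memory) (x v y : ℕ) :
    (m.setInt x v).int y = if y = x then v else m.int y := by
  simp [Memory.setInt, Function.update_apply]

theorem Memory.setInt_real (m : Memory) (x v : ℕ) : (m.setInt x v).real = m.real := rfl

theorem Memory.setReal_int (m : Memory) (a i : ℕ) (v : ℝ) : (m.setReal a i v).int = m.int := rfl

theorem Memory.setReal_real (m : Memory) (a i : ℕ) (v : ℝ) (b : ℕ) :
    (m.setReal a i v).real b = if b = a then Function.update (m.real a) i v else m.real b := by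
  simp [Memory.setReal, Function.update_apply]

/-- The program `c`, started in `m`, stops after at most `B` steps in a memory that satisfies `Q`. -/
def Runs (W : ℕ) (c : Prog) (m : Memory) (B : ℕ) (Q : Memory → Prop) : Prop :=
  ∃ n m', Exec W c m n m' ∧ n ≤ B ∧ Q m'

variable {W : ℕ} {Q : Memory → Prop} {m : Memory} {B : ℕ}

theorem Runs.mono {c : Prog} {R : Memory → Prop} (h : Runs W c m B R) (hQ : ∀ m', R m' → Q m') :
    Runs W c m B Q := by
  obtain ⟨n, m', h1, h2, h3⟩ := h
  exact ⟨n, m', h1, h2, hQ m' h3⟩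

theorem Runs.setInt {x : ℕ} {a : IntExp} (hW : a.eval m ≤ W) (hB : a.cost + 1 ≤ B)
    (hQ : Q (m.setInt x (a.eval m))) : Runs W (.setInt x a) m B Q :=
  ⟨_, _, Exec.setInt x a m hW, hB, hQ⟩

theorem Runs.setReal {a : ℕ} {i : IntExp} {v : RealExp} (hB : i.cost + v.cost + 1 ≤ B)
    (hQ : Q (m.setReal a (i.eval m) (v.eval m))) : Runs W (.setReal a i v) m B Q :=
  ⟨_, _, Exec.setReal a i v m, hB, hQ⟩

theorem Runs.seq {c d : Prog} (B₁ B₂ : ℕ) (h : Runs W c m B₁ fun m' => Runs W d m' B₂ Q)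
    (hB : B₁ + B₂ ≤ B) : Runs W (.seq c d) m B Q := by
  obtain ⟨n₁, m₁, h1, h2, n₂, m₂, h3, h4, h5⟩ := h
  exact ⟨_, _, Exec.seq c d m m₁ m₂ n₁ n₂ h1 h3, (add_le_add h2 h4).trans hB, h5⟩

theorem Runs.ite {b : Test} {c d : Prog} (B₁ : ℕ) (hc : b.holds m → Runs W c m B₁ Q)
    (hd : ¬ b.holds m → Runs W d m B₁ Q) (hB : b.cost + B₁ + 1 ≤ B) :
    Runs W (.ite b c d) m B Q := by
  by_cases hb : b.holds m
  · obtain ⟨n, m', h1, h2, h3⟩ := hc hb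
    exact ⟨_, _, Exec.iteTrue b c d m m' n hb h1, by omega, h3⟩
  · obtain ⟨n, m', h1, h2, h3⟩ := hd hb
    exact ⟨_, _, Exec.iteFalse b c d m m' n hb h1, by omega, h3⟩

/-- A loop with an invariant that is indexed by the number of iterations still allowed. -/
theorem Runs.whileLoop {Inv : ℕ → Memory → Prop} {b : Test} {c : Prog} (B₁ : ℕ)
    (hstep : ∀ j m, Inv j m → b.holds m → ∃ j', j = j' + 1 ∧ Runs W c m B₁ (Inv j'))
    (hQ : ∀ j m, Inv j m → ¬ b.holds m → Q m) (j : ℕ) (hm : Inv j m)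
    (hB : j * (b.cost + B₁ + 1) + b.cost + 1 ≤ B) : Runs W (.while b c) m B Q := by
  induction j generalizing m B with
  | zero =>
    have hb : ¬ b.holds m := fun hb => by
      obtain ⟨j', hj', -⟩ := hstep 0 m hm hb
      omega
    exact ⟨_, _, Exec.whileFalse b c m hb, by omega, hQ 0 m hm hb⟩
  | succ j ih =>
    by_cases hb : b.holds m
    · obtain ⟨j', hj', n₁, m₁, h1, h2, h3⟩ := hstep _ m hm hb
      obtain rfl : j = j' := by omega
      obtain ⟨n₂, m₂, h4, h5, h6⟩ := ih h3 (B := j * (b.cost + B₁ + 1) + b.cost + 1) le_rfl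
      refine ⟨_, _, Exec.whileTrue b c m m₁ m₂ n₁ n₂ hb h1 h4, ?_, h6⟩
      rw [Nat.succ_mul] at hB
      omega
    · refine ⟨_, _, Exec.whileFalse b c m hb, ?_, hQ _ m hm hb⟩
      omega

/-- The loop `for i < N`, with the index in register 5 and `N` in register 1. -/
def forLoop (c : Prog) : Prog :=
  .seq (.setInt 5 (.lit 0)) (.while (.intLT (.reg 5) (.reg 1))
    (.seq c (.setInt 5 (.add (.reg 5) (.lit 1)))))

/-- An iteration costs 3 for the test, `B₁` for the body, 4 for the increment and 1 for the loop
itself, hence `B₁ + 8`. The fuel of the underlying loop is `N - j`. -/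
theorem Runs.forLoop {N : ℕ} {Inv : ℕ → Memory → Prop} {c : Prog} (B₁ : ℕ) (hN : N ≤ W)
    (hreg : ∀ j m, Inv j m → m.int 5 = j ∧ m.int 1 = N) (h0 : Inv 0 (m.setInt 5 0))
    (hstep : ∀ j m, j < N → Inv j m →
      Runs W c m B₁ fun m' => m'.int 5 = j ∧ Inv (j + 1) (m'.setInt 5 (j + 1)))
    (hQ : ∀ m', Inv N m' → Q m') (hB : N * (B₁ + 8) + 6 ≤ B) :
    Runs W (OnlineCalibration.forLoop c) m B Q := by
  refine Runs.seq 2 (N * (B₁ + 8) + 4) (Runs.setInt (Nat.zero_le _) le_rfl ?_) (by omega)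
  refine Runs.whileLoop (Inv := fun j' m => ∃ j, j + j' = N ∧ Inv j m) (B₁ + 4) ?_ ?_ N
    ⟨0, by omega, h0⟩ (le_of_eq ?_)
  · rintro j' m ⟨j, hj, hm⟩ hb
    obtain ⟨h5, h1⟩ := hreg j m hm
    have hlt : j < N := by
      simpa [Test.holds, IntExp.eval, h5, h1] using hb
    refine ⟨j' - 1, by omega, ?_⟩
    refine Runs.seq B₁ 4 ((hstep j m hlt hm).mono fun m' hm' => ?_) le_rfl
    have heval : (IntExp.add (.reg 5) (.lit 1)).eval m' = j + 1 := by
      simp [IntExp.eval, hm'.1]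
    refine Runs.setInt (by omega) le_rfl ⟨j + 1, by omega, ?_⟩
    rw [heval]
    exact hm'.2
  · rintro j' m ⟨j, hj, hm⟩ hb
    obtain ⟨h5, h1⟩ := hreg j m hm
    have hge : N ≤ j := by
      simpa [Test.holds, IntExp.eval, h5, h1] using hb
    obtain rfl : j = N := by omega
    exact hQ m hm
  · simp only [Test.cost, IntExp.cost]
    ring

end Runs

/-! ### Sampling distributions on two points -/

section TwoPoint

variable {T : ℕ}

/-- The distribution with mass `θ` at `k₀` and the rest at `k₁`. -/
def twoPoint (k₀ k₁ : Fin (T + 1)) (θ : ℝ) (h0 : 0 ≤ θ) (h1 : θ ≤ 1) : PMF (Fin (T + 1)) :=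
  PMF.ofFintype (fun k => ENNReal.ofReal
    ((if k = k₀ then θ else 0) + (if k = k₁ then 1 - θ else 0))) (by
      rw [← ENNReal.ofReal_sum_of_nonneg]
      · simp [Finset.sum_add_distrib]
      · intro k _
        have : 0 ≤ 1 - θ := by linarith
        positivity)

theorem twoPoint_apply (k₀ k₁ : Fin (T + 1)) (θ : ℝ) (h0 : 0 ≤ θ) (h1 : θ ≤ 1) (k : Fin (T + 1)) :
    (twoPoint k₀ k₁ θ h0 h1 k).toReal =
      (if k = k₀ then θ else 0) + (if k = k₁ then 1 - θ else 0) := by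
  rw [twoPoint, PMF.ofFintype_apply, ENNReal.toReal_ofReal]
  have : 0 ≤ 1 - θ := by linarith
  positivity

theorem twoPoint_self (k : Fin (T + 1)) (θ : ℝ) (h0 : 0 ≤ θ) (h1 : θ ≤ 1) :
    twoPoint k k θ h0 h1 = PMF.pure k := by
  ext j
  rw [twoPoint, PMF.ofFintype_apply, PMF.pure_apply]
  by_cases h : j = k <;> simp [h]

end TwoPoint

/-! ### The potential at the grid points -/

section Potential

variable {N T : ℕ}

theorem sum_units (f : ℤˣ → ℝ) : ∑ s, f s = f 1 + f (-1) := by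
  have : (Finset.univ : Finset ℤˣ) = {1, -1} := by decide
  rw [this, Finset.sum_pair (by decide)]

/-- The weights that are stored in the arrays 3 and 4. -/
def storedWeight (N : ℕ) (m : Memory) (e : Expert N) : ℝ :=
  if e.2 = 1 then m.real 3 e.1 else m.real 4 e.1

theorem potential_storedWeight (hN : 0 < N) (hT : 0 < T) (m : Memory) (k : Fin (T + 1)) :
    potential (uniformPartition N) (storedWeight N m) (gridPoint T k) =
      m.real 3 (cell N T k) - m.real 4 (cell N T k) := by
  simp only [potential, Fintype.sum_prod_type, sum_units, indicator_uniformPartition hT]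
  have h1 : ∀ i : Fin N, storedWeight N m (i, 1) * signValue 1 * (inCell N i k * 1) +
      storedWeight N m (i, -1) * signValue (-1) * (inCell N i k * 1) =
      inCell N i k * (m.real 3 i - m.real 4 i) := by
    intro i
    simp [storedWeight, signValue, show (-1 : ℤˣ) ≠ 1 by decide]
    ring
  simp only [h1, sum_inCell_mul hN hT]

end Potential

/-! ### The prediction -/

/-- The index of the interval that contains `k / T`. -/
def cellExp (k : IntExp) : IntExp := .sub (.div (.mul k (.reg 1)) (.reg 0)) (.div k (.reg 0))

/-- The potential at `k / T`. -/
def potentialExp (k : IntExp) : RealExp := .sub (.cell 3 (cellExp k)) (.cell 4 (cellExp k))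

/-- The forecast made from `k / T`. -/
def forecastExp (k : IntExp) : RealExp :=
  .div (.add (.ofInt (cellExp k)) (.ofInt (.lit 1))) (.ofInt (.reg 1))

/-- The choice of the point mass at `k / T`. -/
def choosePoint (k : IntExp) : Prog :=
  .seq (.setInt 2 k) (.seq (.setInt 3 k) (.setReal 0 (.lit 0) (.ofInt (.lit 1))))

/-- One step of the binary search for a sign change of the potential. -/
def searchStep : Prog :=
  .seq (.setInt 7 (.div (.add (.reg 2) (.reg 3)) (.lit 2)))
    (.ite (.realLT (.ofInt (.lit 0)) (potentialExp (.reg 7)))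
      (.setInt 3 (.reg 7)) (.setInt 2 (.reg 7)))

/-- The binary search for a sign change of the potential. -/
def searchProg : Prog :=
  .seq (.setInt 2 (.lit 0)) (.seq (.setInt 3 (.reg 0))
    (.seq (.while (.intLT (.add (.reg 2) (.lit 1)) (.reg 3)) searchStep)
      (.setReal 0 (.lit 0) (.div (potentialExp (.reg 3))
        (.sub (potentialExp (.reg 3)) (potentialExp (.reg 2)))))))

/-- The prediction of a round. -/
def predictProg : Prog :=
  .seq (.ite (.realLT (.ofInt (.lit 0)) (potentialExp (.lit 0))) (choosePoint (.lit 0))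
      (.ite (.realLT (.ofInt (.lit 0)) (potentialExp (.reg 0))) searchProg (choosePoint (.reg 0))))
    (.seq (.setReal 1 (.lit 0) (forecastExp (.reg 2))) (.setReal 2 (.lit 0) (forecastExp (.reg 3))))

section Predict

variable {N T : ℕ}

theorem cellExp_eval {m : Memory} (h0 : m.int 0 = T) (h1 : m.int 1 = N) (k : IntExp) :
    (cellExp k).eval m = cell N T (k.eval m) := by
  simp [cellExp, IntExp.eval, h0, h1, cell]

/-- The part of the memory that a prediction leaves alone. -/
def SameWeights (T N : ℕ) (m₀ m : Memory) : Prop :=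
  m.int 0 = T ∧ m.int 1 = N ∧ m.real 3 = m₀.real 3 ∧ m.real 4 = m₀.real 4 ∧ m.real 5 = m₀.real 5

/-- The stored potential at `k / T`. -/
def storedPotential (N T : ℕ) (m : Memory) (k : ℕ) : ℝ :=
  m.real 3 (cell N T k) - m.real 4 (cell N T k)

theorem potentialExp_eval {m₀ m : Memory} (h : SameWeights T N m₀ m) (k : IntExp) :
    (potentialExp k).eval m = storedPotential N T m₀ (k.eval m) := by
  simp [potentialExp, RealExp.eval, cellExp_eval h.1 h.2.1, h.2.2.1, h.2.2.2.1, storedPotential]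

theorem SameWeights.setInt {m₀ m : Memory} (h : SameWeights T N m₀ m) {x v : ℕ} (hx : 2 ≤ x) :
    SameWeights T N m₀ (m.setInt x v) := by
  obtain ⟨h0, h1, h2⟩ := h
  refine ⟨?_, ?_, h2⟩
  · rw [Memory.setInt_int, if_neg (by omega), h0]
  · rw [Memory.setInt_int, if_neg (by omega), h1]

theorem SameWeights.setReal {m₀ m : Memory} (h : SameWeights T N m₀ m) {a i : ℕ} {v : ℝ}
    (ha : a < 3) : SameWeights T N m₀ (m.setReal a i v) := by
  obtain ⟨h0, h1, h3, h4, h5⟩ := h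
  refine ⟨h0, h1, ?_, ?_, ?_⟩ <;> rw [Memory.setReal_real, if_neg (by omega)] <;> assumption

/-- The distribution chosen in the memory `m`, for the weights stored in `m₀`. -/
def Chosen (T N : ℕ) (m₀ m : Memory) : Prop :=
  SameWeights T N m₀ m ∧ m.int 2 ≤ T ∧ m.int 3 ≤ T ∧ 0 ≤ m.real 0 0 ∧ m.real 0 0 ≤ 1 ∧
  ((0 < storedPotential N T m₀ 0 ∧ m.int 2 = 0 ∧ m.int 3 = 0) ∨
   (storedPotential N T m₀ 0 ≤ 0 ∧ storedPotential N T m₀ T ≤ 0 ∧ m.int 2 = T ∧ m.int 3 = T) ∨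
   (storedPotential N T m₀ 0 ≤ 0 ∧ 0 < storedPotential N T m₀ T ∧ m.int 3 = m.int 2 + 1 ∧
    storedPotential N T m₀ (m.int 2) ≤ 0 ∧ 0 < storedPotential N T m₀ (m.int 3) ∧
    m.real 0 0 = storedPotential N T m₀ (m.int 3) /
      (storedPotential N T m₀ (m.int 3) - storedPotential N T m₀ (m.int 2))))

theorem choosePoint_runs {W : ℕ} {m₀ m : Memory} (hm : SameWeights T N m₀ m) (hTW : T ≤ W)
    (k : IntExp) (hk : ∀ m', SameWeights T N m₀ m' → k.eval m' = k.eval m)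
    (hkT : k.eval m ≤ T) (hcost : k.cost ≤ 1) :
    Runs W (choosePoint k) m 8 fun m' => SameWeights T N m₀ m' ∧ m'.int 2 = k.eval m ∧
      m'.int 3 = k.eval m ∧ m'.real 0 0 = 1 := by
  refine Runs.seq 2 6 (Runs.setInt (by omega) (by omega) ?_) le_rfl
  have hm1 := hm.setInt (x := 2) (v := k.eval m) le_rfl
  have he := hk _ hm1
  refine Runs.seq 2 4 (Runs.setInt (by omega) (by omega) ?_) le_rfl
  rw [he]
  have hm2 := hm1.setInt (x := 3) (v := k.eval m) (by norm_num)
  refine Runs.setReal (by simp [IntExp.cost, RealExp.cost]) ⟨hm2.setReal (by norm_num), ?_, ?_, ?_⟩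
  · simp [Memory.setReal_int, Memory.setInt_int]
  · simp [Memory.setReal_int, Memory.setInt_int]
  · simp [Memory.setReal_real, IntExp.eval, RealExp.eval]

/-- The bracket keeps `Φ ≤ 0` at its left end and `Φ > 0` at its right end, and its length at most
`2 ^ j` with `j` iterations left; it ends with two neighbouring grid points. No monotonicity of `Φ`
is needed. -/
theorem searchProg_runs {W J : ℕ} {m₀ m : Memory} (hm : SameWeights T N m₀ m) (hTW : T ≤ W)
    (hT : 0 < T) (hJ : T ≤ 2 ^ J) (h0 : storedPotential N T m₀ 0 ≤ 0)
    (h1 : 0 < storedPotential N T m₀ T) :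
    Runs W searchProg m (J * 50 + 100) (Chosen T N m₀) := by
  refine Runs.seq 2 (J * 50 + 90) (Runs.setInt (Nat.zero_le _) le_rfl ?_) (by omega)
  have hm1 := hm.setInt (x := 2) (v := 0) le_rfl
  have he : (IntExp.reg 0).eval (m.setInt 2 0) = T := hm1.1
  refine Runs.seq 2 (J * 50 + 80) (Runs.setInt (by rw [IntExp.eval] at *; omega) le_rfl ?_) (by omega)
  change Runs W _ ((m.setInt 2 0).setInt 3 ((IntExp.reg 0).eval (m.setInt 2 0))) _ _
  rw [he]
  have hm2 := hm1.setInt (x := 3) (v := T) (by norm_num)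
  refine Runs.seq (J * 50 + 10) 70 ?_ (by omega)
  refine Runs.whileLoop (Inv := fun j m' => SameWeights T N m₀ m' ∧ m'.int 2 < m'.int 3 ∧
    m'.int 3 ≤ T ∧ m'.int 3 - m'.int 2 ≤ 2 ^ j ∧ storedPotential N T m₀ (m'.int 2) ≤ 0 ∧
    0 < storedPotential N T m₀ (m'.int 3)) 43 ?_ ?_ J ?_ ?_
  · rintro j m' ⟨hs, hlt, hle, hgap, hn, hp⟩ hb
    have hb : m'.int 2 + 1 < m'.int 3 := hb
    cases j with
    | zero =>
      rw [pow_zero] at hgap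
      omega
    | succ j =>
      refine ⟨j, rfl, ?_⟩
      rw [pow_succ] at hgap
      have hmid : (IntExp.div (.add (.reg 2) (.reg 3)) (.lit 2)).eval m' =
        (m'.int 2 + m'.int 3) / 2 := rfl
      refine Runs.seq 6 37 (Runs.setInt (by rw [hmid]; omega) le_rfl ?_) le_rfl
      rw [hmid]
      set d := (m'.int 2 + m'.int 3) / 2 with hd
      have hs1 := hs.setInt (x := 7) (v := d) (by norm_num)
      have hd7 : (m'.setInt 7 d).int 7 = d := by simp [Memory.setInt_int]
      have hd2 : (m'.setInt 7 d).int 2 = m'.int 2 := by simp [Memory.setInt_int]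
      have hd3 : (m'.setInt 7 d).int 3 = m'.int 3 := by simp [Memory.setInt_int]
      refine Runs.ite 2 (fun hc => ?_) (fun hc => ?_) ?_
      · have hpos : 0 < storedPotential N T m₀ d := by
          simpa [Test.holds, RealExp.eval, potentialExp_eval hs1, IntExp.eval, hd7] using hc
        refine Runs.setInt (by rw [IntExp.eval, hd7]; omega) le_rfl ?_
        rw [IntExp.eval, hd7]
        refine ⟨hs1.setInt (by norm_num), ?_⟩
        simp only [Memory.setInt_int, reduceIte, Nat.reduceEqDiff]
        exact ⟨by omega, by omega, by omega, hn, hpos⟩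
      · have hneg : storedPotential N T m₀ d ≤ 0 := by
          simpa [Test.holds, RealExp.eval, potentialExp_eval hs1, IntExp.eval, hd7] using hc
        refine Runs.setInt (by rw [IntExp.eval, hd7]; omega) le_rfl ?_
        rw [IntExp.eval, hd7]
        refine ⟨hs1.setInt (by norm_num), ?_⟩
        simp only [Memory.setInt_int, reduceIte, Nat.reduceEqDiff]
        exact ⟨by omega, by omega, by omega, hneg, hp⟩
      · simp [Test.cost, RealExp.cost, IntExp.cost, potentialExp, cellExp]
  · rintro j m' ⟨hs, hlt, hle, hgap, hn, hp⟩ hb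
    have hb : ¬ (m'.int 2 + 1 < m'.int 3) := hb
    refine Runs.setReal (by simp [RealExp.cost, IntExp.cost, potentialExp, cellExp]) ?_
    have heval : (RealExp.div (potentialExp (.reg 3))
        (.sub (potentialExp (.reg 3)) (potentialExp (.reg 2)))).eval m' =
        storedPotential N T m₀ (m'.int 3) /
          (storedPotential N T m₀ (m'.int 3) - storedPotential N T m₀ (m'.int 2)) := by
      simp [RealExp.eval, potentialExp_eval hs, IntExp.eval]
    rw [heval]
    have hval : ((m'.setReal 0 ((IntExp.lit 0).eval m') (storedPotential N T m₀ (m'.int 3) /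
          (storedPotential N T m₀ (m'.int 3) - storedPotential N T m₀ (m'.int 2))))).real 0 0 =
        storedPotential N T m₀ (m'.int 3) /
          (storedPotential N T m₀ (m'.int 3) - storedPotential N T m₀ (m'.int 2)) := by
      simp [Memory.setReal_real, IntExp.eval]
    -- The right end is strictly positive, so both potentials never vanish together and the mass is
    -- well defined.
    have hden : 0 < storedPotential N T m₀ (m'.int 3) - storedPotential N T m₀ (m'.int 2) := by
      linarith
    refine ⟨hs.setReal (by norm_num), ?_, ?_, ?_, ?_, Or.inr (Or.inr ⟨h0, h1, ?_, hn, hp, hval⟩)⟩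
    · rw [Memory.setReal_int]
      omega
    · rw [Memory.setReal_int]
      exact hle
    · rw [hval]
      positivity
    · rw [hval, div_le_one hden]
      linarith
    · rw [Memory.setReal_int]
      omega
  · refine ⟨hm2, ?_⟩
    simp only [Memory.setInt_int, reduceIte, Nat.reduceEqDiff]
    exact ⟨hT, le_rfl, by omega, h0, h1⟩
  · simp only [Test.cost, IntExp.cost]
    omega

theorem predictProg_runs {W J : ℕ} {m : Memory} (hm0 : m.int 0 = T) (hm1 : m.int 1 = N)
    (hTW : T ≤ W) (hT : 0 < T) (hJ : T ≤ 2 ^ J) :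
    Runs W predictProg m (J * 50 + 250) fun m' => Chosen T N m m' ∧
      m'.real 1 0 = ((cell N T (m'.int 2) : ℝ) + 1) / N ∧
      m'.real 2 0 = ((cell N T (m'.int 3) : ℝ) + 1) / N := by
  have hs : SameWeights T N m m := ⟨hm0, hm1, rfl, rfl, rfl⟩
  have hreg : ∀ m', SameWeights T N m m' → (IntExp.reg 0).eval m' = (IntExp.reg 0).eval m :=
    fun m' h => h.1.trans hm0.symm
  have hreg0 : (IntExp.reg 0).eval m = T := hm0
  refine Runs.seq (J * 50 + 190) 60 ?_ (by omega)
  refine Runs.mono (R := Chosen T N m) ?_ fun m₁ hc => ?_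
  · refine Runs.ite (J * 50 + 150) (fun h => ?_) (fun h => ?_) ?_
    · have h : 0 < storedPotential N T m 0 := by
        simpa [Test.holds, RealExp.eval, potentialExp_eval hs, IntExp.eval] using h
      obtain ⟨n, m', h1, h2, h3, h4, h5, h6⟩ :=
        choosePoint_runs hs hTW (.lit 0) (fun _ _ => rfl) (Nat.zero_le _) le_rfl
      refine ⟨n, m', h1, by omega, h3, ?_, ?_, by rw [h6]; norm_num, by rw [h6],
        Or.inl ⟨h, h4, h5⟩⟩
      · rw [h4]; exact Nat.zero_le _
      · rw [h5]; exact Nat.zero_le _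
    · have h : storedPotential N T m 0 ≤ 0 := by
        simpa [Test.holds, RealExp.eval, potentialExp_eval hs, IntExp.eval] using h
      refine Runs.ite (J * 50 + 100) (fun h' => ?_) (fun h' => ?_) ?_
      · have h' : 0 < storedPotential N T m T := by
          simpa [Test.holds, RealExp.eval, potentialExp_eval hs, IntExp.eval, hm0] using h'
        exact searchProg_runs hs hTW hT hJ h h'
      · have h' : storedPotential N T m T ≤ 0 := by
          simpa [Test.holds, RealExp.eval, potentialExp_eval hs, IntExp.eval, hm0] using h'
        obtain ⟨n, m', h1, h2, h3, h4, h5, h6⟩ :=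
          choosePoint_runs hs hTW (.reg 0) hreg hreg0.le le_rfl
        rw [hreg0] at h4 h5
        exact ⟨n, m', h1, by omega, h3, h4.le, h5.le, by rw [h6]; norm_num, by rw [h6],
          Or.inr (Or.inl ⟨h, h', h4, h5⟩)⟩
      · simp only [Test.cost, RealExp.cost, IntExp.cost, potentialExp, cellExp]
        omega
    · simp only [Test.cost, RealExp.cost, IntExp.cost, potentialExp, cellExp]
      omega
  · obtain ⟨hs1, h2, h3, h4, h5, h6⟩ := hc
    have hfore : ∀ m', SameWeights T N m m' → ∀ k, (forecastExp k).eval m' =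
        ((cell N T (k.eval m') : ℝ) + 1) / N := by
      intro m' h k
      simp [forecastExp, RealExp.eval, cellExp_eval h.1 h.2.1, IntExp.eval, h.2.1]
    refine Runs.seq 30 30 (Runs.setReal (by simp [RealExp.cost, IntExp.cost, forecastExp, cellExp])
      ?_) le_rfl
    refine Runs.setReal (by simp [RealExp.cost, IntExp.cost, forecastExp, cellExp]) ?_
    have hs2 := hs1.setReal (a := 1) (i := (IntExp.lit 0).eval m₁)
      (v := (forecastExp (.reg 2)).eval m₁) (by norm_num)
    refine ⟨⟨hs2.setReal (by norm_num), h2, h3, ?_⟩, ?_, ?_⟩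
    · simpa [Memory.setReal_real, Memory.setReal_int] using ⟨h4, h5, h6⟩
    · simp [Memory.setReal_real, Memory.setReal_int, IntExp.eval, hfore _ hs1]
    · rw [hfore _ hs2]
      simp [Memory.setReal_real, Memory.setReal_int, IntExp.eval]

/-- The distribution chosen by the program is admitted and announced. -/
theorem Chosen.exists_dist {m₀ m : Memory} (hN : 0 < N) (hT : 0 < T) (h : Chosen T N m₀ m)
    (hf₀ : m.real 1 0 = ((cell N T (m.int 2) : ℝ) + 1) / N)
    (hf₁ : m.real 2 0 = ((cell N T (m.int 3) : ℝ) + 1) / N) :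
    ∃ P : PMF (Fin (T + 1)), Announces (uniformPartition N) m P ∧
      IsSamplingRule (potential (uniformPartition N) (storedWeight N m₀)) P := by
  obtain ⟨-, h2, h3, h4, h5, h6⟩ := h
  let k₀ : Fin (T + 1) := ⟨m.int 2, by omega⟩
  let k₁ : Fin (T + 1) := ⟨m.int 3, by omega⟩
  have hT' : (T : ℝ) ≠ 0 := by positivity
  have hpot : ∀ k : Fin (T + 1), potential (uniformPartition N) (storedWeight N m₀) (gridPoint T k) =
      storedPotential N T m₀ k := fun k => potential_storedWeight hN hT m₀ k
  have hzero : potential (uniformPartition N) (storedWeight N m₀) 0 = storedPotential N T m₀ 0 := by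
    simpa [gridPoint] using hpot 0
  have hone : potential (uniformPartition N) (storedWeight N m₀) 1 = storedPotential N T m₀ T := by
    simpa [gridPoint, hT'] using hpot (Fin.last T)
  refine ⟨twoPoint k₀ k₁ (m.real 0 0) h4 h5, ⟨k₀, k₁, rfl, rfl, h4, h5,
    twoPoint_apply k₀ k₁ _ h4 h5, ?_, ?_⟩, ?_⟩
  · rw [forecast_uniformPartition hN hT, hf₀]
  · rw [forecast_uniformPartition hN hT, hf₁]
  · rcases h6 with ⟨hp, hk2, hk3⟩ | ⟨hp0, hp1, hk2, hk3⟩ | ⟨hp0, hp1, hk, hn, hp, hθ⟩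
    · have e0 : k₀ = 0 := Fin.ext hk2
      have e1 : k₁ = 0 := Fin.ext hk3
      rw [e0, e1, twoPoint_self]
      refine ⟨fun _ => rfl, fun h => ?_, fun h => ?_⟩ <;> rw [hzero] at h <;> linarith
    · have e0 : k₀ = Fin.last T := Fin.ext hk2
      have e1 : k₁ = Fin.last T := Fin.ext hk3
      rw [e0, e1, twoPoint_self]
      refine ⟨fun h => ?_, fun _ _ => rfl, fun _ h => ?_⟩
      · rw [hzero] at h; linarith
      · rw [hone] at h; linarith
    · refine ⟨fun h => ?_, fun _ h => ?_, fun _ _ => ?_⟩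
      · rw [hzero] at h; linarith
      · rw [hone] at h; linarith
      let k : Fin T := ⟨m.int 2, by omega⟩
      have e0 : k.castSucc = k₀ := rfl
      have e1 : k.succ = k₁ := Fin.ext hk.symm
      have hne : k₀ ≠ k₁ := fun h => by
        have := congrArg Fin.val h
        change m.int 2 = m.int 3 at this
        omega
      refine ⟨k, ?_⟩
      rw [e0, e1, hpot, hpot, twoPoint_apply, twoPoint_apply]
      simp only [hne, hne.symm, if_true, if_false, add_zero, zero_add]
      change storedPotential N T m₀ (m.int 2) * storedPotential N T m₀ (m.int 3) ≤ 0 ∧ _ ∧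
        m.real 0 0 * (|storedPotential N T m₀ (m.int 2)| + |storedPotential N T m₀ (m.int 3)|)
          = |storedPotential N T m₀ (m.int 3)|
      refine ⟨mul_nonpos_of_nonpos_of_nonneg hn hp.le, by ring, ?_⟩
      rw [abs_of_nonpos hn, abs_of_pos hp, hθ]
      have : storedPotential N T m₀ (m.int 3) - storedPotential N T m₀ (m.int 2) ≠ 0 := by linarith
      field_simp
      ring

end Predict


/-! ### Expressions of the update -/

/-- A numeral. -/
def numExp (n : ℕ) : RealExp := .ofInt (.lit n)

/-- The maximum of two numbers. -/
def maxExp (a b : RealExp) : RealExp :=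
  .div (.add (.add a b) (.sqrt (.mul (.sub a b) (.sub a b)))) (numExp 2)

/-- The product of the numbers of experts and rounds. -/
def ratioExp : IntExp := .mul (.mul (.lit 2) (.reg 1)) (.reg 0)

/-- The learning rate of the interval in register 5. -/
def rateExp : RealExp :=
  .div (numExp 1) (maxExp (numExp 64) (.sqrt (.div (.cell 5 (.reg 5)) (.log (.ofInt ratioExp)))))

/-- The multiplicative update of the weight in the array `a`, for the loss `l` and the Lagrange
multiplier `s`. -/
def stepExp (a : ℕ) (l s : RealExp) : RealExp :=
  maxExp (.div (numExp 1) (.ofInt ratioExp)) (.mul (.cell a (.reg 5))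
    (.exp (.sub (numExp 0) (.mul (.cell 7 (.reg 5))
      (.add (.add l (.mul (.mul (numExp 32) (.cell 7 (.reg 5))) (.mul l l))) s)))))

/-- The updated weight of the positive expert. -/
def posExp (s : RealExp) : RealExp := stepExp 3 (.sub (numExp 0) (.cell 6 (.reg 5))) s

/-- The updated weight of the negative expert. -/
def negExp (s : RealExp) : RealExp := stepExp 4 (.cell 6 (.reg 5)) s

/-- A power of the number of rounds. -/
def powExp : ℕ → IntExp
  | 0 => .lit 1
  | n + 1 => .mul (powExp n) (.reg 0)

/-- The updated weight as a number. -/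
def stepVal (c w η l s : ℝ) : ℝ := max c (w * Real.exp (-(η * (l + 32 * η * l ^ 2 + s))))

/-- `max a b = (a + b + |a - b|) / 2`, with the absolute value written as the root of a square. -/
theorem maxExp_eval (m : Memory) (a b : RealExp) :
    (maxExp a b).eval m = max (a.eval m) (b.eval m) := by
  simp only [maxExp, numExp, RealExp.eval, IntExp.eval, Real.sqrt_mul_self_eq_abs]
  push_cast
  rcases le_total (a.eval m) (b.eval m) with h | h
  · rw [max_eq_right h, abs_of_nonpos (by linarith)]
    ring
  · rw [max_eq_left h, abs_of_nonneg (by linarith)]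
    ring

theorem powExp_eval (m : Memory) (n : ℕ) : (powExp n).eval m = m.int 0 ^ n := by
  induction n with
  | zero => rfl
  | succ n ih => rw [powExp, IntExp.eval, ih, IntExp.eval, pow_succ]

theorem stepExp_eval {T N : ℕ} {m : Memory} (h0 : m.int 0 = T) (h1 : m.int 1 = N) (a : ℕ)
    (l s : RealExp) : (stepExp a l s).eval m =
      stepVal (1 / ((2 * N * T : ℕ) : ℝ)) (m.real a (m.int 5)) (m.real 7 (m.int 5)) (l.eval m)
        (s.eval m) := by
  rw [stepExp, maxExp_eval, stepVal]
  simp only [RealExp.eval, IntExp.eval, numExp, ratioExp, h0, h1, Nat.cast_one, Nat.cast_zero,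
    zero_sub, Nat.cast_ofNat, ← pow_two]

section Update

variable {N T : ℕ}

/-! ### The gains and the learning rates -/

/-- Adds the gain at the point in register `k`, which has the probability `p`. -/
def addGain (k : ℕ) (p : RealExp) : Prog :=
  .setReal 6 (cellExp (.reg k)) (.add (.cell 6 (cellExp (.reg k)))
    (.mul p (.sub (.div (.ofInt (.reg k)) (.ofInt (.reg 0))) (.ofInt (.reg 4)))))

/-- Computes the gains in the array 6. -/
def gainProg : Prog :=
  .seq (forLoop (.setReal 6 (.reg 5) (numExp 0)))
    (.seq (addGain 2 (.cell 0 (.lit 0))) (addGain 3 (.sub (numExp 1) (.cell 0 (.lit 0)))))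

/-- Computes the learning rates in the array 7 and updates the sums of squares in the array 5. -/
def rateProg : Prog :=
  forLoop (.seq (.setReal 7 (.reg 5) rateExp) (.setReal 5 (.reg 5)
    (.add (.cell 5 (.reg 5)) (.mul (.cell 6 (.reg 5)) (.cell 6 (.reg 5))))))

/-- The gain of the interval `j`, when `k₀ / T` has the probability `θ` and `k₁ / T` the rest. -/
def storedGain (N T k₀ k₁ y : ℕ) (θ : ℝ) (j : ℕ) : ℝ :=
  (if j = cell N T k₀ then θ * ((k₀ : ℝ) / T - y) else 0) +
    (if j = cell N T k₁ then (1 - θ) * ((k₁ : ℝ) / T - y) else 0)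

/-- The two points may share an interval, so their contributions are accumulated into a cleared
array; hence the case distinction at the end. Only these two additions depend on the announced
distribution. -/
theorem gainProg_runs {W : ℕ} {m : Memory} (hNW : N ≤ W) (h0 : m.int 0 = T) (h1 : m.int 1 = N) :
    Runs W gainProg m (N * 12 + 106) fun m' => m'.int 0 = T ∧ m'.int 1 = N ∧
      m'.real 3 = m.real 3 ∧ m'.real 4 = m.real 4 ∧ m'.real 5 = m.real 5 ∧
      ∀ j < N, m'.real 6 j = storedGain N T (m.int 2) (m.int 3) (m.int 4) (m.real 0 0) j := by
  refine Runs.seq (N * 12 + 6) 100 ?_ le_rfl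
  refine Runs.forLoop (Inv := fun j m' => m'.int 5 = j ∧ (∀ x, x ≠ 5 → m'.int x = m.int x) ∧
    (∀ a, a ≠ 6 → m'.real a = m.real a) ∧ ∀ i < j, m'.real 6 i = 0) 4 hNW ?_ ?_ ?_ ?_ le_rfl
  · rintro j m' ⟨h5, hx, -⟩
    exact ⟨h5, (hx 1 (by norm_num)).trans h1⟩
  · refine ⟨by simp [Memory.setInt_int], fun x hx => by simp [Memory.setInt_int, hx],
      fun _ _ => rfl, fun i hi => by omega⟩
  · rintro j m' hj ⟨h5, hx, ha, hz⟩
    refine Runs.setReal (by simp [RealExp.cost, IntExp.cost, numExp]) ⟨h5, ?_, ?_, ?_, ?_⟩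
    · simp [Memory.setInt_int]
    · intro x hx5
      simp [Memory.setInt_int, hx5, Memory.setReal_int, hx x hx5]
    · intro a ha6
      simp [Memory.setInt_real, Memory.setReal_real, ha6, ha a ha6]
    · intro i hi
      simp only [Memory.setInt_real, Memory.setReal_real, if_true, IntExp.eval, h5,
        Function.update_apply, RealExp.eval, numExp, Nat.cast_zero]
      split_ifs with hij
      · rfl
      · exact hz i (by omega)
  · rintro m' ⟨h5, hx, ha, hz⟩
    have e0 : m'.int 0 = T := (hx 0 (by norm_num)).trans h0
    have e1 : m'.int 1 = N := (hx 1 (by norm_num)).trans h1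
    have e2 := hx 2 (by norm_num)
    have e3 := hx 3 (by norm_num)
    have e4 := hx 4 (by norm_num)
    have r0 := ha 0 (by norm_num)
    have r3 := ha 3 (by norm_num)
    have r4 := ha 4 (by norm_num)
    have r5 := ha 5 (by norm_num)
    refine Runs.seq 50 50 (Runs.setReal (by simp [RealExp.cost, IntExp.cost, cellExp]) ?_) le_rfl
    refine Runs.setReal (by simp [RealExp.cost, IntExp.cost, cellExp, numExp]) ⟨e0, e1, ?_⟩
    simp only [Memory.setReal_real, Nat.reduceEqDiff, if_true, if_false, r3,
      r4, r5, true_and]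
    intro j hj
    have hc2 : ∀ m'' : Memory, m''.int = m'.int →
        (cellExp (.reg 2)).eval m'' = cell N T (m.int 2) := by
      intro m'' h
      rw [cellExp_eval (T := T) (N := N) (by rw [h, e0]) (by rw [h, e1]), IntExp.eval, h, e2]
    have hc3 : ∀ m'' : Memory, m''.int = m'.int →
        (cellExp (.reg 3)).eval m'' = cell N T (m.int 3) := by
      intro m'' h
      rw [cellExp_eval (T := T) (N := N) (by rw [h, e0]) (by rw [h, e1]), IntExp.eval, h, e3]
    simp only [RealExp.eval, IntExp.eval, numExp, Memory.setReal_int, Memory.setReal_real,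
      hc2 m' rfl, hc3 (m'.setReal _ _ _) rfl, e0, e2, e3, e4, r0, if_true, Nat.cast_one,
      Function.update_apply, storedGain]
    have hz' := hz j hj
    by_cases h2 : j = cell N T (m.int 2) <;> by_cases h3 : j = cell N T (m.int 3)
    · simp [← h2, ← h3, hz']
    · simp [← h2, h3, hz']
    · have : ¬ (cell N T (m.int 3) = cell N T (m.int 2)) := fun h => h2 (h3.trans h)
      rw [← h3] at this ⊢
      simp [this, hz']
    · simp [h2, h3, hz']

theorem rateExp_eval {m : Memory} (h0 : m.int 0 = T) (h1 : m.int 1 = N) :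
    rateExp.eval m = learningRate (Expert N) T (m.real 5 (m.int 5)) := by
  simp only [rateExp, RealExp.eval, maxExp_eval, IntExp.eval, numExp, ratioExp, h0, h1,
    learningRate, card_expert]
  push_cast
  rfl

/-- The rate must see the earlier losses only, so it is read before the square of the new gain is
added. One entry per interval suffices, because the two signs have the same squares. -/
theorem rateProg_runs {W : ℕ} {m : Memory} (hNW : N ≤ W) (h0 : m.int 0 = T) (h1 : m.int 1 = N) :
    Runs W rateProg m (N * 208 + 6) fun m' => m'.int 0 = T ∧ m'.int 1 = N ∧
      m'.real 3 = m.real 3 ∧ m'.real 4 = m.real 4 ∧ m'.real 6 = m.real 6 ∧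
      ∀ j < N, m'.real 7 j = learningRate (Expert N) T (m.real 5 j) ∧
        m'.real 5 j = m.real 5 j + m.real 6 j ^ 2 := by
  refine Runs.forLoop (Inv := fun j m' => m'.int 5 = j ∧ (∀ x, x ≠ 5 → m'.int x = m.int x) ∧
    (∀ a, a ≠ 7 → a ≠ 5 → m'.real a = m.real a) ∧ (∀ i, j ≤ i → m'.real 5 i = m.real 5 i) ∧
    ∀ i < j, m'.real 7 i = learningRate (Expert N) T (m.real 5 i) ∧
        m'.real 5 i = m.real 5 i + m.real 6 i ^ 2) 200 hNW ?_ ?_ ?_ ?_ le_rfl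
  · rintro j m' ⟨h5, hx, -⟩
    exact ⟨h5, (hx 1 (by norm_num)).trans h1⟩
  · refine ⟨by simp [Memory.setInt_int], fun x hx => by simp [Memory.setInt_int, hx],
      fun _ _ _ => rfl, fun _ _ => rfl, fun i hi => by omega⟩
  · rintro j m' hj ⟨h5, hx, ha, hold, hnew⟩
    have e0 : m'.int 0 = T := (hx 0 (by norm_num)).trans h0
    have e1 : m'.int 1 = N := (hx 1 (by norm_num)).trans h1
    have r6 := ha 6 (by norm_num) (by norm_num)
    refine Runs.seq 150 50 (Runs.setReal (by decide) ?_) le_rfl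
    refine Runs.setReal (by simp [RealExp.cost, IntExp.cost]) ⟨h5, ?_, ?_, ?_, ?_, ?_⟩
    · simp [Memory.setInt_int]
    · intro x hx5
      simp [Memory.setInt_int, hx5, Memory.setReal_int, hx x hx5]
    · intro a ha7 ha5
      simp [Memory.setInt_real, Memory.setReal_real, ha7, ha5, ha a ha7 ha5]
    · intro i hi
      have hij : i ≠ j := by omega
      simp [Memory.setInt_real, Memory.setReal_real, Memory.setReal_int, IntExp.eval, h5,
        hij, hold i (by omega)]
    · intro i hi
      simp only [Memory.setInt_real, Memory.setReal_real, Memory.setReal_int, IntExp.eval, h5,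
        Function.update_apply, RealExp.eval, rateExp_eval e0 e1, r6, Nat.reduceEqDiff, if_true,
        if_false]
      by_cases hij : i = j
      · subst hij
        simp [hold i le_rfl, pow_two]
      · simpa [hij] using hnew i (by omega)
  · rintro m' ⟨h5, hx, ha, hold, hnew⟩
    exact ⟨(hx 0 (by norm_num)).trans h0, (hx 1 (by norm_num)).trans h1, ha 3 (by norm_num)
      (by norm_num), ha 4 (by norm_num) (by norm_num), ha 6 (by norm_num) (by norm_num), hnew⟩

/-! ### The bisection for the Lagrange multiplier -/

/-- The sum of the updated weights for the multiplier `s`, in the array `a`. -/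
def sumProg (a : ℕ) (s : RealExp) : Prog :=
  .seq (.setReal a (.lit 0) (numExp 0)) (forLoop (.setReal a (.lit 0)
    (.add (.cell a (.lit 0)) (.add (posExp s) (negExp s)))))

/-- The midpoint of the current interval. -/
def midExp : RealExp := .div (.add (.cell 8 (.lit 0)) (.cell 9 (.lit 0))) (numExp 2)

/-- One step of the bisection. -/
def bisectStep : Prog :=
  .seq (.setInt 6 (.mul (.reg 6) (.lit 2))) (.seq (sumProg 10 midExp)
    (.ite (.realLT (.cell 10 (.lit 0)) (numExp 1))
      (.setReal 9 (.lit 0) midExp) (.setReal 8 (.lit 0) midExp)))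

/-- The bisection, until the interval has the length `4 / T ^ 18`. -/
def bisectProg : Prog :=
  .seq (.setReal 8 (.lit 0) (.sub (numExp 0) (numExp 2))) (.seq (.setReal 9 (.lit 0) (numExp 2))
    (.seq (.setInt 6 (.lit 1)) (.while (.intLT (.reg 6) (powExp 18)) bisectStep)))

/-- The values that stay fixed during the bisection. -/
def Fixed (T N : ℕ) (m₀ m : Memory) : Prop :=
  m.int 0 = T ∧ m.int 1 = N ∧ ∀ a, 3 ≤ a → a ≤ 7 → m.real a = m₀.real a

theorem Fixed.setInt {m₀ m : Memory} (h : Fixed T N m₀ m) {x v : ℕ} (hx : 2 ≤ x) :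
    Fixed T N m₀ (m.setInt x v) := by
  obtain ⟨h0, h1, h2⟩ := h
  refine ⟨?_, ?_, h2⟩
  · rw [Memory.setInt_int, if_neg (by omega), h0]
  · rw [Memory.setInt_int, if_neg (by omega), h1]

theorem Fixed.setReal {m₀ m : Memory} (h : Fixed T N m₀ m) {a i : ℕ} {v : ℝ}
    (ha : 8 ≤ a) : Fixed T N m₀ (m.setReal a i v) := by
  obtain ⟨h0, h1, h2⟩ := h
  refine ⟨h0, h1, fun b hb hb' => ?_⟩
  rw [Memory.setReal_real, if_neg (by omega), h2 b hb hb']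

/-- The updated weight of the positive expert of the interval `j`. -/
def posVal (N T : ℕ) (m : Memory) (s : ℝ) (j : ℕ) : ℝ :=
  stepVal (1 / ((2 * N * T : ℕ) : ℝ)) (m.real 3 j) (m.real 7 j) (-m.real 6 j) s

/-- The updated weight of the negative expert of the interval `j`. -/
def negVal (N T : ℕ) (m : Memory) (s : ℝ) (j : ℕ) : ℝ :=
  stepVal (1 / ((2 * N * T : ℕ) : ℝ)) (m.real 4 j) (m.real 7 j) (m.real 6 j) s

/-- The sum of the updated weights. -/
def sumVal (N T : ℕ) (m : Memory) (s : ℝ) (n : ℕ) : ℝ :=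
  ∑ j ∈ Finset.range n, (posVal N T m s j + negVal N T m s j)

theorem posExp_eval {m₀ m : Memory} (h : Fixed T N m₀ m) (s : RealExp) :
    (posExp s).eval m = posVal N T m₀ (s.eval m) (m.int 5) := by
  rw [posExp, stepExp_eval h.1 h.2.1]
  simp [RealExp.eval, IntExp.eval, numExp, posVal, h.2.2]

theorem negExp_eval {m₀ m : Memory} (h : Fixed T N m₀ m) (s : RealExp) :
    (negExp s).eval m = negVal N T m₀ (s.eval m) (m.int 5) := by
  rw [negExp, stepExp_eval h.1 h.2.1]
  simp [RealExp.eval, IntExp.eval, negVal, h.2.2]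

theorem posExp_cost (s : RealExp) : (posExp s).cost = 3 * s.cost + 138 := by
  simp only [posExp, stepExp, maxExp, numExp, ratioExp, RealExp.cost, IntExp.cost]
  ring

theorem negExp_cost (s : RealExp) : (negExp s).cost = 3 * s.cost + 111 := by
  simp only [negExp, stepExp, maxExp, numExp, ratioExp, RealExp.cost, IntExp.cost]
  ring

/-- The hypothesis `hs` says that the multiplier expression does not read the accumulator `a`, so
its value stays `σ` while the sum is built up. -/
theorem sumProg_runs {W a : ℕ} {m₀ m : Memory} (hNW : N ≤ W) (hm : Fixed T N m₀ m) (ha : 8 ≤ a)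
    (s : RealExp) (hcost : s.cost ≤ 10) (σ : ℝ)
    (hs : ∀ m' : Memory, (∀ b, b ≠ a → m'.real b = m.real b) → s.eval m' = σ) :
    Runs W (sumProg a s) m (N * 358 + 10) fun m' => Fixed T N m₀ m' ∧
      m'.real a 0 = sumVal N T m₀ σ N ∧ (∀ b, b ≠ a → m'.real b = m.real b) ∧
      ∀ x, x ≠ 5 → m'.int x = m.int x := by
  refine Runs.seq 4 (N * 358 + 6) (Runs.setReal (by simp [RealExp.cost, IntExp.cost, numExp]) ?_)
    (by omega)
  refine Runs.forLoop (Inv := fun j m' => m'.int 5 = j ∧ (∀ x, x ≠ 5 → m'.int x = m.int x) ∧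
    (∀ b, b ≠ a → m'.real b = m.real b) ∧ Fixed T N m₀ m' ∧
    m'.real a 0 = sumVal N T m₀ σ j) 350 hNW ?_ ?_ ?_ ?_ le_rfl
  · rintro j m' ⟨h5, -, -, hF, -⟩
    exact ⟨h5, hF.2.1⟩
  · refine ⟨by simp [Memory.setInt_int], fun x hx => by simp [Memory.setInt_int, hx,
      Memory.setReal_int], fun b hb => by simp [Memory.setInt_real, Memory.setReal_real, hb],
      (hm.setReal ha).setInt (by norm_num), ?_⟩
    simp [Memory.setInt_real, Memory.setReal_real, IntExp.eval, RealExp.eval, numExp, sumVal]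
  · rintro j m' hj ⟨h5, hx, hb, hF, hsum⟩
    refine Runs.setReal ?_ ⟨h5, ?_, ?_, ?_, (hF.setReal ha).setInt (by norm_num), ?_⟩
    · simp only [RealExp.cost, IntExp.cost, posExp_cost, negExp_cost]
      omega
    · simp [Memory.setInt_int]
    · intro x hx5
      simp [Memory.setInt_int, hx5, Memory.setReal_int, hx x hx5]
    · intro b hba
      simp [Memory.setInt_real, Memory.setReal_real, hba, hb b hba]
    · simp only [Memory.setInt_real, Memory.setReal_real, if_true, IntExp.eval,
        Function.update_self, RealExp.eval, posExp_eval hF, negExp_eval hF, hs m' hb, hsum, h5]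
      rw [sumVal, sumVal, Finset.sum_range_succ]
  · rintro m' ⟨-, hx, hb, hF, hsum⟩
    exact ⟨hF, hsum, hb, hx⟩

/-- Register 6 is doubled whenever the interval is halved, so the length is always 4 over its
content, and the loop can be stopped by an integer comparison. The register is below `T ^ 18` before
a doubling, so words up to `2 * T ^ 18` suffice. -/
theorem bisectProg_runs {W J : ℕ} {m₀ m : Memory} (hNW : N ≤ W) (hTW : 2 * T ^ 18 ≤ W)
    (hT : 0 < T) (hm : Fixed T N m₀ m) (hJ : T ^ 18 ≤ 2 ^ J) (hlo : 1 ≤ sumVal N T m₀ (-2) N)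
    (hhi : sumVal N T m₀ 2 N ≤ 1) :
    Runs W bisectProg m (J * (N * 358 + 150) + 100) fun m' => Fixed T N m₀ m' ∧
      -2 ≤ m'.real 8 0 ∧ m'.real 8 0 ≤ m'.real 9 0 ∧
      m'.real 9 0 - m'.real 8 0 ≤ 4 / (T : ℝ) ^ 18 ∧
      1 ≤ sumVal N T m₀ (m'.real 8 0) N ∧ sumVal N T m₀ (m'.real 9 0) N ≤ 1 := by
  refine Runs.seq 7 (J * (N * 358 + 150) + 93) (Runs.setReal
    (by simp [RealExp.cost, IntExp.cost, numExp]) ?_) (by omega)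
  refine Runs.seq 4 (J * (N * 358 + 150) + 89) (Runs.setReal
    (by simp [RealExp.cost, IntExp.cost, numExp]) ?_) (by omega)
  have hW1 : 1 ≤ W := by
    have := Nat.pow_pos (n := 18) hT
    omega
  refine Runs.seq 2 (J * (N * 358 + 150) + 87) (Runs.setInt hW1 le_rfl ?_) (by omega)
  have hF0 := ((hm.setReal (a := 8) (i := (IntExp.lit 0).eval m)
    (v := (RealExp.sub (numExp 0) (numExp 2)).eval m) le_rfl).setReal (a := 9) (i := 0)
    (v := 2) (by norm_num)).setInt (x := 6) (v := 1) (by norm_num)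
  refine Runs.whileLoop (Inv := fun j m' => Fixed T N m₀ m' ∧ T ^ 18 ≤ m'.int 6 * 2 ^ j ∧
    1 ≤ m'.int 6 ∧ -2 ≤ m'.real 8 0 ∧ m'.real 9 0 - m'.real 8 0 = 4 / (m'.int 6 : ℝ) ∧
      1 ≤ sumVal N T m₀ (m'.real 8 0) N ∧ sumVal N T m₀ (m'.real 9 0) N ≤ 1)
    (N * 358 + 80) ?_ ?_ J ?_ ?_
  · rintro j m' ⟨hF, hx, hx1, hl, hlen, hL, hH⟩ hb
    have hb : m'.int 6 < T ^ 18 := by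
      have : m'.int 6 < (powExp 18).eval m' := hb
      rwa [powExp_eval, hF.1] at this
    cases j with
    | zero =>
      rw [pow_zero, mul_one] at hx
      omega
    | succ j =>
      refine ⟨j, rfl, ?_⟩
      have heval : (IntExp.mul (.reg 6) (.lit 2)).eval m' = m'.int 6 * 2 := rfl
      refine Runs.seq 4 (N * 358 + 76) (Runs.setInt (by rw [heval]; omega)
        (by simp [IntExp.cost]) ?_) (by omega)
      rw [heval]
      have hF1 := hF.setInt (x := 6) (v := m'.int 6 * 2) (by norm_num)
      set mid := (m'.real 8 0 + m'.real 9 0) / 2 with hmid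
      have hmidExp : ∀ m'' : Memory, (∀ b, b ≠ 10 → m''.real b = m'.real b) →
          midExp.eval m'' = mid := by
        intro m'' h
        simp [midExp, RealExp.eval, IntExp.eval, numExp, h, hmid]
      refine Runs.seq (N * 358 + 10) 66 ((sumProg_runs hNW hF1 (by norm_num) midExp (by decide) mid
        hmidExp).mono ?_) (by omega)
      rintro m₁ ⟨hF2, hS, hr, hi⟩
      have hi6 : m₁.int 6 = m'.int 6 * 2 := by
        rw [hi 6 (by norm_num), Memory.setInt_int, if_pos rfl]
      have hr8 : m₁.real 8 = m'.real 8 := hr 8 (by norm_num)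
      have hr9 : m₁.real 9 = m'.real 9 := hr 9 (by norm_num)
      have hmid1 : midExp.eval m₁ = mid := hmidExp m₁ hr
      have hxpos : (0 : ℝ) < m'.int 6 := by exact_mod_cast hx1
      have hhalf : 4 / ((m'.int 6 * 2 : ℕ) : ℝ) = (m'.real 9 0 - m'.real 8 0) / 2 := by
        rw [hlen]
        push_cast
        field_simp
      have hpow : T ^ 18 ≤ m'.int 6 * 2 * 2 ^ j := by
        rw [pow_succ] at hx
        calc T ^ 18 ≤ m'.int 6 * (2 ^ j * 2) := hx
          _ = _ := by ring
      have hlenpos : 0 < m'.real 9 0 - m'.real 8 0 := by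
        rw [hlen]
        positivity
      refine Runs.ite 20 (fun hc => ?_) (fun hc => ?_) (by decide)
      · have hc : sumVal N T m₀ mid N < 1 := by
          simpa [Test.holds, RealExp.eval, IntExp.eval, numExp, hS] using hc
        refine Runs.setReal (by decide) ⟨hF2.setReal (by norm_num), ?_⟩
        simp only [Memory.setReal_int, Memory.setReal_real, hi6, hr8, hmid1, IntExp.eval,
          Function.update_self, Nat.reduceEqDiff, if_true, if_false]
        refine ⟨hpow, by omega, hl, ?_, hL, hc.le⟩
        rw [hhalf, hmid]
        ring
      · have hc : 1 ≤ sumVal N T m₀ mid N := by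
          simpa [Test.holds, RealExp.eval, IntExp.eval, numExp, hS] using hc
        refine Runs.setReal (by decide) ⟨hF2.setReal (by norm_num), ?_⟩
        simp only [Memory.setReal_int, Memory.setReal_real, hi6, hr9, hmid1, IntExp.eval,
          Function.update_self, Nat.reduceEqDiff, if_true, if_false]
        refine ⟨hpow, by omega, ?_, ?_, hc, hH⟩
        · rw [hmid]
          linarith
        · rw [hhalf, hmid]
          ring
  · rintro j m' ⟨hF, hx, hx1, hl, hlen, hL, hH⟩ hb
    have hb : T ^ 18 ≤ m'.int 6 := by
      have : ¬ m'.int 6 < (powExp 18).eval m' := hb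
      rwa [powExp_eval, hF.1, not_lt] at this
    have hTpos : (0 : ℝ) < (T : ℝ) ^ 18 := by positivity
    have hbR : (T : ℝ) ^ 18 ≤ m'.int 6 := by exact_mod_cast hb
    have hpos : 0 ≤ 4 / (m'.int 6 : ℝ) := by positivity
    refine ⟨hF, hl, by linarith, ?_, hL, hH⟩
    rw [hlen]
    gcongr
  · refine ⟨by simpa [RealExp.eval, IntExp.eval, numExp] using hF0, ?_⟩
    simp only [Memory.setInt_int, Memory.setInt_real, Memory.setReal_real, IntExp.eval,
      RealExp.eval, numExp, Function.update_self, Nat.reduceEqDiff, if_true, if_false,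
      Nat.cast_ofNat, Nat.cast_zero, zero_sub, Nat.cast_one, one_mul]
    exact ⟨hJ, le_rfl, le_rfl, by norm_num, hlo, hhi⟩
  · have hc : (Test.intLT (.reg 6) (powExp 18)).cost = 39 := by
      simp [Test.cost, IntExp.cost, powExp]
    rw [hc]
    have : J * (39 + (N * 358 + 80) + 1) ≤ J * (N * 358 + 150) := Nat.mul_le_mul_left J (by omega)
    linarith

/-! ### The new weights -/

/-- The mixture of the updated weights at the two ends of the interval. -/
def mixExp (f : RealExp → RealExp) : RealExp :=
  .add (.mul (.cell 13 (.lit 0)) (f (.cell 8 (.lit 0))))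
    (.mul (.sub (numExp 1) (.cell 13 (.lit 0))) (f (.cell 9 (.lit 0))))

/-- Computes the new weights. -/
def weightProg : Prog :=
  .seq (sumProg 11 (.cell 8 (.lit 0))) (.seq (sumProg 12 (.cell 9 (.lit 0)))
    (.seq (.setReal 13 (.lit 0) (.div (.sub (numExp 1) (.cell 12 (.lit 0)))
        (.sub (.cell 11 (.lit 0)) (.cell 12 (.lit 0)))))
      (forLoop (.seq (.setReal 3 (.reg 5) (mixExp posExp)) (.setReal 4 (.reg 5) (mixExp negExp))))))

/-- The weight of the lower end in the mixture. -/
def mixRatio (N T : ℕ) (m : Memory) (lo hi : ℝ) : ℝ :=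
  (1 - sumVal N T m hi N) / (sumVal N T m lo N - sumVal N T m hi N)

/-- The weights are overwritten in place. This is sound because a new weight depends only on the old
weight with the same index and sign; the invariant records that the entries from `j` on are still
the old ones. -/
theorem weightProg_runs {W : ℕ} {m₀ m : Memory} (hNW : N ≤ W) (hm : Fixed T N m₀ m) :
    Runs W weightProg m (N * 1524 + 100) fun m' => m'.int 0 = T ∧ m'.int 1 = N ∧
      m'.real 5 = m₀.real 5 ∧ ∀ j < N,
      m'.real 3 j = mixRatio N T m₀ (m.real 8 0) (m.real 9 0) * posVal N T m₀ (m.real 8 0) j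
        + (1 - mixRatio N T m₀ (m.real 8 0) (m.real 9 0)) * posVal N T m₀ (m.real 9 0) j ∧
      m'.real 4 j = mixRatio N T m₀ (m.real 8 0) (m.real 9 0) * negVal N T m₀ (m.real 8 0) j
        + (1 - mixRatio N T m₀ (m.real 8 0) (m.real 9 0)) * negVal N T m₀ (m.real 9 0) j := by
  set lo := m.real 8 0 with hlo
  set hi := m.real 9 0 with hhi
  refine Runs.seq (N * 358 + 10) (N * 1166 + 90) ((sumProg_runs hNW hm (by norm_num) _ (by decide)
    lo (fun m' h => ?_)).mono ?_) (by omega)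
  · simp [RealExp.eval, IntExp.eval, h, hlo]
  rintro m₁ ⟨hF1, hS1, hr1, -⟩
  refine Runs.seq (N * 358 + 10) (N * 808 + 80) ((sumProg_runs hNW hF1 (by norm_num) _ (by decide)
    hi (fun m' h => ?_)).mono ?_) (by omega)
  · simp [RealExp.eval, IntExp.eval, h, hr1, hhi]
  rintro m₂ ⟨hF2, hS2, hr2, -⟩
  refine Runs.seq 40 (N * 808 + 40) (Runs.setReal (by decide) ?_) (by omega)
  have hr11 : m₂.real 11 = m₁.real 11 := hr2 11 (by norm_num)
  have heval : (RealExp.div (.sub (numExp 1) (.cell 12 (.lit 0)))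
        (.sub (.cell 11 (.lit 0)) (.cell 12 (.lit 0)))).eval m₂ = mixRatio N T m₀ lo hi := by
    simp [RealExp.eval, IntExp.eval, numExp, hS2, hr11, hS1, mixRatio]
  rw [heval]
  set r := mixRatio N T m₀ lo hi with hr
  have hF3 := hF2.setReal (a := 13) (i := (IntExp.lit 0).eval m₂) (v := r) (by norm_num)
  set m₃ := m₂.setReal 13 ((IntExp.lit 0).eval m₂) r with hm3
  have h8 : m₃.real 8 0 = lo := by
    simp [hm3, Memory.setReal_real, hr2, hr1, hlo]
  have h9 : m₃.real 9 0 = hi := by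
    simp [hm3, Memory.setReal_real, hr2, hr1, hhi]
  have h13 : m₃.real 13 0 = r := by
    simp [hm3, Memory.setReal_real, IntExp.eval]
  refine Runs.forLoop (Inv := fun j m' => m'.int 5 = j ∧ m'.int 0 = T ∧ m'.int 1 = N ∧
    (∀ a, a ≠ 3 → a ≠ 4 → m'.real a = m₃.real a) ∧
    (∀ i, j ≤ i → m'.real 3 i = m₀.real 3 i ∧ m'.real 4 i = m₀.real 4 i) ∧
    ∀ i < j, m'.real 3 i = r * posVal N T m₀ lo i + (1 - r) * posVal N T m₀ hi i ∧
      m'.real 4 i = r * negVal N T m₀ lo i + (1 - r) * negVal N T m₀ hi i) 800 hNW ?_ ?_ ?_ ?_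
      (by omega)
  · rintro j m' ⟨h5, h0, h1, -⟩
    exact ⟨h5, h1⟩
  · refine ⟨by simp [Memory.setInt_int], ?_, ?_, fun _ _ _ => rfl, fun i _ => ?_,
      fun i hi => by omega⟩
    · rw [Memory.setInt_int, if_neg (by norm_num), hF3.1]
    · rw [Memory.setInt_int, if_neg (by norm_num), hF3.2.1]
    · rw [Memory.setInt_real, hF3.2.2 3 (by norm_num) (by norm_num),
        hF3.2.2 4 (by norm_num) (by norm_num)]
      exact ⟨rfl, rfl⟩
  · rintro j m' hj ⟨h5, h0, h1, ha, hold, hnew⟩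
    have e6 : m'.real 6 = m₀.real 6 :=
      (ha 6 (by norm_num) (by norm_num)).trans (hF3.2.2 6 (by norm_num) (by norm_num))
    have e7 : m'.real 7 = m₀.real 7 :=
      (ha 7 (by norm_num) (by norm_num)).trans (hF3.2.2 7 (by norm_num) (by norm_num))
    have hpos : (mixExp posExp).eval m' =
        r * posVal N T m₀ lo j + (1 - r) * posVal N T m₀ hi j := by
      simp [mixExp, RealExp.eval, posExp, stepExp_eval h0 h1, IntExp.eval, numExp,
        ha 8 (by norm_num) (by norm_num), ha 9 (by norm_num) (by norm_num),
        ha 13 (by norm_num) (by norm_num), h8, h9, h13, h5, e6, e7, (hold j le_rfl).1, posVal]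
    set m₄ := m'.setReal 3 ((IntExp.reg 5).eval m') ((mixExp posExp).eval m') with hm4
    have hneg : (mixExp negExp).eval m₄ =
        r * negVal N T m₀ lo j + (1 - r) * negVal N T m₀ hi j := by
      have f0 : m₄.int 0 = T := h0
      have f1 : m₄.int 1 = N := h1
      have f5 : m₄.int 5 = j := h5
      have fa : ∀ a, a ≠ 3 → m₄.real a = m'.real a := by
        intro a ha
        rw [hm4, Memory.setReal_real, if_neg ha]
      simp [mixExp, RealExp.eval, negExp, stepExp_eval f0 f1, IntExp.eval, numExp,
        fa 8 (by norm_num), fa 9 (by norm_num), fa 13 (by norm_num), fa 6 (by norm_num),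
        fa 7 (by norm_num), fa 4 (by norm_num),
        ha 8 (by norm_num) (by norm_num), ha 9 (by norm_num) (by norm_num),
        ha 13 (by norm_num) (by norm_num), h8, h9, h13, f5, e6, e7, (hold j le_rfl).2, negVal]
    refine Runs.seq 400 400 (Runs.setReal ?_ ?_) le_rfl
    · simp only [mixExp, posExp_cost, RealExp.cost, IntExp.cost, numExp]
      norm_num
    refine Runs.setReal ?_ ⟨h5, ?_, ?_, ?_, ?_, ?_, ?_⟩
    · simp only [mixExp, negExp_cost, RealExp.cost, IntExp.cost, numExp]
      norm_num
    · simp [Memory.setInt_int]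
    · simpa [Memory.setInt_int, Memory.setReal_int] using h0
    · simpa [Memory.setInt_int, Memory.setReal_int] using h1
    · intro a ha3 ha4
      simp [Memory.setInt_real, Memory.setReal_real, ha3, ha4, ha a ha3 ha4]
    · intro i hi
      have hij : i ≠ j := by omega
      simpa [Memory.setInt_real, Memory.setReal_real, Memory.setReal_int, IntExp.eval, h5,
        Function.update_apply, hij] using hold i (by omega)
    · intro i hi
      rw [← hm4, hneg, hm4, hpos]
      by_cases hij : i = j
      · subst hij
        simp [Memory.setInt_real, Memory.setReal_real, Memory.setReal_int, IntExp.eval, h5]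
      · simpa [Memory.setInt_real, Memory.setReal_real, Memory.setReal_int, IntExp.eval, h5,
          Function.update_apply, hij] using hnew i (by omega)
  · rintro m' ⟨-, h0, h1, ha, -, hnew⟩
    exact ⟨h0, h1, (ha 5 (by norm_num) (by norm_num)).trans (hF3.2.2 5 (by norm_num) (by norm_num)),
      hnew⟩

end Update


/-! ### The mixture is an accurate update -/

theorem abs_corrected_le {l η : ℝ} (hl : |l| ≤ 1) (hη0 : 0 ≤ η) (hη : η ≤ 1 / 64) :
    |l + 32 * η * l ^ 2| ≤ 3 / 2 := by
  have h1 : l ^ 2 ≤ 1 := by rw [← sq_abs]; exact pow_le_one₀ (abs_nonneg _) hl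
  have h2 : 32 * η * l ^ 2 ≤ 1 / 2 := by nlinarith [sq_nonneg l]
  have h3 : 0 ≤ 32 * η * l ^ 2 := by positivity
  have := abs_add_le l (32 * η * l ^ 2)
  rw [abs_of_nonneg h3] at this
  linarith

/-- Clipping is 1-Lipschitz. An unclipped weight is at most 2 and falls by at most the fraction `η
(hi - lo)` with `η ≤ 1/64`, which is well within the factor `1/4`. -/
theorem clippedStep_sub_le {E : Type} {c : ℝ} {η g w : E → ℝ} {lo hi : ℝ} {e : E} (hη0 : 0 < η e)
    (hη : η e ≤ 1 / 64) (hg : |g e| ≤ 3 / 2) (hw0 : 0 ≤ w e) (hw1 : w e ≤ 1) (hlo : -2 ≤ lo)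
    (hle : lo ≤ hi) : clippedStep c η g w lo e - clippedStep c η g w hi e ≤ (hi - lo) / 4 := by
  set A := w e * Real.exp (-(η e * (g e + lo))) with hA
  set B := w e * Real.exp (-(η e * (g e + hi))) with hB
  have hA0 : 0 ≤ A := by positivity
  have hBA : A * (1 - η e * (hi - lo)) ≤ B := by
    have h1 : B = A * Real.exp (-(η e * (hi - lo))) := by
      rw [hA, hB, mul_assoc, ← Real.exp_add]
      congr 2
      ring
    rw [h1]
    refine mul_le_mul_of_nonneg_left ?_ hA0
    have := Real.add_one_le_exp (-(η e * (hi - lo)))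
    linarith
  have hA2 : A ≤ 2 := by
    have h1 : -(η e * (g e + lo)) ≤ 7 / 128 := by
      have : -(7 / 2) ≤ g e + lo := by linarith [(abs_le.1 hg).1]
      nlinarith
    have h2 : Real.exp (-(η e * (g e + lo))) ≤ 2 := by
      refine (Real.exp_le_exp.2 h1).trans ((exp_le_quadratic ?_).trans (by norm_num))
      rw [abs_of_nonneg] <;> norm_num
    calc A ≤ 1 * 2 := mul_le_mul hw1 h2 (Real.exp_pos _).le zero_le_one
      _ = 2 := one_mul 2
  have hdiff : A - B ≤ (hi - lo) / 4 := by
    have h1 : 0 ≤ η e * (hi - lo) := mul_nonneg hη0.le (by linarith)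
    have h2 : η e * (hi - lo) ≤ 1 / 64 * (hi - lo) :=
      mul_le_mul_of_nonneg_right hη (by linarith)
    nlinarith
  change max c A - max c B ≤ _
  rw [sub_le_iff_le_add]
  refine max_le ?_ ?_
  · have := le_max_left c B
    linarith
  · have := le_max_right c B
    linarith

/-- The exact multiplier lies between `lo` and `hi`, so by monotonicity the exact weights lie
between the two clipped vectors in every coordinate, and so does the mixture. The mixture ratio is
chosen to make the sum exactly 1, which neither end point need satisfy. -/
theorem mixture_isMsMwCUpdate {E : Type} [Fintype E] {T : ℕ} {V l w w' : E → ℝ} {lo hi : ℝ}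
    (hT : 0 < T) (hd : 0 < Fintype.card E) (hw : w ∈ truncSimplex E T) (hl : ∀ e, |l e| ≤ 1)
    (hlo : -2 ≤ lo) (hle : lo ≤ hi) (hlen : hi - lo ≤ 4 / (T : ℝ) ^ 18)
    (clip : ℝ → E → ℝ) (hclip : clip = clippedStep (1 / ((Fintype.card E : ℝ) * T))
      (fun e => learningRate E T (V e)) (fun e => l e + 32 * learningRate E T (V e) * l e ^ 2) w)
    (hS : 1 ≤ ∑ e, clip lo e) (hS' : ∑ e, clip hi e ≤ 1)
    (hw' : ∀ e, w' e = (1 - ∑ e, clip hi e) / (∑ e, clip lo e - ∑ e, clip hi e) * clip lo e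
      + (1 - (1 - ∑ e, clip hi e) / (∑ e, clip lo e - ∑ e, clip hi e)) * clip hi e) :
    IsMsMwCUpdate T (1 / (T : ℝ) ^ 18) V l w w' := by
  set c := 1 / ((Fintype.card E : ℝ) * T) with hcdef
  have hc : 0 < c := by positivity
  set η : E → ℝ := fun e => learningRate E T (V e) with hηdef
  have hη : ∀ e, 0 < η e := fun e => learningRate_pos T _
  have hη' : ∀ e, η e ≤ 1 / 64 := fun e => learningRate_le T _
  have hw0 : ∀ e, 0 < w e := fun e => hc.trans_le (hw.1 e)
  have hw1 : ∀ e, w e ≤ 1 := by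
    intro e
    rw [← hw.2]
    exact Finset.single_le_sum (fun e _ => (hw0 e).le) (Finset.mem_univ e)
  set Slo := ∑ e, clip lo e with hSlo
  set Shi := ∑ e, clip hi e with hShi
  set r := (1 - Shi) / (Slo - Shi) with hr
  have hr0 : 0 ≤ r := div_nonneg (by linarith) (by linarith)
  have hr1 : r ≤ 1 := div_le_one_of_le₀ (by linarith) (by linarith)
  have hrS : r * Slo + (1 - r) * Shi = 1 := by
    -- If the two sums coincide, both are 1; the ratio is then `0 / 0`, but any ratio gives the sum
    -- 1.
    rcases (hS'.trans hS).eq_or_lt with h | h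
    · have h1 : Shi = 1 := le_antisymm hS' (h ▸ hS)
      rw [← h, h1]
      ring
    · have : r * (Slo - Shi) = 1 - Shi := div_mul_cancel₀ _ (by linarith)
      linarith
  have hge : ∀ s e, c ≤ clip s e := by
    intro s e
    rw [hclip]
    exact le_max_left _ _
  have hanti : ∀ e, Antitone fun s => clip s e := by
    intro e
    rw [hclip]
    exact clippedStep_antitone hη (fun e => (hw0 e).le) e
  obtain ⟨s, hs, hsum⟩ : ∃ s ∈ Set.Icc lo hi, ∑ e, clip s e = 1 := by
    have hcont : Continuous fun s => ∑ e, clip s e := by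
      rw [hclip]
      unfold clippedStep
      fun_prop
    exact intermediate_value_Icc' hle hcont.continuousOn ⟨hS', hS⟩
  refine ⟨⟨fun e => ?_, ?_⟩, clip s, ⟨hge s, hsum⟩, ?_, fun e => ?_⟩
  · rw [hw']
    nlinarith [hge lo e, hge hi e]
  · simp only [hw', Finset.sum_add_distrib, ← Finset.mul_sum]
    exact hrS
  · rw [hclip] at hsum ⊢
    exact isMinOn_clippedStep hη hc hw0 hsum
  · have h1 : clip hi e ≤ clip s e := hanti e hs.2
    have h2 : clip s e ≤ clip lo e := hanti e hs.1
    have h3 : clip lo e - clip hi e ≤ (hi - lo) / 4 := by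
      rw [hclip]
      exact clippedStep_sub_le (hη e) (hη' e) (abs_corrected_le (hl e) (hη e).le (hη' e)) (hw0 e).le
        (hw1 e) hlo hle
    have h4 : (hi - lo) / 4 ≤ 1 / (T : ℝ) ^ 18 := by
      calc (hi - lo) / 4 ≤ 4 / (T : ℝ) ^ 18 / 4 := by gcongr
        _ = _ := by ring
    rw [hw', abs_le]
    constructor <;> nlinarith

/-! ### The program -/

/-- The initial weights. -/
def initProg : Prog :=
  forLoop (.seq (.setReal 3 (.reg 5) (.div (numExp 1) (.ofInt (.mul (.lit 2) (.reg 1)))))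
    (.setReal 4 (.reg 5) (.div (numExp 1) (.ofInt (.mul (.lit 2) (.reg 1))))))

/-- The update of a round. -/
def updateProg : Prog := .seq gainProg (.seq rateProg (.seq bisectProg weightProg))

/-- The calibration algorithm as a program. -/
def calibrationProg : ForecastProg := ⟨initProg, predictProg, updateProg⟩

section Program

variable {N T : ℕ}

theorem initProg_runs {W : ℕ} (hNW : N ≤ W) :
    Runs W initProg (inputMemory T N) (N * 28 + 6) fun m' => m'.int 0 = T ∧ m'.int 1 = N ∧
      (∀ j, m'.real 5 j = 0) ∧
      ∀ j < N, m'.real 3 j = 1 / (2 * N : ℝ) ∧ m'.real 4 j = 1 / (2 * N : ℝ) := by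
  refine Runs.forLoop (Inv := fun j m' => m'.int 5 = j ∧ m'.int 0 = T ∧ m'.int 1 = N ∧
    (∀ j, m'.real 5 j = 0) ∧
    ∀ i < j, m'.real 3 i = 1 / (2 * N : ℝ) ∧ m'.real 4 i = 1 / (2 * N : ℝ)) 20 hNW ?_ ?_ ?_ ?_ le_rfl
  · rintro j m' ⟨h5, -, h1, -⟩
    exact ⟨h5, h1⟩
  · simp [Memory.setInt_int, Memory.setInt_real, inputMemory]
  · rintro j m' hj ⟨h5, h0, h1, hz, hnew⟩
    refine Runs.seq 10 10 (Runs.setReal (by decide) ?_) le_rfl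
    refine Runs.setReal (by decide) ⟨h5, ?_, ?_, ?_, ?_, ?_⟩
    · simp [Memory.setInt_int]
    · simpa [Memory.setInt_int, Memory.setReal_int] using h0
    · simpa [Memory.setInt_int, Memory.setReal_int] using h1
    · simpa [Memory.setInt_real, Memory.setReal_real] using hz
    · intro i hi
      by_cases hij : i = j
      · subst hij
        simp [Memory.setInt_real, Memory.setReal_real, Memory.setReal_int, IntExp.eval,
          RealExp.eval, numExp, h5, h1]
      · simpa [Memory.setInt_real, Memory.setReal_real, Memory.setReal_int, IntExp.eval, h5,
          Function.update_apply, hij] using hnew i (by omega)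
  · rintro m' ⟨-, h0, h1, hz, hnew⟩
    exact ⟨h0, h1, hz, hnew⟩

/-- Announced masses add up when `k₀ = k₁`, so the formula also covers point masses. -/
theorem storedGain_eq_cellGain {m : Memory} {P : PMF (Fin (T + 1))}
    (hP : Announces (uniformPartition N) m P) (y : Bool) (i : Fin N) :
    storedGain N T (m.int 2) (m.int 3) (if y then 1 else 0) (m.real 0 0) i = cellGain P y i := by
  obtain ⟨k₀, k₁, h2, h3, -, -, hk, -⟩ := hP
  have hy : (((if y then 1 else 0 : ℕ) : ℕ) : ℝ) = outcome y := by
    cases y <;> simp [outcome]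
  simp only [cellGain, hk, add_mul, Finset.sum_add_distrib, ite_mul, zero_mul,
    Finset.sum_ite_eq', Finset.mem_univ, if_true]
  rw [storedGain, h2, h3, hy]
  simp only [inCell, gridPoint, ite_mul, one_mul, zero_mul, mul_ite, mul_zero]

/-- The state of the memory between two rounds. -/
def Ready (N T : ℕ) (m : Memory) : Prop :=
  m.int 0 = T ∧ m.int 1 = N ∧ storedWeight N m ∈ truncSimplex (Expert N) T

theorem sum_expert (f : Expert N → ℝ) : ∑ e, f e = ∑ i : Fin N, (f (i, 1) + f (i, -1)) := by
  rw [Fintype.sum_prod_type]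
  exact Finset.sum_congr rfl fun i _ => sum_units _

theorem updateProg_runs {W J : ℕ} {m₀ m : Memory} {P : PMF (Fin (T + 1))} (hN : 0 < N) (hT : 2 ≤ T)
    (hNW : N ≤ W) (hTW : 2 * T ^ 18 ≤ W) (hJ : T ^ 18 ≤ 2 ^ J) (hm₀ : Ready N T m₀)
    (hm : SameWeights T N m₀ m) (hP : Announces (uniformPartition N) m P) (y : Bool) :
    Runs W updateProg (m.setInt 4 (if y then 1 else 0)) (J * (N * 358 + 150) + N * 1744 + 312)
      fun m' => Ready N T m' ∧
      (∀ i < N, m'.real 5 i = m₀.real 5 i +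
        storedGain N T (m.int 2) (m.int 3) (if y then 1 else 0) (m.real 0 0) i ^ 2) ∧
      IsMsMwCUpdate T (1 / (T : ℝ) ^ 18) (fun e : Expert N => m₀.real 5 e.1)
        (fun e => -expertGain (uniformPartition N) P y e) (storedWeight N m₀) (storedWeight N m') := by
  have hT0 : 0 < T := by omega
  have hneg : (-1 : ℤˣ) ≠ 1 := by decide
  obtain ⟨hs0, hs1, hs3, hs4, hs5⟩ := hm
  refine Runs.seq (N * 12 + 106) (J * (N * 358 + 150) + N * 1732 + 206)
    ((gainProg_runs (T := T) hNW ?_ ?_).mono ?_) (by omega)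
  · rw [Memory.setInt_int, if_neg (by norm_num), hs0]
  · rw [Memory.setInt_int, if_neg (by norm_num), hs1]
  rintro m₁ ⟨g0, g1, g3, g4, g5, g6⟩
  simp only [Memory.setInt_int, Memory.setInt_real, Nat.reduceEqDiff, if_true, if_false, hs3, hs4,
    hs5] at g3 g4 g5 g6
  refine Runs.seq (N * 208 + 6) (J * (N * 358 + 150) + N * 1524 + 200)
    ((rateProg_runs (T := T) hNW g0 g1).mono ?_) (by omega)
  rintro m₂ ⟨r0, r1, r3, r4, r6, r7⟩
  have hF : Fixed T N m₂ m₂ := ⟨r0, r1, fun _ _ _ => rfl⟩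
  set V : Expert N → ℝ := fun e => m₀.real 5 e.1 with hV
  set l : Expert N → ℝ := fun e => -expertGain (uniformPartition N) P y e with hl
  set w := storedWeight N m₀ with hw
  have hG : ∀ i : Fin N, m₂.real 6 i = cellGain P y i := by
    intro i
    rw [r6, g6 i i.2, storedGain_eq_cellGain hP]
  have hl1 : ∀ e, |l e| ≤ 1 := by
    intro e
    rw [hl, abs_neg]
    exact (abs_expertGain_le hT0 P y e).trans (cellMass_le_one hT0 P e.1)
  set clip : ℝ → Expert N → ℝ := clippedStep (1 / ((Fintype.card (Expert N) : ℝ) * T))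
    (fun e => learningRate (Expert N) T (V e))
    (fun e => l e + 32 * learningRate (Expert N) T (V e) * l e ^ 2) w with hclip
  have hc : 1 / ((2 * N * T : ℕ) : ℝ) = 1 / ((Fintype.card (Expert N) : ℝ) * T) := by
    rw [card_expert]
    push_cast
    ring
  have hη : ∀ i : Fin N, m₂.real 7 i = learningRate (Expert N) T (m₀.real 5 i) := by
    intro i
    rw [(r7 i i.2).1, g5]
  have hpos : ∀ s, ∀ i : Fin N, posVal N T m₂ s i = clip s (i, 1) := by
    intro s i
    simp only [posVal, stepVal, hclip, clippedStep, hc, r3, g3, hη, hG, hw, storedWeight, if_true,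
      hV, hl, expertGain_eq hT0, signValue, Units.val_one, Int.cast_one, one_mul]
  have hnegv : ∀ s, ∀ i : Fin N, negVal N T m₂ s i = clip s (i, -1) := by
    intro s i
    simp only [negVal, stepVal, hclip, clippedStep, hc, r4, g4, hη, hG, hw, storedWeight, hneg,
      if_false, hV, hl, expertGain_eq hT0, signValue, Units.val_neg, Units.val_one, Int.cast_neg,
      Int.cast_one, neg_mul, one_mul, neg_neg]
  have hsum : ∀ s, sumVal N T m₂ s N = ∑ e, clip s e := by
    intro s
    rw [sum_expert, sumVal, Finset.sum_range]
    exact Finset.sum_congr rfl fun i _ => by rw [hpos, hnegv]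
  have hrate : ∀ e : Expert N, 0 < learningRate (Expert N) T (V e) := fun e => learningRate_pos T _
  have hcpos : 0 < 1 / ((Fintype.card (Expert N) : ℝ) * T) := by
    rw [card_expert]
    positivity
  have hw0 : ∀ e, 0 ≤ w e := fun e => hcpos.le.trans (hm₀.2.2.1 e)
  -- The corrected losses are at most `3/2` in absolute value, so the multiplier lies in `[-3/2,
  -- 3/2]`, inside the initial bracket `[-2, 2]` of the bisection.
  obtain ⟨s, hs, hs1'⟩ := exists_clippedStep_sum_eq hrate hcpos hm₀.2.2.1 hm₀.2.2.2
    (fun e => abs_corrected_le (hl1 e) (hrate e).le (learningRate_le T _)) (by norm_num)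
  have hanti : ∀ a b, a ≤ b → ∑ e, clip b e ≤ ∑ e, clip a e := fun a b hab =>
    Finset.sum_le_sum fun e _ => clippedStep_antitone hrate hw0 e hab
  refine Runs.seq (J * (N * 358 + 150) + 100) (N * 1524 + 100) ((bisectProg_runs hNW hTW hT0 hF hJ
    ?_ ?_).mono ?_) (by omega)
  · rw [hsum]
    calc (1 : ℝ) = ∑ e, clip s e := hs1'.symm
      _ ≤ _ := hanti _ _ (by linarith [hs.1])
  · rw [hsum]
    calc ∑ e, clip 2 e ≤ ∑ e, clip s e := hanti _ _ (by linarith [hs.2])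
      _ = 1 := hs1'
  rintro m₃ ⟨hF3, hlo, hle, hlen, hSlo, hShi⟩
  refine (weightProg_runs hNW hF3).mono ?_
  rintro m₄ ⟨e0, e1, e5, e34⟩
  rw [hsum] at hSlo hShi
  simp only [mixRatio, hsum] at e34
  have hupd : IsMsMwCUpdate T (1 / (T : ℝ) ^ 18) V l w (storedWeight N m₄) := by
    refine mixture_isMsMwCUpdate hT0 (by rw [card_expert]; omega) hm₀.2.2 hl1 hlo hle hlen clip hclip
      hSlo hShi ?_
    rintro ⟨i, σ⟩
    rcases Int.units_eq_one_or σ with rfl | rfl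
    · rw [← hpos, ← hpos, ← (e34 i i.2).1]
      rfl
    · rw [← hnegv, ← hnegv, ← (e34 i i.2).2]
      rfl
  refine ⟨⟨e0, e1, hupd.1⟩, fun i hi => ?_, hupd⟩
  rw [e5, (r7 i hi).2, g5, g6 i hi]

/-- The forecaster is read off from the memory: its weights are the stored ones and its distribution
is the announced one, so it is implemented by construction. What has to be proved is that it obeys
the rules of the algorithm. -/
theorem exists_implementation {W J : ℕ} (hN : 0 < N) (hT : 2 ≤ T) (hNW : N ≤ W)
    (hTW : 2 * T ^ 18 ≤ W) (hJ : T ^ 18 ≤ 2 ^ J) (B : ℝ)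
    (hB : ((J * (N * 358 + 150) + N * 1744 + J * 50 + 562 : ℕ) : ℝ) ≤ B) :
    ∃ F : Forecaster N T, IsCalibrationAlgorithm (1 / (T : ℝ) ^ 18) (uniformPartition N) F ∧
      Implements calibrationProg W B (uniformPartition N) F := by
  have hT0 : 0 < T := by omega
  have hTT : T ≤ T ^ 18 := Nat.le_self_pow (by norm_num) T
  obtain ⟨n₀, m₀, hexec₀, hn₀, hi0, hi1, hz, hw₀⟩ := initProg_runs (T := T) hNW
  have hstored : ∀ e, storedWeight N m₀ e = 1 / (Fintype.card (Expert N) : ℝ) := by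
    rintro ⟨i, σ⟩
    rw [card_expert]
    unfold storedWeight
    push_cast
    split_ifs
    · exact (hw₀ i i.2).1
    · exact (hw₀ i i.2).2
  have hready : Ready N T m₀ := by
    refine ⟨hi0, hi1, fun e => ?_, ?_⟩
    · rw [hstored, card_expert]
      push_cast
      have : (1 : ℝ) ≤ T := by exact_mod_cast hT0
      refine one_div_le_one_div_of_le (by positivity) (le_mul_of_one_le_right (by positivity) this)
    · have : (Fintype.card (Expert N) : ℝ) ≠ 0 := by rw [card_expert]; positivity
      simp only [hstored, Finset.sum_const, Finset.card_univ, nsmul_eq_mul]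
      field_simp
  -- Quantifying over all memories that are ready for a round, rather than over reachable ones,
  -- makes the choice of successors a total function that can be iterated along any history.
  have hround : ∀ m : {m : Memory // Ready N T m}, ∃ (m' : Memory) (P : PMF (Fin (T + 1))) (n₁ : ℕ),
      Exec W predictProg m n₁ m' ∧ Announces (uniformPartition N) m' P ∧
      IsSamplingRule (potential (uniformPartition N) (storedWeight N m)) P ∧
      ∀ y : Bool, ∃ (m'' : {m : Memory // Ready N T m}) (n₂ : ℕ),
        Exec W updateProg (m'.setInt 4 (if y then 1 else 0)) n₂ m'' ∧
        ((n₁ + n₂ : ℕ) : ℝ) ≤ B ∧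
        (∀ i : Fin N, m''.1.real 5 i = m.1.real 5 i + cellGain P y i ^ 2) ∧
        IsMsMwCUpdate T (1 / (T : ℝ) ^ 18) (fun e : Expert N => m.1.real 5 e.1)
          (fun e => -expertGain (uniformPartition N) P y e) (storedWeight N m)
          (storedWeight N m'') := by
    rintro ⟨m, hm⟩
    obtain ⟨n₁, m', h1, h2, h3, h4, h5⟩ := predictProg_runs (W := W) (J := J) hm.1 hm.2.1
      (hTT.trans ((Nat.le_mul_of_pos_left _ two_pos).trans hTW)) hT0
      (hTT.trans hJ)
    obtain ⟨P, hP, hsamp⟩ := h3.exists_dist hN hT0 h4 h5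
    refine ⟨m', P, n₁, h1, hP, hsamp, fun y => ?_⟩
    obtain ⟨n₂, m'', k1, k2, k3, k4, k5⟩ := updateProg_runs hN hT hNW hTW hJ hm h3.1 hP y
    refine ⟨⟨m'', k3⟩, n₂, k1, le_trans ?_ hB, fun i => ?_, k5⟩
    · exact_mod_cast (by omega : n₁ + n₂ ≤ J * (N * 358 + 150) + N * 1744 + J * 50 + 562)
    · rw [k4 i i.2, storedGain_eq_cellGain hP]
  choose pred P n₁ hexec hann hsamp upd n₂ hexec₂ hcost hsq hupd using hround
  -- The memory follows the outcomes only: the update uses the whole sampling distribution and never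
  -- the sampled point.
  let M : List (Round T) → {m : Memory // Ready N T m} := fun h =>
    List.rec ⟨m₀, hready⟩ (fun r _ m => upd m r.1) h
  let F : Forecaster N T := ⟨fun h => storedWeight N (M h).1, fun h => P (M h)⟩
  have hMs : ∀ (r : Round T) h, M (r :: h) = upd (M h) r.1 := fun _ _ => rfl
  have hV : ∀ h, squareSum (uniformPartition N) F h = fun e => (M h).1.real 5 e.1 := by
    intro h
    funext e
    induction h with
    -- The array of squares starts at zero, as the input memory is zero and the initialization
    -- leaves it alone.
    | nil => exact (hz e.1).symm
    | cons r h ih =>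
      rw [squareSum, ih, hMs, hsq, expertGain_eq hT0, mul_pow, ← sq_abs (signValue e.2),
        abs_signValue, one_pow, one_mul]
  refine ⟨F, ⟨hstored, fun h r _ => ?_, fun h _ => hsamp (M h)⟩, fun h => (M h).1,
    ⟨n₀, hexec₀, ?_⟩, fun h _ => ⟨pred (M h), n₁ (M h), hexec (M h), hann (M h), fun r =>
      ⟨n₂ (M h) r.1, hexec₂ (M h) r.1, hcost (M h) r.1⟩⟩⟩
  · rw [hV]
    exact hupd (M h) r.1
  · refine le_trans ?_ hB
    exact_mod_cast (by omega : n₀ ≤ J * (N * 358 + 150) + N * 1744 + J * 50 + 562)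

end Program

/-! ### Word size and step count in terms of `T` and `C` -/

theorem exists_calibrationProg {T : ℕ} {δ : ℝ} {q : ℕ → unitInterval} (hT : 2 ≤ T) (hδ : 0 < δ)
    (hδ1 : δ < 1) {N : ℕ} (hN : N = gridSize T δ (deviation T q)) :
    ∃ F : Forecaster N T, IsCalibrationAlgorithm (1 / (T : ℝ) ^ 18) (uniformPartition N) F ∧
      Implements calibrationProg (T ^ 20) (10 ^ 10 * min (√(T : ℝ))
        (((T : ℝ) ^ 2 / (1 + deviation T q)) ^ (1 / 3 : ℝ)) * Real.log T ^ 1)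
        (uniformPartition N) F := by
  have hC := deviation_nonneg T q
  have hNpos : 0 < N := by rw [hN]; exact gridSize_pos hT hδ hδ1 hC
  have hNle := gridSize_le hT hδ hδ1 hC (deviation_le T q)
  rw [← hN] at hNle
  have hT2 : (2 : ℝ) ≤ T := by exact_mod_cast hT
  have hlog := half_le_log hT
  set μ := min (√(T : ℝ)) (((T : ℝ) ^ 2 / (1 + deviation T q)) ^ (1 / 3 : ℝ)) with hμ
  have hN1 : (1 : ℝ) ≤ N := by exact_mod_cast hNpos
  have hTpow : ∀ k, 2 ^ k ≤ T ^ k := fun k => Nat.pow_le_pow_left hT k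
  have hNT : N ≤ T ^ 20 := by
    have h1 : (N : ℝ) ≤ 5 * T := by
      have h2 : μ ≤ √(T : ℝ) := min_le_left _ _
      have h3 : √(T : ℝ) ≤ T := by
        rw [Real.sqrt_le_left (by linarith)]
        nlinarith
      linarith
    have h4 : N ≤ 5 * T := by exact_mod_cast h1
    calc N ≤ 5 * T := h4
      _ ≤ T ^ 19 * T := Nat.mul_le_mul_right T (le_trans (by norm_num) (hTpow 19))
      _ = T ^ 20 := by ring
  have hTW : 2 * T ^ 18 ≤ T ^ 20 := by
    calc 2 * T ^ 18 ≤ T ^ 2 * T ^ 18 := Nat.mul_le_mul_right _ (le_trans (by norm_num) (hTpow 2))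
      _ = T ^ 20 := by ring
  obtain ⟨L, hL1, hL2⟩ : ∃ L : ℕ, T ≤ 2 ^ L ∧ (L : ℝ) ≤ 4 * Real.log T := by
    refine ⟨Nat.log 2 T + 1, (Nat.lt_pow_succ_log_self one_lt_two T).le, ?_⟩
    have h1 : ((2 ^ Nat.log 2 T : ℕ) : ℝ) ≤ T := by
      exact_mod_cast Nat.pow_log_le_self 2 (by omega)
    have h2 := Real.log_le_log (by positivity) h1
    push_cast at h2 ⊢
    rw [Real.log_pow] at h2
    have h3 := Real.log_two_gt_d9
    have h4 : (0 : ℝ) ≤ Nat.log 2 T := Nat.cast_nonneg _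
    nlinarith
  -- Bisection to accuracy `T ^ (-18)` takes `18 L` halvings with `L` about `log₂ T`. This is the
  -- source of the single logarithm in the step count.
  refine exists_implementation (J := 18 * L) hNpos hT hNT hTW ?_ _ ?_
  · rw [mul_comm, pow_mul]
    exact Nat.pow_le_pow_left hL1 18
  · push_cast
    have hL0 : (0 : ℝ) ≤ L := Nat.cast_nonneg _
    have hl1 : 1 ≤ 2 * Real.log T := by linarith
    have h1 : (L : ℝ) * N ≤ 4 * Real.log T * (5 * μ) :=
      mul_le_mul hL2 hNle (by linarith) (by linarith)
    have h2 : (L : ℝ) * 1 ≤ L * N := mul_le_mul_of_nonneg_left hN1 hL0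
    have h3 : (N : ℝ) ≤ 10 * (μ * Real.log T) := by
      calc (N : ℝ) ≤ N * (2 * Real.log T) := le_mul_of_one_le_right (by linarith) hl1
        _ ≤ 5 * μ * (2 * Real.log T) := mul_le_mul_of_nonneg_right hNle (by linarith)
        _ = _ := by ring
    have h4 : 0 ≤ μ * Real.log T := by linarith
    rw [pow_one]
    linarith

end OnlineCalibration

end

/-! ### The main theorem -/

theorem mainTheorem1 :
    ∃ (a b c : ℕ) (K : ℝ) (π : OnlineCalibration.ForecastProg),
      ∀ (T : ℕ) (δ : ℝ) (q : ℕ → unitInterval), 2 ≤ T → 0 < δ → δ < 1 →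
        ∀ (C ι : ℝ) (N : ℕ), C = OnlineCalibration.deviation T q →
          ι = OnlineCalibration.confidence T δ → N = OnlineCalibration.gridSize T δ C →
          -- the calibration error, for the exact algorithm and for accurate MsMwC updates
          (∀ ε : ℝ, 0 ≤ ε → ε ≤ 1 / (T : ℝ) ^ a →
            ∀ F : OnlineCalibration.Forecaster N T,
              OnlineCalibration.IsCalibrationAlgorithm ε
                (OnlineCalibration.uniformPartition N) F →
              ENNReal.ofReal (1 - δ) ≤
                OnlineCalibration.probCalErrorLE q (OnlineCalibration.uniformPartition N) F
                  (K * (√(ι * T * Real.log T) + (ι * T * C * Real.log T) ^ (1 / 3 : ℝ)))) ∧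
          -- the computational complexity
          (∃ F : OnlineCalibration.Forecaster N T,
            OnlineCalibration.IsCalibrationAlgorithm (1 / (T : ℝ) ^ a)
              (OnlineCalibration.uniformPartition N) F ∧
            OnlineCalibration.Implements π (T ^ b)
              (K * min (√(T : ℝ)) (((T : ℝ) ^ 2 / (1 + C)) ^ (1 / 3 : ℝ)) * Real.log T ^ c)
              (OnlineCalibration.uniformPartition N) F) := by
  -- The same exponent 18 is small enough for the bisection to reach and large enough for the regret
  -- bound to tolerate the inaccuracy.
  refine ⟨18, 20, 1, 10 ^ 10, OnlineCalibration.calibrationProg, ?_⟩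
  rintro T δ q hT hδ hδ1 C ι N rfl rfl hN
  exact ⟨fun ε hε0 hε F hF => OnlineCalibration.calibration_bound hT hδ hδ1 hN hε0 hε F hF,
    OnlineCalibration.exists_calibrationProg hT hδ hδ1 hN⟩
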